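/- **Setting.** A finite probabilistic automaton (PA) consists of a finite set $S$ of states, a finite set $Act$ of actions and finitely many transitions $s\xrightarrow{a}\mu$, where $s\in S$, $a\in Act$ and $\mu$ is a sub-distribution on $S$ (total mass at most $1$). Let $l$ be the maximal number of transitions with the same label issued from a single state, and assume $l\ge 1$. For $\epsilon\ge 0$ and a relation $R$ on $S$, write $\mu\,\mathcal L^{\epsilon}(R)\,\nu$ if $\mu(E)\le\nu(R(E))+\epsilon$ for all $E\subseteq S$, where $R(E)=\{y : \exists x\in E,\ xRy\}$. **The distance.** Let $N\ge 1$, $\delta=1/N$ and $\lambda(x)=\min(x+\delta,1)$ on $[0,1]$; let $\lambda^{n}$ be the $n$-th iterate and $\lambda^{-n}(1)$ the least $x\in[0,1]$ with $\lambda^n(x)=1$. An order $n$ $(\epsilon,\lambda)$-simulation is a decreasing sequence of relations $S\times S=R_0\supseteq R_1\supseteq\dots\supseteq R_n$ such that for all $i\in\{1,\dots,n\}$, whenever $s\,R_i\,t$ and $s\xrightarrow{a}\mu$, there is $t\xrightarrow{a}\nu$ with $\mu\,\mathcal L^{\lambda^{n-i}(\epsilon)}(R_{i-1})\,\nu$.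 Write $s\prec^{\lambda,n}_\epsilon t$ if $s\,R_n\,t$ for some such sequence, and $s\sim^{\lambda,n}_\epsilon t$ if $s\prec^{\lambda,n}_\epsilon t$ and $t\prec^{\lambda,n}_\epsilon s$. The decayed distance is $$d^\lambda(s,t)=\min\{\epsilon : \epsilon=\lambda^{-n}(1)\text{ and } s\sim^{\lambda,n}_{\epsilon}t\text{ for some } n\in\mathbb N\}.$$ **Networks.** A network is a finite directed graph with a source $\bot$, a sink $\top\ne\bot$ and non-negative real capacities; a flow $f$ satisfies $0\le f\le c$ and is conserved at all vertices other than $\bot,\top$; its value is the outflow minus the inflow at $\bot$. The network $\mathcal N(\mu,\nu,R)$ has the vertices $\bot$, $\top$, $s$ and $s'$ for $s\in S$, and the edges $\bot\to s$ of capacity $\mu(s)$, $t'\to\top$ of capacity $\nu(t)$, and $s\to t'$ of capacity $1$ for $(s,t)\in R$. **Algorithm C** (input: a finite PA and $N\ge1$; output: $d:S\times S\to[0,1]$). 1. Put $\delta=1/N$, $d(s,t)=1$ for all $s,t$, and $R_1=S\times S$. 2. For $n=1,\dots,N$: - put $R_{n+1}=R_n$; - for all $(s,t)\in S\times S$, all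 $a\in Act$ and all $s\xrightarrow{a}\mu$: compute the maximum flow of $\mathcal N(\mu,\nu,R_n)$ for each $t\xrightarrow{a}\nu$; if it is at least $\mu(S)-(1-n\delta)$ for no such $\nu$, remove $(s,t)$ from $R_{n+1}$; - for all $(s,t)$ with $(s,t)\in R_{n+1}$ and $(t,s)\in R_{n+1}$, put $d(s,t)=1-n\delta$. 3. Return $d$. **Machine model.** Time is counted on a real RAM at unit cost: additions and (truncated) subtractions of natural numbers, the four operations of real arithmetic, comparisons of both kinds of numbers, Boolean connectives, tests, and accesses to two-dimensional arrays cost one step each. The states and actions are numbered, and the transitions are given in a table. **Proposition.** (i) There is a real RAM program that computes the value of a maximum flow of every network with $m$ vertices in $O(m^3)$ steps. (ii) With any such program as subroutine, Algorithm C halts, and it outputs $d(s,t)=d^\lambda(s,t)$ for all $s,t\in S$. It performs at most $N\cdot|S|^2\cdot|Act|\cdot l^2$ maximum-flow computations, and it runs in time $$O\bigl(N\cdot|S|^5\cdot|Act|\cdot l^2\bigr),$$ where the implied constant depends only on the flow subroutine. In particular, for a fixed accuracy $1/N$, Algorithm C runs in time $O(|S|^5\cdot|Act|\cdot l^2)$.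 -/

import Mathlib

/-! ## Finite probabilistic automata and the decayed distance -/

/-- A sub-distribution on the finite set `S`: its total mass is at most one. -/
structure SubDist (S : Type) [Fintype S] where
  prob : S → ℝ
  nonneg : ∀ s, 0 ≤ prob s
  sum_le_one : ∑ s, prob s ≤ 1

/-- The mass `μ(E)` of a set of states. -/
noncomputable def SubDist.mass {S : Type} [Fintype S] (μ : SubDist S) (E : Set S) : ℝ :=
  ∑ s, E.indicator μ.prob s

/-- A finite probabilistic automaton: `μ ∈ trans s a` is the transition from `s` to `μ` with
label `a`. -/
structure FinitePA (S Act : Type) [Fintype S] [Fintype Act] where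
  trans : S → Act → Finset (SubDist S)

namespace FinitePA

variable {S Act : Type} [Fintype S] [Fintype Act]

/-- The maximal number `l` of transitions with the same label issued from a single state. -/
def maxBranching (P : FinitePA S Act) : ℕ :=
  Finset.univ.sup fun p : S × Act => (P.trans p.1 p.2).card

/-- The lifting with tolerance `ε` of a relation `R`: `μ(E) ≤ ν(R(E)) + ε` for all `E ⊆ S`. -/
def Lifting (ε : ℝ) (R : S → S → Prop) (μ ν : SubDist S) : Prop :=
  ∀ E : Set S, μ.mass E ≤ ν.mass {y | ∃ x ∈ E, R x y} + ε

/-- `R 0, …, R n` is an order `n` `(ε, lam)`-simulation (the values of `R` beyond `n` are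
irrelevant). -/
def IsDecaySimulation (P : FinitePA S Act) (lam : ℝ → ℝ) (n : ℕ) (ε : ℝ)
    (R : ℕ → S → S → Prop) : Prop :=
  (∀ s t, R 0 s t) ∧
  (∀ i < n, ∀ s t, R (i + 1) s t → R i s t) ∧
  ∀ i, 1 ≤ i → i ≤ n → ∀ s t, R i s t →
    ∀ a, ∀ μ ∈ P.trans s a, ∃ ν ∈ P.trans t a, Lifting (lam^[n - i] ε) (R (i - 1)) μ ν

/-- `t` simulates `s` up to order `n`. -/
def DecaySimulated (P : FinitePA S Act) (lam : ℝ → ℝ) (n : ℕ) (ε : ℝ) (s t : S) : Prop :=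
  ∃ R : ℕ → S → S → Prop, P.IsDecaySimulation lam n ε R ∧ R n s t

/-- Order `n` `(ε, lam)`-bisimilarity: simulation in both directions. -/
def DecayBisimilar (P : FinitePA S Act) (lam : ℝ → ℝ) (n : ℕ) (ε : ℝ) (s t : S) : Prop :=
  P.DecaySimulated lam n ε s t ∧ P.DecaySimulated lam n ε t s

/-- The value of `lam⁻ⁿ(1)`: the least point of `[0, 1]` that the `n`-th iterate of `lam` sends
to `1`. -/
def IsIterPreimageOne (lam : ℝ → ℝ) (n : ℕ) (ε : ℝ) : Prop :=
  IsLeast {x | x ∈ Set.Icc (0 : ℝ) 1 ∧ lam^[n] x = 1} ε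

/-- `v` is the decayed distance of `s` and `t`, that is, the minimum of the numbers
`ε = lam⁻ⁿ(1)` for which `s` and `t` are order `n` `(ε, lam)`-bisimilar. -/
def IsDecayDistance (P : FinitePA S Act) (lam : ℝ → ℝ) (s t : S) (v : ℝ) : Prop :=
  IsLeast {ε | ∃ n, IsIterPreimageOne lam n ε ∧ P.DecayBisimilar lam n ε s t} v

/-- The linear discount with step `δ = 1 / N`: `x ↦ x + δ`, cut off at `1`. -/
noncomputable def linearDecay (N : ℕ) (x : ℝ) : ℝ := min (x + 1 / (N : ℝ)) 1

end FinitePA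

/-! ## Flow networks -/

/-- A flow network, given by its capacity function (zero outside the edges). -/
structure FlowNetwork (V : Type) [Fintype V] where
  source : V
  sink : V
  source_ne_sink : source ≠ sink
  cap : V → V → ℝ
  cap_nonneg : ∀ u v, 0 ≤ cap u v

namespace FlowNetwork

variable {V : Type} [Fintype V]

/-- Flow functions: capacity constraints, and conservation at the inner nodes. -/
def IsFlow (G : FlowNetwork V) (f : V → V → ℝ) : Prop :=
  (∀ u v, 0 ≤ f u v ∧ f u v ≤ G.cap u v) ∧
  ∀ v, v ≠ G.source → v ≠ G.sink → ∑ u, f u v = ∑ u, f v u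

/-- The value of a flow: what leaves the source minus what enters it. -/
def flowValue (G : FlowNetwork V) (f : V → V → ℝ) : ℝ :=
  ∑ v, f G.source v - ∑ v, f v G.source

/-- `x` is the value of a maximum flow of the network. -/
def IsMaxFlow (G : FlowNetwork V) (x : ℝ) : Prop :=
  IsGreatest {y | ∃ f, G.IsFlow f ∧ y = G.flowValue f} x

end FlowNetwork

/-! ## The machine model: a real RAM at unit cost

Programs work on two-dimensional arrays of natural numbers and of real numbers (names and indices
are natural numbers). Every constant, memory access, arithmetic operation, comparison, Boolean
connective, assignment and test costs one step. Natural numbers are added and subtracted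
(truncated at zero), real numbers are added, subtracted, multiplied, divided and compared exactly.
-/

namespace RealRAM

/-- A memory: `nat x i j` and `real x i j` are the cells `x[i, j]` of the array `x`. -/
structure Mem where
  nat : ℕ → ℕ → ℕ → ℕ
  real : ℕ → ℕ → ℕ → ℝ

/-- Expressions for natural numbers. -/
inductive NExp where
  | lit (k : ℕ)
  | get (x : ℕ) (i j : NExp)
  | add (a b : NExp)
  | sub (a b : NExp)

/-- Expressions for real numbers. -/
inductive RExp where
  | ofNat (a : NExp)
  | get (x : ℕ) (i j : NExp)
  | add (a b : RExp)
  | sub (a b : RExp)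
  | mul (a b : RExp)
  | div (a b : RExp)

/-- Tests. -/
inductive BExp where
  | ltNat (a b : NExp)
  | eqNat (a b : NExp)
  | leReal (a b : RExp)
  | not (b : BExp)
  | and (b c : BExp)

/-- Programs. -/
inductive Prog where
  | skip
  | setNat (x : ℕ) (i j e : NExp)
  | setReal (x : ℕ) (i j : NExp) (e : RExp)
  | seq (p q : Prog)
  | cond (b : BExp) (p q : Prog)
  | loop (b : BExp) (p : Prog)

def NExp.eval (σ : Mem) : NExp → ℕ
  | lit k => k
  | get x i j => σ.nat x (i.eval σ) (j.eval σ)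
  | add a b => a.eval σ + b.eval σ
  | sub a b => a.eval σ - b.eval σ

def NExp.cost : NExp → ℕ
  | lit _ => 1
  | get _ i j => i.cost + j.cost + 1
  | add a b => a.cost + b.cost + 1
  | sub a b => a.cost + b.cost + 1

noncomputable def RExp.eval (σ : Mem) : RExp → ℝ
  | ofNat a => (a.eval σ : ℝ)
  | get x i j => σ.real x (i.eval σ) (j.eval σ)
  | add a b => a.eval σ + b.eval σ
  | sub a b => a.eval σ - b.eval σ
  | mul a b => a.eval σ * b.eval σ
  | div a b => a.eval σ / b.eval σ

def RExp.cost : RExp → ℕ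
  | ofNat a => a.cost + 1
  | get _ i j => i.cost + j.cost + 1
  | add a b => a.cost + b.cost + 1
  | sub a b => a.cost + b.cost + 1
  | mul a b => a.cost + b.cost + 1
  | div a b => a.cost + b.cost + 1

def BExp.Holds (σ : Mem) : BExp → Prop
  | ltNat a b => a.eval σ < b.eval σ
  | eqNat a b => a.eval σ = b.eval σ
  | leReal a b => a.eval σ ≤ b.eval σ
  | not b => ¬ b.Holds σ
  | and b c => b.Holds σ ∧ c.Holds σ

def BExp.cost : BExp → ℕ
  | ltNat a b => a.cost + b.cost + 1
  | eqNat a b => a.cost + b.cost + 1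
  | leReal a b => a.cost + b.cost + 1
  | not b => b.cost + 1
  | and b c => b.cost + c.cost + 1

/-- The memory after `x[i, j] := k` for a natural number. -/
def Mem.updateNat (σ : Mem) (x i j k : ℕ) : Mem where
  nat := fun x' i' j' => if x' = x ∧ i' = i ∧ j' = j then k else σ.nat x' i' j'
  real := σ.real

/-- The memory after `x[i, j] := r` for a real number. -/
def Mem.updateReal (σ : Mem) (x i j : ℕ) (r : ℝ) : Mem where
  nat := σ.nat
  real := fun x' i' j' => if x' = x ∧ i' = i ∧ j' = j then r else σ.real x' i' j'

/-- `Run p σ σ' T`: started in the memory `σ`, the program `p` halts after exactly `T` steps in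
the memory `σ'`. -/
inductive Run : Prog → Mem → Mem → ℕ → Prop where
  | skip (σ : Mem) : Run .skip σ σ 1
  | setNat (σ : Mem) (x : ℕ) (i j e : NExp) :
      Run (.setNat x i j e) σ (σ.updateNat x (i.eval σ) (j.eval σ) (e.eval σ))
        (i.cost + j.cost + e.cost + 1)
  | setReal (σ : Mem) (x : ℕ) (i j : NExp) (e : RExp) :
      Run (.setReal x i j e) σ (σ.updateReal x (i.eval σ) (j.eval σ) (e.eval σ))
        (i.cost + j.cost + e.cost + 1)
  | seq {p q : Prog} {σ σ₁ σ₂ : Mem} {T₁ T₂ : ℕ} :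
      Run p σ σ₁ T₁ → Run q σ₁ σ₂ T₂ → Run (.seq p q) σ σ₂ (T₁ + T₂)
  | condTrue {b : BExp} {p q : Prog} {σ σ₁ : Mem} {T : ℕ} :
      b.Holds σ → Run p σ σ₁ T → Run (.cond b p q) σ σ₁ (b.cost + 1 + T)
  | condFalse {b : BExp} {p q : Prog} {σ σ₁ : Mem} {T : ℕ} :
      ¬ b.Holds σ → Run q σ σ₁ T → Run (.cond b p q) σ σ₁ (b.cost + 1 + T)
  | loopDone {b : BExp} {p : Prog} {σ : Mem} :
      ¬ b.Holds σ → Run (.loop b p) σ σ (b.cost + 1)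
  | loopStep {b : BExp} {p : Prog} {σ σ₁ σ₂ : Mem} {T₁ T₂ : ℕ} :
      b.Holds σ → Run p σ σ₁ T₁ → Run (.loop b p) σ₁ σ₂ T₂ →
        Run (.loop b p) σ σ₂ (b.cost + 1 + T₁ + T₂)

/-- Scalar variables are the cells `x[0, 0]`. -/
def nvar (x : ℕ) : NExp := .get x (.lit 0) (.lit 0)

def rvar (x : ℕ) : RExp := .get x (.lit 0) (.lit 0)

def assignNat (x : ℕ) (e : NExp) : Prog := .setNat x (.lit 0) (.lit 0) e

def assignReal (x : ℕ) (e : RExp) : Prog := .setReal x (.lit 0) (.lit 0) e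

/-- Sequential composition of a list of programs. -/
def block : List Prog → Prog
  | [] => .skip
  | p :: ps => .seq p (block ps)

/-- `for x = lo, lo + 1, …` while `x < hi`, do `p`. -/
def forRange (x : ℕ) (lo hi : NExp) (p : Prog) : Prog :=
  .seq (assignNat x lo)
    (.loop (.ltNat (nvar x) hi) (.seq p (assignNat x (.add (nvar x) (.lit 1)))))

/-! ### Maximum-flow routines

The arrays with a name below `100` belong to the calling program; those from `100` on belong to
the flow routine. -/

/-- The number of vertices of the network (a natural number). -/
def kVert : ℕ := 100
/-- The capacity matrix of the network (real). -/
def kCap : ℕ := 100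
/-- The value of the maximum flow (real, the result of the routine). -/
def kFlow : ℕ := 101

/-- The memory `σ` holds the network `G` with vertices `0, …, m - 1`, source `0` and
sink `m - 1`. -/
def HoldsNetwork (σ : Mem) {m : ℕ} (G : FlowNetwork (Fin m)) : Prop :=
  σ.nat kVert 0 0 = m ∧ (G.source : ℕ) = 0 ∧ (G.sink : ℕ) = m - 1 ∧
  ∀ u v : Fin m, σ.real kCap u v = G.cap u v

/-- The program `p` computes the value of a maximum flow of every network with `m` vertices in
`O(m ^ 3)` steps, whatever else the memory holds, and does not touch the arrays of its caller. -/
def IsCubicMaxFlow (p : Prog) : Prop :=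
  ∃ K : ℕ, ∀ (m : ℕ) (G : FlowNetwork (Fin m)) (σ : Mem), HoldsNetwork σ G →
    ∃ (σ' : Mem) (T : ℕ), Run p σ σ' T ∧ T ≤ K * m ^ 3 ∧
      G.IsMaxFlow (σ'.real kFlow 0 0) ∧
      ∀ x < 100, σ'.nat x = σ.nat x ∧ σ'.real x = σ.real x

/-! ### Algorithm C

Names of the arrays of natural numbers. -/

/-- The number of states (input). -/
def kStates : ℕ := 0
/-- The number of actions (input). -/
def kActs : ℕ := 1
/-- The number `N` of rounds (input). -/
def kRounds : ℕ := 2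
/-- `kCount[s, a]` is the number of `a`-transitions from `s` (input). -/
def kCount : ℕ := 3
/-- The `i`-th `a`-transition from `s` is row number `kBase[s, a] + i` of `kProb` (input). -/
def kBase : ℕ := 4
/-- The current relation (`1` for related pairs, `0` for the others). -/
def kRel : ℕ := 5
/-- The next relation. -/
def kNext : ℕ := 6
/-- Loop variables: round, pair of states, action, transition from `s`, transition from `t`,
and two auxiliary ones. -/
def kN : ℕ := 7
def kS : ℕ := 8
def kT : ℕ := 9
def kA : ℕ := 10
def kI : ℕ := 11
def kJ : ℕ := 12
def kU : ℕ := 13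
def kW : ℕ := 14
/-- Flag: a matching transition from `t` has been found. -/
def kFound : ℕ := 15
/-- Counter for the flow computations. -/
def kCalls : ℕ := 16

/-! Names of the arrays of real numbers. -/

/-- Row `k` of `kProb` is the sub-distribution reached by transition number `k` (input). -/
def kProb : ℕ := 0
/-- The distance matrix (output). -/
def kDist : ℕ := 1
/-- The number `δ = 1 / N`. -/
def kDelta : ℕ := 2
/-- The total mass `μ(S)`. -/
def kMass : ℕ := 3

/-- The row of the transition `μ` from `s` that is being treated. -/
def rowMu : NExp := .add (.get kBase (nvar kS) (nvar kA)) (nvar kI)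

/-- The row of the transition `ν` from `t` that is being treated. -/
def rowNu : NExp := .add (.get kBase (nvar kT) (nvar kA)) (nvar kJ)

/-- `1 - n δ` for the current round `n`. -/
def tolerance : RExp := .sub (.ofNat (.lit 1)) (.mul (.ofNat (nvar kN)) (rvar kDelta))

/-- For all pairs `(s, t)` do `p`. -/
def forPairs (p : Prog) : Prog :=
  forRange kS (.lit 0) (nvar kStates) (forRange kT (.lit 0) (nvar kStates) p)

/-- `δ := 1 / N`, and for all `(s, t)`: `d(s, t) := 1`, `R := S × S`. -/
def initialise : Prog := block [
  assignReal kDelta (.div (.ofNat (.lit 1)) (.ofNat (nvar kRounds))),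
  forPairs (block [
    .setReal kDist (nvar kS) (nvar kT) (.ofNat (.lit 1)),
    .setNat kRel (nvar kS) (nvar kT) (.lit 1)]),
  assignNat kCalls (.lit 0)]

/-- `kMass := μ(S)`. -/
def computeMass : Prog := block [
  assignReal kMass (.ofNat (.lit 0)),
  forRange kU (.lit 0) (nvar kStates)
    (assignReal kMass (.add (rvar kMass) (.get kProb rowMu (nvar kU))))]

/-- Sets up the network of `μ`, `ν` and `R`. With `n` states, the source is `0`, the state `u` is
`u + 1`, its copy is `u + n + 1`, and the sink is `n + n + 1`; the capacities are `μ(u)` from the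
source to `u`, `ν(u)` from the copy of `u` to the sink, and `1` from `u` to the copy of `w` for
every pair `(u, w)` of `R`. -/
def buildNetwork : Prog :=
  let n : NExp := nvar kStates
  let u : NExp := nvar kU
  let w : NExp := nvar kW
  block [
    assignNat kVert (.add (.add n n) (.lit 2)),
    forRange kU (.lit 0) (nvar kVert) (forRange kW (.lit 0) (nvar kVert)
      (.setReal kCap u w (.ofNat (.lit 0)))),
    forRange kU (.lit 0) n (block [
      .setReal kCap (.lit 0) (.add u (.lit 1)) (.get kProb rowMu u),
      .setReal kCap (.add (.add u n) (.lit 1)) (.add (.add n n) (.lit 1)) (.get kProb rowNu u),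
      forRange kW (.lit 0) n
        (.cond (.eqNat (.get kRel u w) (.lit 1))
          (.setReal kCap (.add u (.lit 1)) (.add (.add w n) (.lit 1)) (.ofNat (.lit 1)))
          .skip)])]

/-- If there is no `a`-transition from `t` to a `ν` such that the maximum flow of the network of
`μ`, `ν` and the current relation is at least `μ(S) - (1 - n δ)`, then the pair `(s, t)` is removed
from the next relation. -/
def treatTransition (flow : Prog) : Prog := block [
  computeMass,
  assignNat kFound (.lit 0),
  forRange kJ (.lit 0) (.get kCount (nvar kT) (nvar kA)) (block [
    buildNetwork,
    flow,
    assignNat kCalls (.add (nvar kCalls) (.lit 1)),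
    .cond (.leReal (.sub (rvar kMass) tolerance) (rvar kFlow))
      (assignNat kFound (.lit 1))
      .skip]),
  .cond (.eqNat (nvar kFound) (.lit 0))
    (.setNat kNext (nvar kS) (nvar kT) (.lit 0))
    .skip]

/-- Algorithm C, with the subroutine `flow` for maximum flows: for `n = 1, …, N`, the next relation
starts as a copy of the current one; for all pairs `(s, t)`, all actions `a` and all
`a`-transitions from `s` to some `μ`, the pair is removed if the transition is not matched; the
next relation becomes the current one, and the pairs that it contains in both directions get the
distance `1 - n δ`. -/
def algorithmC (flow : Prog) : Prog := block [
  initialise,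
  forRange kN (.lit 1) (.add (nvar kRounds) (.lit 1)) (block [
    forPairs (.setNat kNext (nvar kS) (nvar kT) (.get kRel (nvar kS) (nvar kT))),
    forPairs
      (forRange kA (.lit 0) (nvar kActs)
        (forRange kI (.lit 0) (.get kCount (nvar kS) (nvar kA))
          (treatTransition flow))),
    forPairs (.setNat kRel (nvar kS) (nvar kT) (.get kNext (nvar kS) (nvar kT))),
    forPairs
      (.cond (.and (.eqNat (.get kRel (nvar kS) (nvar kT)) (.lit 1))
          (.eqNat (.get kRel (nvar kT) (nvar kS)) (.lit 1)))
        (.setReal kDist (nvar kS) (nvar kT) tolerance)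
        .skip)])]

/-- The memory `σ` holds the automaton `P`, with states `0, …, n - 1` and actions `0, …, k - 1`,
and the number `N`. The transitions with a given source and label are listed without repetition;
the rest of the memory is arbitrary. -/
def HoldsInput (σ : Mem) {n k : ℕ} (P : FinitePA (Fin n) (Fin k)) (N : ℕ) : Prop :=
  σ.nat kStates 0 0 = n ∧ σ.nat kActs 0 0 = k ∧ σ.nat kRounds 0 0 = N ∧
  ∀ (s : Fin n) (a : Fin k),
    ∃ e : Fin (σ.nat kCount s a) ≃ {μ // μ ∈ P.trans s a},
      ∀ (i : Fin (σ.nat kCount s a)) (u : Fin n),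
        σ.real kProb (σ.nat kBase s a + i) u = (e i).1.prob u

end RealRAM

/-! The algorithm is correct because the tolerances do not depend on the order of the simulation.
With λ(x) = min(x + δ, 1) and ε = 1 - nδ one has λ^{n-i}(ε) = 1 - iδ, whatever n is. Hence a single
decreasing sequence of relations, `decayRel`, which starts with S × S and is refined in step i with
tolerance 1 - iδ, contains the largest simulation of every order n ≤ N. For n > N the number
λ^{-n}(1) is 0, and the last N levels of an order n simulation already lie below the sequence
(`DecaySimulated.decayRel`, `decaySimulated_of_decayRel`). So the distance is 1 - jδ for the last j
≤ N at which the pair is related in both directions (`isDecayDistance_of_last`), and this is the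
value that the successive overwriting of d leaves behind.

Each refinement step is a question about flows (`IsMaxFlow.sub_le_iff_lifting`). The cut made of the
source, E and the copies of R(E) has capacity μ(S) - μ(E) + ν(R(E)). A cut crossed by an edge of R
has capacity at least μ(S), because such an edge has capacity 1 and μ(E) ≤ 1. Therefore the minimum
cut is at least μ(S) - ε exactly when the lifting holds. The equality of maximum flow and minimum
cut is itself a by-product of the flow program.

That program is a push-relabel routine which sweeps cyclically over the inner vertices. A bound H
for the heights of the active vertices drops by one after each sweep and grows by one with each
relabelling, so there are O(m²) sweeps of O(m) vertices each. A potential that is at most 9m³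
initially and decreases with every step makes this precise (`haltsWithin_sweepStep`). Empty height
levels serve twice: they bound the heights (`height_lt`) and they exhibit a saturated cut at the end
(`exists_flow_cut`).

Running times are tracked by `HaltsWithin`, with one rule for counting loops. A network has 2n + 2
vertices, so a flow costs O(n³); the nested loops contribute the factor N n² |Act| l². -/

namespace RealRAM

/-! ### Total correctness with time bounds -/

/-- Started in `σ`, the program `p` halts after at most `T` steps in a memory that satisfies
`Q`. -/
def HaltsWithin (p : Prog) (σ : Mem) (T : ℕ) (Q : Mem → Prop) : Prop :=
  ∃ (σ' : Mem) (t : ℕ), Run p σ σ' t ∧ t ≤ T ∧ Q σ'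

theorem HaltsWithin.mono {p : Prog} {σ : Mem} {T T' : ℕ} {Q Q' : Mem → Prop}
    (h : HaltsWithin p σ T Q) (hT : T ≤ T') (hQ : ∀ σ', Q σ' → Q' σ') :
    HaltsWithin p σ T' Q' := by
  obtain ⟨σ', t, hr, ht, hq⟩ := h
  exact ⟨σ', t, hr, ht.trans hT, hQ _ hq⟩

theorem HaltsWithin.seq {p q : Prog} {σ : Mem} {T₁ T₂ : ℕ} {Q : Mem → Prop}
    (h : HaltsWithin p σ T₁ fun σ₁ => HaltsWithin q σ₁ T₂ Q) :
    HaltsWithin (.seq p q) σ (T₁ + T₂) Q := by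
  obtain ⟨σ₁, t₁, hr₁, ht₁, σ₂, t₂, hr₂, ht₂, hq⟩ := h
  exact ⟨σ₂, t₁ + t₂, .seq hr₁ hr₂, by omega, hq⟩

/-- The weakest precondition of a program without loops. -/
def Prog.wp : Prog → (Mem → Prop) → Mem → Prop
  | .skip, Q, σ => Q σ
  | .setNat x i j e, Q, σ => Q (σ.updateNat x (i.eval σ) (j.eval σ) (e.eval σ))
  | .setReal x i j e, Q, σ => Q (σ.updateReal x (i.eval σ) (j.eval σ) (e.eval σ))
  | .seq p q, Q, σ => p.wp (q.wp Q) σ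
  | .cond b p q, Q, σ => (b.Holds σ → p.wp Q σ) ∧ (¬ b.Holds σ → q.wp Q σ)
  | .loop _ _, _, _ => False

/-- A bound for the running time of a program without loops. -/
def Prog.maxCost : Prog → ℕ
  | .skip => 1
  | .setNat _ i j e => i.cost + j.cost + e.cost + 1
  | .setReal _ i j e => i.cost + j.cost + e.cost + 1
  | .seq p q => p.maxCost + q.maxCost
  | .cond b p q => b.cost + 1 + (p.maxCost + q.maxCost)
  -- Any value would do: the weakest precondition of a loop is `False`, so this bound is never
  -- invoked for one.
  | .loop _ _ => 0

theorem haltsWithin_of_wp {p : Prog} : ∀ {σ : Mem} {Q : Mem → Prop},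
    p.wp Q σ → HaltsWithin p σ p.maxCost Q := by
  induction p with
  | skip => exact fun h => ⟨_, _, .skip _, le_rfl, h⟩
  | setNat x i j e => exact fun h => ⟨_, _, .setNat _ x i j e, le_rfl, h⟩
  | setReal x i j e => exact fun h => ⟨_, _, .setReal _ x i j e, le_rfl, h⟩
  | seq p q hp hq => exact fun h => ((hp h).mono le_rfl fun _ h => hq h).seq
  | cond b p q hp hq =>
    intro σ Q h
    by_cases hb : b.Holds σ
    · obtain ⟨σ', t, hr, ht, hQ⟩ := hp (h.1 hb)
      exact ⟨σ', _, .condTrue hb hr, by simp only [Prog.maxCost]; omega, hQ⟩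
    · obtain ⟨σ', t, hr, ht, hQ⟩ := hq (h.2 hb)
      exact ⟨σ', _, .condFalse hb hr, by simp only [Prog.maxCost]; omega, hQ⟩
  | loop b p => exact fun h => h.elim

theorem HaltsWithin.seq_skip {p : Prog} {σ : Mem} {T : ℕ} {Q : Mem → Prop}
    (h : HaltsWithin p σ T Q) : HaltsWithin (.seq p .skip) σ (T + 1) Q :=
  (h.mono le_rfl fun _ h => haltsWithin_of_wp (p := .skip) h).seq

/-- A loop whose body decreases a potential. -/
theorem haltsWithin_loop {b : BExp} {p : Prog} (I : Mem → Prop) (Φ : Mem → ℕ) (c : ℕ)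
    (step : ∀ σ, I σ → b.Holds σ → HaltsWithin p σ c fun σ' => I σ' ∧ Φ σ' < Φ σ)
    (σ : Mem) (hσ : I σ) :
    HaltsWithin (.loop b p) σ ((b.cost + 1 + c) * (Φ σ + 1)) fun σ' => I σ' ∧ ¬ b.Holds σ' := by
  induction hk : Φ σ using Nat.strong_induction_on generalizing σ with
  | _ k ih =>
    by_cases hb : b.Holds σ
    · obtain ⟨σ₁, t₁, hr₁, ht₁, hI, hlt⟩ := step σ hσ hb
      obtain ⟨σ₂, t₂, hr₂, ht₂, hQ⟩ := ih (Φ σ₁) (hk ▸ hlt) σ₁ hI rfl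
      refine ⟨σ₂, _, .loopStep hb hr₁ hr₂, ?_, hQ⟩
      have : (b.cost + 1 + c) * (Φ σ₁ + 1) ≤ (b.cost + 1 + c) * k :=
        Nat.mul_le_mul_left _ (by omega)
      calc b.cost + 1 + t₁ + t₂ ≤ (b.cost + 1 + c) + (b.cost + 1 + c) * k := by omega
        _ = _ := by ring
    · refine ⟨σ, _, .loopDone hb, ?_, hσ, hb⟩
      exact (Nat.le_add_right _ _).trans (Nat.le_mul_of_pos_right _ (Nat.succ_pos _))

@[simp] theorem updateNat_real (σ : Mem) (x i j k : ℕ) : (σ.updateNat x i j k).real = σ.real := rfl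

@[simp] theorem updateReal_nat (σ : Mem) (x i j : ℕ) (r : ℝ) :
    (σ.updateReal x i j r).nat = σ.nat := rfl

@[simp] theorem updateNat_nat_self (σ : Mem) (x i j k : ℕ) :
    (σ.updateNat x i j k).nat x i j = k := by simp [Mem.updateNat]

theorem updateNat_nat_apply (σ : Mem) (x i j k i' j' : ℕ) :
    (σ.updateNat x i j k).nat x i' j' = if i' = i ∧ j' = j then k else σ.nat x i' j' := by
  simp [Mem.updateNat]

theorem updateNat_nat_of_ne (σ : Mem) {x y : ℕ} (i j k : ℕ) (h : y ≠ x) :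
    (σ.updateNat x i j k).nat y = σ.nat y := by
  funext i' j'; simp [Mem.updateNat, h]

@[simp] theorem updateReal_real_self (σ : Mem) (x i j : ℕ) (r : ℝ) :
    (σ.updateReal x i j r).real x i j = r := by simp [Mem.updateReal]

theorem updateReal_real_apply (σ : Mem) (x i j : ℕ) (r : ℝ) (i' j' : ℕ) :
    (σ.updateReal x i j r).real x i' j' = if i' = i ∧ j' = j then r else σ.real x i' j' := by
  simp [Mem.updateReal]

theorem updateReal_real_of_ne (σ : Mem) {x y : ℕ} (i j : ℕ) (r : ℝ) (h : y ≠ x) :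
    (σ.updateReal x i j r).real y = σ.real y := by
  funext i' j'; simp [Mem.updateReal, h]

@[simp] theorem nvar_eval (σ : Mem) (x : ℕ) : (nvar x).eval σ = σ.nat x 0 0 := rfl

@[simp] theorem rvar_eval (σ : Mem) (x : ℕ) : (rvar x).eval σ = σ.real x 0 0 := rfl

/-- A counting loop with an invariant: `I i` holds whenever the loop variable has the value
`i`. -/
theorem haltsWithin_forRange {x : ℕ} {lo hi : NExp} {p : Prog} {σ : Mem} {Q : Mem → Prop}
    (I : ℕ → Mem → Prop) (a b M c : ℕ) (hlo : lo.eval σ = a) (hab : a ≤ b)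
    (hM : b - a ≤ M) (hM1 : 1 ≤ M) (hc : 1 ≤ c) (hloc : lo.cost ≤ 10) (hhic : hi.cost ≤ 10)
    (init : I a (σ.updateNat x 0 0 a))
    (hhi : ∀ i σ, I i σ → σ.nat x 0 0 = i → hi.eval σ = b)
    (step : ∀ i σ, a ≤ i → i < b → I i σ → σ.nat x 0 0 = i →
      HaltsWithin p σ c fun σ' => σ'.nat x 0 0 = i ∧ I (i + 1) (σ'.updateNat x 0 0 (i + 1)))
    (hQ : ∀ σ', I b σ' → Q σ') :
    HaltsWithin (forRange x lo hi p) σ (100 * (M * c)) Q := by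
  -- The index of the invariant is read off from the loop variable itself, so that the general loop
  -- rule applies with potential `b - x`.
  set J : Mem → Prop := fun σ => a ≤ σ.nat x 0 0 ∧ σ.nat x 0 0 ≤ b ∧ I (σ.nat x 0 0) σ with hJ
  have key := haltsWithin_loop (b := .ltNat (nvar x) hi)
    (p := .seq p (assignNat x (.add (nvar x) (.lit 1)))) J
    (fun σ => b - σ.nat x 0 0) (c + 8) ?_ (σ.updateNat x 0 0 a)
    ⟨by simp, by simpa using hab, by simpa using init⟩
  · have h1 : HaltsWithin (assignNat x lo) σ (lo.cost + 3) fun σ' => σ' = σ.updateNat x 0 0 a := by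
      refine (haltsWithin_of_wp (p := assignNat x lo) (Q := fun σ' => σ' = σ.updateNat x 0 0 a)
        ?_).mono ?_ fun _ h => h
      · simp [assignNat, Prog.wp, NExp.eval, hlo]
      · simp only [assignNat, Prog.maxCost, NExp.cost]; omega
    have h2 := key.mono (Q' := Q) le_rfl ?_
    · refine (h1.mono le_rfl fun σ' hσ' => (by rw [hσ']; exact h2)).seq.mono ?_ fun _ h => h
      simp only [updateNat_nat_self, BExp.cost, nvar, NExp.cost]
      -- One iteration costs at most 23 + c ≤ 24c steps, and there are at most M + 1 ≤ 2M tests. The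
      -- assumptions 1 ≤ M and 1 ≤ c absorb the overhead even when the loop is empty.
      have h2' : (1 + 1 + 1 + hi.cost + 1 + 1 + (c + 8)) * (b - a + 1)
          ≤ (24 * c) * (2 * M) := Nat.mul_le_mul (by omega) (by omega)
      have h3 : 1 ≤ M * c := Nat.mul_pos hM1 hc
      have h4 : (24 * c) * (2 * M) = 48 * (M * c) := by ring
      omega
    · rintro σ' ⟨⟨-, hle, hI⟩, hn⟩
      have : σ'.nat x 0 0 = b := by
        simp only [BExp.Holds, nvar_eval, hhi _ _ hI rfl] at hn
        omega
      exact hQ _ (this ▸ hI)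
  · rintro τ ⟨h1, h2, h3⟩ hb
    have hlt : τ.nat x 0 0 < b := by
      simpa only [BExp.Holds, nvar_eval, hhi _ _ h3 rfl] using hb
    refine ((step _ τ h1 hlt h3 rfl).mono le_rfl fun τ' hτ' => ?_).seq
    refine (haltsWithin_of_wp (p := assignNat x (.add (nvar x) (.lit 1))) ?_).mono (T' := 8) ?_
      fun _ h => h
    · simp only [assignNat, Prog.wp, NExp.eval, nvar_eval, hτ'.1, hJ, updateNat_nat_self]
      exact ⟨⟨by omega, by omega, hτ'.2⟩, by omega⟩
    · simp [assignNat, Prog.maxCost, NExp.cost, nvar]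

end RealRAM

/-! ## Cuts and preflows -/

/-- The terms with both ends in `U` cancel in pairs, so only what crosses the boundary of `U`
survives. This serves both for weak duality and for preflows. -/
theorem sum_sum_eq_of_antisymm {V : Type} [DecidableEq V] {A U : Finset V} (hU : U ⊆ A)
    (g : V → V → ℝ) (hg : ∀ u ∈ A, ∀ v ∈ A, g u v = -g v u) :
    ∑ u ∈ U, ∑ v ∈ A, g u v = ∑ u ∈ U, ∑ v ∈ A \ U, g u v := by
  have h0 : ∑ u ∈ U, ∑ v ∈ U, g u v = 0 := by
    have h1 : ∑ u ∈ U, ∑ v ∈ U, g u v = -∑ u ∈ U, ∑ v ∈ U, g u v := by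
      conv_lhs => rw [Finset.sum_comm]
      rw [← Finset.sum_neg_distrib]
      refine Finset.sum_congr rfl fun u hu => ?_
      rw [← Finset.sum_neg_distrib]
      exact Finset.sum_congr rfl fun v hv => hg v (hU hv) u (hU hu)
    linarith
  have h2 : ∀ u, ∑ v ∈ A, g u v = ∑ v ∈ A \ U, g u v + ∑ v ∈ U, g u v := fun u =>
    (Finset.sum_sdiff hU).symm
  simp only [h2, Finset.sum_add_distrib, h0, add_zero]

namespace FlowNetwork

/-- The capacity of the cut `(U, Uᶜ)`. -/
def cutCap {V : Type} [Fintype V] [DecidableEq V] (G : FlowNetwork V) (U : Finset V) : ℝ :=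
  ∑ u ∈ U, ∑ v ∈ Uᶜ, G.cap u v

/-- Weak duality: summing the net outflow over `U` leaves only the source, by conservation, and the
same sum counts the net flow across the cut. -/
theorem flowValue_le_cutCap {V : Type} [Fintype V] [DecidableEq V] {G : FlowNetwork V}
    {f : V → V → ℝ} (hf : G.IsFlow f) {U : Finset V} (hs : G.source ∈ U) (ht : G.sink ∉ U) :
    G.flowValue f ≤ G.cutCap U := by
  have h1 : ∑ u ∈ U, ∑ v, (f u v - f v u) = G.flowValue f := by
    rw [Finset.sum_eq_single_of_mem _ hs, flowValue, Finset.sum_sub_distrib]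
    intro u hu hne
    rw [Finset.sum_sub_distrib, hf.2 u hne (fun h => ht (h ▸ hu)), sub_self]
  rw [← h1, sum_sum_eq_of_antisymm (Finset.subset_univ U) _ (fun u _ v _ => by ring), cutCap,
    ← Finset.compl_eq_univ_sdiff]
  refine Finset.sum_le_sum fun u _ => Finset.sum_le_sum fun v _ => ?_
  linarith [(hf.1 u v).2, (hf.1 v u).1]

/-- A preflow on the vertices `0, …, m - 1` with capacities `c`, source `0` and sink `m - 1`, given
by its residual capacities `r`, with excesses `e` and a valid height function `d`. -/
structure IsPreflow (m : ℕ) (c r : ℕ → ℕ → ℝ) (e : ℕ → ℝ) (d : ℕ → ℕ) : Prop where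
  two_le : 2 ≤ m
  cap_nonneg : ∀ u < m, ∀ v < m, 0 ≤ c u v
  nonneg : ∀ u < m, ∀ v < m, 0 ≤ r u v
  symm : ∀ u < m, ∀ v < m, r u v + r v u = c u v + c v u
  -- The source is excluded: the program never initialises its excess.
  excess_eq : ∀ v < m, v ≠ 0 → e v = ∑ u ∈ Finset.range m, (c u v - r u v)
  excess_nonneg : ∀ v < m, v ≠ 0 → 0 ≤ e v
  height_source : d 0 = m
  height_sink : d (m - 1) = 0
  valid : ∀ u < m, ∀ v < m, 0 < r u v → d u ≤ d v + 1

namespace IsPreflow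

variable {m : ℕ} {c r : ℕ → ℕ → ℝ} {e : ℕ → ℝ} {d : ℕ → ℕ}

/-- Pigeonhole: there are m - 1 levels but only m - 2 inner vertices; the sink has height 0 and the
source is kept out by the hypothesis. It is used with a = m to bound heights and with a = 0 to find
a cut. -/
theorem exists_gap (h : IsPreflow m c r e d) {a : ℕ} (ha : d 0 ∉ Finset.Ico (a + 1) (a + m)) :
    ∃ k ∈ Finset.Ico (a + 1) (a + m), ∀ v < m, d v ≠ k := by
  by_contra! hcon
  have hm := h.two_le
  have hsub : Finset.Ico (a + 1) (a + m) ⊆ (Finset.Ico 1 (m - 1)).image d := by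
    intro k hk
    obtain ⟨v, hv, rfl⟩ := hcon k hk
    refine Finset.mem_image_of_mem d ?_
    rw [Finset.mem_Ico]
    have h0 : v ≠ 0 := by rintro rfl; exact ha hk
    have h1 : v ≠ m - 1 := by
      rintro rfl
      rw [h.height_sink, Finset.mem_Ico] at hk
      omega
    omega
  have := (Finset.card_le_card hsub).trans Finset.card_image_le
  simp only [Nat.card_Ico] at this
  omega

/-- If no residual edge leaves `U`, every edge out of `U` is saturated and every edge into `U`
carries no flow. So the net inflow of `U` is minus the capacity leaving it. -/
theorem sum_net_eq (h : IsPreflow m c r e d) {U : Finset ℕ} (hU : U ⊆ Finset.range m)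
    (hr : ∀ v ∈ U, ∀ u ∈ Finset.range m \ U, r v u = 0) :
    ∑ v ∈ U, ∑ u ∈ Finset.range m, (c u v - r u v)
      = -∑ v ∈ U, ∑ u ∈ Finset.range m \ U, c v u := by
  rw [sum_sum_eq_of_antisymm hU, ← Finset.sum_neg_distrib]
  · refine Finset.sum_congr rfl fun v hv => ?_
    rw [← Finset.sum_neg_distrib]
    refine Finset.sum_congr rfl fun u hu => ?_
    have h1 := h.symm v (Finset.mem_range.1 (hU hv)) u
      (Finset.mem_range.1 (Finset.mem_sdiff.1 hu).1)
    have h2 := hr v hv u hu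
    linarith
  · intro u hu v hv
    linarith [h.symm u (Finset.mem_range.1 hu) v (Finset.mem_range.1 hv)]

/-- The vertices above an empty level have no residual edges to the others. -/
theorem residual_eq_zero_of_gap (h : IsPreflow m c r e d) {k : ℕ} (hk : ∀ v < m, d v ≠ k) :
    ∀ v ∈ (Finset.range m).filter (k < d ·),
      ∀ u ∈ Finset.range m \ (Finset.range m).filter (k < d ·), r v u = 0 := by
  intro v hv u hu
  simp only [Finset.mem_filter, Finset.mem_sdiff, Finset.mem_range, not_and, not_lt] at hv hu
  by_contra hne
  have h1 := h.valid v hv.1 u hu.1 (lt_of_le_of_ne (h.nonneg v hv.1 u hu.1) (Ne.symm hne))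
  have h2 := hu.2 hu.1
  have h3 := hk u hu.1
  omega

/-- An empty level between m and 2m cuts off a set of vertices above it that contains `v` but not
the source. Its total excess is minus a capacity, hence not positive, which contradicts 0 < e v.
This replaces the usual residual path from an active vertex back to the source. -/
theorem height_lt (h : IsPreflow m c r e d) {v : ℕ} (hv : v < m) (he : 0 < e v) :
    d v < 2 * m := by
  by_contra! hd
  obtain ⟨k, hk, hgap⟩ := h.exists_gap (a := m) (by simp [h.height_source])
  rw [Finset.mem_Ico] at hk
  set U := (Finset.range m).filter (k < d ·) with hUdef
  have hU : U ⊆ Finset.range m := Finset.filter_subset _ _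
  have hmem : ∀ u ∈ U, u < m ∧ u ≠ 0 := by
    intro u hu
    rw [hUdef, Finset.mem_filter, Finset.mem_range] at hu
    refine ⟨hu.1, ?_⟩
    rintro rfl
    have := h.height_source
    omega
  have h1 := h.sum_net_eq hU (h.residual_eq_zero_of_gap hgap)
  have h2 : 0 ≤ ∑ v ∈ U, ∑ u ∈ Finset.range m \ U, c v u :=
    Finset.sum_nonneg fun v hv => Finset.sum_nonneg fun u hu =>
      h.cap_nonneg v (hmem v hv).1 u (Finset.mem_range.1 (Finset.mem_sdiff.1 hu).1)
  have h3 : 0 < ∑ v ∈ U, e v :=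
    Finset.sum_pos' (fun u hu => h.excess_nonneg u (hmem u hu).1 (hmem u hu).2)
      ⟨v, by rw [hUdef, Finset.mem_filter, Finset.mem_range]; exact ⟨hv, by omega⟩, he⟩
  have h4 : ∑ v ∈ U, e v = ∑ v ∈ U, ∑ u ∈ Finset.range m, (c u v - r u v) :=
    Finset.sum_congr rfl fun u hu => h.excess_eq u (hmem u hu).1 (hmem u hu).2
  linarith

/-- Moving `x` units of excess along an admissible edge. -/
theorem push (h : IsPreflow m c r e d) {p w : ℕ} (hp : p < m) (hp0 : p ≠ 0) (hw : w < m)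
    (hd : d p = d w + 1) {x : ℝ} (hx : 0 ≤ x) (hxr : x ≤ r p w) (hxe : x ≤ e p)
    {r' : ℕ → ℕ → ℝ} {e' : ℕ → ℝ}
    (hr1 : r' p w = r p w - x) (hr2 : r' w p = r w p + x)
    (hr3 : ∀ u v, ¬ (u = p ∧ v = w) → ¬ (u = w ∧ v = p) → r' u v = r u v)
    (he1 : e' p = e p - x) (he2 : e' w = e w + x) (he3 : ∀ v, v ≠ p → v ≠ w → e' v = e v) :
    IsPreflow m c r' e' d := by
  have hpw : p ≠ w := by rintro rfl; omega
  refine ⟨h.two_le, h.cap_nonneg, ?_, ?_, ?_, ?_, h.height_source, h.height_sink, ?_⟩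
  · intro u hu v hv
    have := h.nonneg u hu v hv
    by_cases h1 : u = p ∧ v = w
    · rw [h1.1, h1.2, hr1]; linarith
    by_cases h2 : u = w ∧ v = p
    · rw [h2.1, h2.2] at this ⊢; rw [hr2]; linarith
    · rwa [hr3 _ _ h1 h2]
  · intro u hu v hv
    have := h.symm u hu v hv
    by_cases h1 : u = p ∧ v = w
    · rw [h1.1, h1.2] at this ⊢; rw [hr1, hr2]; linarith
    by_cases h2 : u = w ∧ v = p
    · rw [h2.1, h2.2] at this ⊢; rw [hr1, hr2]; linarith
    · rw [hr3 _ _ h1 h2, hr3 _ _ (fun h => h2 ⟨h.2, h.1⟩) (fun h => h1 ⟨h.2, h.1⟩), this]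
  · intro v hv hv0
    have hsum := h.excess_eq v hv hv0
    by_cases h1 : v = p
    · subst h1
      have hrest : ∑ u ∈ (Finset.range m).erase w, (c u v - r' u v)
          = ∑ u ∈ (Finset.range m).erase w, (c u v - r u v) :=
        Finset.sum_congr rfl fun u hu => by
          rw [hr3 u v (fun h => hpw h.2) (fun h => Finset.ne_of_mem_erase hu h.1)]
      rw [he1, hsum, ← Finset.add_sum_erase _ _ (Finset.mem_range.2 hw),
        ← Finset.add_sum_erase _ (fun u => c u v - r' u v) (Finset.mem_range.2 hw), hr2, hrest]
      ring
    by_cases h2 : v = w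
    · subst h2
      have hrest : ∑ u ∈ (Finset.range m).erase p, (c u v - r' u v)
          = ∑ u ∈ (Finset.range m).erase p, (c u v - r u v) :=
        Finset.sum_congr rfl fun u hu => by
          rw [hr3 u v (fun h => Finset.ne_of_mem_erase hu h.1) (fun h => hpw h.2.symm)]
      rw [he2, hsum, ← Finset.add_sum_erase _ _ (Finset.mem_range.2 hp),
        ← Finset.add_sum_erase _ (fun u => c u v - r' u v) (Finset.mem_range.2 hp), hr1, hrest]
      ring
    · rw [he3 v h1 h2, hsum]
      exact Finset.sum_congr rfl fun u _ => by rw [hr3 u v (fun h => h2 h.2) (fun h => h1 h.2)]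
  · intro v hv hv0
    have := h.excess_nonneg v hv hv0
    by_cases h1 : v = p
    · rw [h1, he1]; linarith
    by_cases h2 : v = w
    · rw [h2] at this ⊢; rw [he2]; linarith
    · rwa [he3 v h1 h2]
  · intro u hu v hv hpos
    by_cases h1 : u = p ∧ v = w
    · rw [h1.1, h1.2]; omega
    by_cases h2 : u = w ∧ v = p
    -- The only residual edge that a push can create is the reverse one, which goes up one level.
    · rw [h2.1, h2.2]; omega
    · exact h.valid u hu v hv (by rwa [hr3 _ _ h1 h2] at hpos)

/-- Raising a vertex without admissible edges. -/
theorem relabel (h : IsPreflow m c r e d) {p : ℕ} (hp0 : p ≠ 0) (hp : p + 1 < m)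
    (hadm : ∀ v < m, 0 < r p v → d p ≤ d v) {d' : ℕ → ℕ} (hd : d' p = d p + 1)
    (hd' : ∀ v, v ≠ p → d' v = d v) : IsPreflow m c r e d' := by
  refine ⟨h.two_le, h.cap_nonneg, h.nonneg, h.symm, h.excess_eq, h.excess_nonneg, ?_, ?_, ?_⟩
  · rw [hd' 0 hp0.symm, h.height_source]
  · rw [hd' _ (by omega), h.height_sink]
  · intro u hu v hv hpos
    have h1 := h.valid u hu v hv hpos
    by_cases hup : u = p
    · subst hup
      have h2 := hadm v hv hpos
      by_cases hvp : v = u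
      · subst hvp; omega
      · rw [hd, hd' v hvp]; omega
    · rw [hd' u hup]
      by_cases hvp : v = p
      · subst hvp; omega
      · rw [hd' v hvp]; exact h1

/-- A preflow without active vertices is a flow, and its heights show a cut that it saturates. -/
theorem exists_flow_cut (h : IsPreflow m c r e d) (hact : ∀ v, v ≠ 0 → v + 1 < m → e v = 0)
    (G : FlowNetwork (Fin m)) (hs : (G.source : ℕ) = 0) (ht : (G.sink : ℕ) = m - 1)
    (hc : ∀ u v : Fin m, c u v = G.cap u v) :
    ∃ U : Finset (Fin m), G.source ∈ U ∧ G.sink ∉ U ∧ e (m - 1) = G.cutCap U ∧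
      G.IsMaxFlow (e (m - 1)) := by
  have hm := h.two_le
  have hnet : ∀ v < m, v ≠ 0 → v + 1 < m → ∑ u ∈ Finset.range m, (c u v - r u v) = 0 :=
    fun v hv h0 h1 => by rw [← h.excess_eq v hv h0, hact v h0 h1]
  -- The net inflows of all vertices add up to zero, and only the source and the sink are
  -- unbalanced.
  have htot : ∑ u ∈ Finset.range m, (c u 0 - r u 0) = -e (m - 1) := by
    have h1 := h.sum_net_eq (Finset.Subset.refl _) (by simp)
    rw [Finset.sdiff_self] at h1
    simp only [Finset.sum_empty, Finset.sum_const_zero, neg_zero] at h1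
    have h01 : (0 : ℕ) ≠ m - 1 := by omega
    rw [Finset.sum_eq_add_of_mem 0 (m - 1) (by simp; omega) (by simp; omega) h01,
      ← h.excess_eq (m - 1) (by omega) (by omega)] at h1
    · linarith
    · intro v hv hne
      have := Finset.mem_range.1 hv
      exact hnet v this hne.1 (by omega)
  -- The empty level lies strictly between the sink, at height 0, and the source, at height m, so it
  -- separates them.
  obtain ⟨k, hk, hgap⟩ := h.exists_gap (a := 0) (by simp [h.height_source])
  rw [Finset.mem_Ico] at hk
  set U := (Finset.range m).filter (k < d ·) with hUdef
  have hU : U ⊆ Finset.range m := Finset.filter_subset _ _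
  have hmem : ∀ u : ℕ, u ∈ U ↔ u < m ∧ k < d u := fun u => by
    rw [hUdef, Finset.mem_filter, Finset.mem_range]
  have hU0 : 0 ∈ U := (hmem 0).2 ⟨by omega, by rw [h.height_source]; omega⟩
  have hU1 : m - 1 ∉ U := fun hx => by
    have := ((hmem _).1 hx).2
    rw [h.height_sink] at this
    omega
  -- Within `U` only the source is unbalanced, so the capacity of the cut is the excess of the sink.
  have hcut := h.sum_net_eq hU (h.residual_eq_zero_of_gap hgap)
  rw [Finset.sum_eq_single_of_mem 0 hU0, htot, neg_inj] at hcut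
  swap
  · intro v hv hne
    have hv' := ((hmem v).1 hv).1
    exact hnet v hv' hne (by
      have : v ≠ m - 1 := fun hx => hU1 (hx ▸ hv)
      omega)
  have hsum : ∀ g : ℕ → ℝ, ∀ W : Finset ℕ, W ⊆ Finset.range m → ∑ u ∈ W, g u =
      ∑ u ∈ Finset.univ.filter (fun u : Fin m => (u : ℕ) ∈ W), g u := by
    intro g W hW
    refine (Finset.sum_bij (fun (u : Fin m) _ => (u : ℕ)) ?_ ?_ ?_ ?_).symm
    · intro u hu; exact (Finset.mem_filter.1 hu).2
    · intro u _ v _ huv; exact Fin.ext huv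
    · intro u hu
      exact ⟨⟨u, Finset.mem_range.1 (hW hu)⟩, by simpa using hu, rfl⟩
    · intro u _; rfl
  set U' : Finset (Fin m) :=
    Finset.univ.filter (fun u : Fin m => (u : ℕ) ∈ U) with hU'
  have hsU : G.source ∈ U' := by simp [hU', hs, hU0]
  have htU : G.sink ∉ U' := by simp [hU', ht, hU1]
  have hval : e (m - 1) = G.cutCap U' := by
    rw [hcut, cutCap, hsum _ U hU]
    refine Finset.sum_congr rfl fun u _ => ?_
    rw [hsum _ _ Finset.sdiff_subset]
    refine Finset.sum_congr ?_ fun v _ => hc u v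
    ext v
    simp [hU']
  refine ⟨U', hsU, htU, hval, ?_, ?_⟩
  -- The net flow c - r is antisymmetric and may be negative; its positive part is a genuine flow
  -- with the same net values.
  · refine ⟨fun u v => max (c u v - r u v) 0, ⟨fun u v => ⟨le_max_right _ _, max_le ?_ ?_⟩, ?_⟩, ?_⟩
    · rw [hc]; linarith [h.nonneg u u.2 v v.2]
    · exact G.cap_nonneg u v
    all_goals
      have hdiff : ∀ u v : Fin m, max (c u v - r u v) 0 - max (c v u - r v u) 0
          = c u v - r u v := by
        intro u v
        have h1 : c v u - r v u = -(c u v - r u v) := by linarith [h.symm u u.2 v v.2]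
        rw [h1]
        rcases le_total (c u v - r u v) 0 with h2 | h2
        · rw [max_eq_right h2, max_eq_left (by linarith)]; ring
        · rw [max_eq_left h2, max_eq_right (by linarith)]; ring
    · intro v hvs hvt
      have hv0 : (v : ℕ) ≠ 0 := fun hx => hvs (Fin.ext (hx.trans hs.symm))
      have hv1 : (v : ℕ) ≠ m - 1 := fun hx => hvt (Fin.ext (hx.trans ht.symm))
      rw [← sub_eq_zero, ← Finset.sum_sub_distrib]
      simp only [hdiff]
      have := hnet v v.2 hv0 (by have := v.2; omega)
      rwa [← Fin.sum_univ_eq_sum_range (fun u => c u v - r u v)] at this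
    · rw [flowValue, ← neg_inj, neg_sub, ← Finset.sum_sub_distrib]
      simp only [hdiff]
      simp only [hs]
      rw [← htot, ← Fin.sum_univ_eq_sum_range (fun u => c u 0 - r u 0)]
  · rintro y ⟨f, hf, rfl⟩
    rw [hval]
    exact flowValue_le_cutCap hf hsU htU

end IsPreflow

end FlowNetwork

/-! ### Sweeps, current arcs and the potential -/

namespace FlowNetwork

/-- A preflow during a sweep over the inner vertices: `cur` are the current arcs, `p` is the vertex
being discharged, and `H` bounds the heights of the active vertices. -/
structure IsSweepState (m : ℕ) (c r : ℕ → ℕ → ℝ) (e : ℕ → ℝ) (d cur : ℕ → ℕ) (p H : ℕ) : Prop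
    extends IsPreflow m c r e d where
  arc_le : ∀ u < m, cur u ≤ m
  arc : ∀ u < m, ∀ v < m, v < cur u → 0 < r u v → d u ≤ d v
  height_le : ∀ v < m, d v ≤ 2 * m
  pos_ne : p ≠ 0
  pos_lt : p < m
  -- A vertex already passed in this sweep can be active again only through a push from a higher
  -- active vertex, so it satisfies a bound that is stronger by one. This gain is what lowers `H` at
  -- the end of the sweep; `H = 0` means that no vertex is active.
  bound : ∀ v, v ≠ 0 → v + 1 < m → 0 < e v → (v < p → d v + 1 < H) ∧ (p ≤ v → d v < H)

/-- The potential that bounds the number of remaining steps. -/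
def sweepPotential (m : ℕ) (d cur : ℕ → ℕ) (p H : ℕ) : ℕ :=
  -- The weights are balanced so that every step wins. A relabelling frees 2m + 1 and spends at most
  -- m on resetting the current arc and m on raising `H`. The end of a sweep frees m and spends less
  -- than m on returning to vertex 1. All other steps advance the arc or the vertex and gain 1.
  ∑ v ∈ Finset.range m, ((2 * m - d v) * (2 * m + 1) + (m - cur v)) + m * H + (m - p)

theorem sum_range_add_eq_of_eq_off {m p : ℕ} (hp : p < m) {F F' : ℕ → ℕ}
    (h : ∀ v, v ≠ p → F' v = F v) :
    ∑ v ∈ Finset.range m, F' v + F p = ∑ v ∈ Finset.range m, F v + F' p := by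
  rw [← Finset.add_sum_erase _ F' (Finset.mem_range.2 hp),
    ← Finset.add_sum_erase _ F (Finset.mem_range.2 hp),
    Finset.sum_congr rfl fun v hv => h v (Finset.ne_of_mem_erase hv)]
  ring

theorem sweepPotential_advanceArc {m : ℕ} {d cur cur' : ℕ → ℕ} {p : ℕ} (H : ℕ) (hp : p < m)
    (hlt : cur p < m) (h1 : cur' p = cur p + 1) (h2 : ∀ v, v ≠ p → cur' v = cur v) :
    sweepPotential m d cur' p H < sweepPotential m d cur p H := by
  have := sum_range_add_eq_of_eq_off hp
    (F := fun v => (2 * m - d v) * (2 * m + 1) + (m - cur v))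
    (F' := fun v => (2 * m - d v) * (2 * m + 1) + (m - cur' v)) fun v hv => by simp only [h2 v hv]
  simp only [h1] at this
  simp only [sweepPotential]
  omega

theorem sweepPotential_relabel {m : ℕ} {d cur d' cur' : ℕ → ℕ} {p : ℕ} (H : ℕ) (hp : p < m)
    (hd : d p < 2 * m) (h1 : cur' p = 0) (h2 : ∀ v, v ≠ p → cur' v = cur v)
    (h3 : d' p = d p + 1) (h4 : ∀ v, v ≠ p → d' v = d v) :
    sweepPotential m d' cur' p (H + 1) < sweepPotential m d cur p H := by
  have := sum_range_add_eq_of_eq_off hp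
    (F := fun v => (2 * m - d v) * (2 * m + 1) + (m - cur v))
    (F' := fun v => (2 * m - d' v) * (2 * m + 1) + (m - cur' v))
    fun v hv => by simp only [h2 v hv, h4 v hv]
  obtain ⟨k, hk⟩ : ∃ k, 2 * m - d p = k + 1 := ⟨2 * m - d p - 1, by omega⟩
  have hk' : 2 * m - (d p + 1) = k := by omega
  have hk2 : (k + 1) * (2 * m + 1) = k * (2 * m + 1) + (2 * m + 1) := by ring
  have hH : m * (H + 1) = m * H + m := by ring
  simp only [h1, h3, hk, hk', hk2] at this
  simp only [sweepPotential, hH]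
  omega

theorem sweepPotential_next {m : ℕ} {d cur : ℕ → ℕ} {p : ℕ} (H : ℕ) (hp : p < m) :
    sweepPotential m d cur (p + 1) H < sweepPotential m d cur p H := by
  simp only [sweepPotential]; omega

theorem sweepPotential_wrap {m : ℕ} {d cur : ℕ → ℕ} {p H : ℕ} (hp : p < m) (hH : 0 < H) :
    sweepPotential m d cur 1 (H - 1) < sweepPotential m d cur p H := by
  obtain ⟨k, rfl⟩ : ∃ k, H = k + 1 := ⟨H - 1, by omega⟩
  simp only [sweepPotential, Nat.add_sub_cancel, mul_add, mul_one]; omega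

theorem sweepPotential_le {m : ℕ} (d cur : ℕ → ℕ) :
    sweepPotential m d cur 1 1 ≤ 9 * m ^ 3 := by
  rcases Nat.eq_zero_or_pos m with rfl | hm
  · simp [sweepPotential]
  have h1 : ∑ v ∈ Finset.range m, ((2 * m - d v) * (2 * m + 1) + (m - cur v))
      ≤ m * ((2 * m) * (2 * m + 1) + m) := by
    refine (Finset.sum_le_card_nsmul _ _ ((2 * m) * (2 * m + 1) + m) fun v _ => ?_).trans ?_
    · exact Nat.add_le_add (Nat.mul_le_mul_right _ (Nat.sub_le _ _)) (Nat.sub_le _ _)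
    · simp
  have h2 : m * m * 1 ≤ m * m * m := Nat.mul_le_mul_left _ hm
  have h3 : m * 1 ≤ m * m := Nat.mul_le_mul_left _ hm
  have h4 : m * ((2 * m) * (2 * m + 1) + m) = 4 * (m * m * m) + 3 * (m * m) := by ring
  have h5 : m ^ 3 = m * m * m := by ring
  simp only [sweepPotential]
  omega

namespace IsSweepState

variable {m : ℕ} {c r : ℕ → ℕ → ℝ} {e : ℕ → ℝ} {d cur : ℕ → ℕ} {p H : ℕ}

theorem next (h : IsSweepState m c r e d cur p H) (hp : p + 1 < m) (he : e p ≤ 0) :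
    IsSweepState m c r e d cur (p + 1) H := by
  refine ⟨h.toIsPreflow, h.arc_le, h.arc, h.height_le, by omega, hp, fun v hv0 hv1 hev => ?_⟩
  have hb := h.bound v hv0 hv1 hev
  have hne : v ≠ p := by rintro rfl; linarith
  exact ⟨fun hlt => hb.1 (by omega), fun hle => hb.2 (by omega)⟩

/-- At the sink all inner vertices have been passed, so the stronger half of `bound` holds for all
of them and `H` may drop by one. -/
theorem wrap (h : IsSweepState m c r e d cur p H) (hp : ¬ p + 1 < m) :
    IsSweepState m c r e d cur 1 (H - 1) := by
  have hm := h.two_le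
  refine ⟨h.toIsPreflow, h.arc_le, h.arc, h.height_le, by omega, by omega,
    fun v hv0 hv1 hev => ⟨fun _ => by omega, fun _ => ?_⟩⟩
  have := (h.bound v hv0 hv1 hev).1 (by omega)
  omega

theorem advanceArc (h : IsSweepState m c r e d cur p H) (hlt : cur p < m)
    (hadm : 0 < r p (cur p) → d p ≤ d (cur p)) {cur' : ℕ → ℕ} (h1 : cur' p = cur p + 1)
    (h2 : ∀ v, v ≠ p → cur' v = cur v) : IsSweepState m c r e d cur' p H := by
  refine ⟨h.toIsPreflow, fun u hu => ?_, fun u hu v hv hvc hpos => ?_, h.height_le, h.pos_ne,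
    h.pos_lt, h.bound⟩
  · by_cases hup : u = p
    · subst hup; omega
    · rw [h2 u hup]; exact h.arc_le u hu
  · by_cases hup : u = p
    · subst hup
      rw [h1] at hvc
      rcases Nat.lt_succ_iff_lt_or_eq.1 hvc with hlt' | rfl
      · exact h.arc u hu v hv hlt' hpos
      · exact hadm hpos
    · rw [h2 u hup] at hvc
      exact h.arc u hu v hv hvc hpos

/-- An exhausted current arc means that no edge from `p` is admissible, and since inadmissibility
persists under raising other vertices, the arcs need resetting only at `p`. Raising by a single
level costs exactly one unit of `H`; `height_lt` keeps the new height at most 2m. -/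
theorem relabelPos (h : IsSweepState m c r e d cur p H) (hp : p + 1 < m) (hcur : ¬ cur p < m)
    (he : 0 < e p) {d' cur' : ℕ → ℕ} (h1 : cur' p = 0) (h2 : ∀ v, v ≠ p → cur' v = cur v)
    (h3 : d' p = d p + 1) (h4 : ∀ v, v ≠ p → d' v = d v) :
    IsSweepState m c r e d' cur' p (H + 1) := by
  have hle : ∀ v, d v ≤ d' v := fun v => by
    by_cases hv : v = p
    · subst hv; omega
    · rw [h4 v hv]
  refine ⟨h.toIsPreflow.relabel h.pos_ne hp (fun v hv hpos => ?_) h3 h4, fun u hu => ?_,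
    fun u hu v hv hvc hpos => ?_, fun v hv => ?_, h.pos_ne, h.pos_lt, fun v hv0 hv1 hev => ?_⟩
  · exact h.arc p h.pos_lt v hv (by omega) hpos
  · by_cases hup : u = p
    · subst hup; omega
    · rw [h2 u hup]; exact h.arc_le u hu
  · by_cases hup : u = p
    · subst hup; omega
    · rw [h2 u hup] at hvc
      rw [h4 u hup]
      exact (h.arc u hu v hv hvc hpos).trans (hle v)
  · by_cases hvp : v = p
    · subst hvp
      have := h.toIsPreflow.height_lt hv he
      omega
    · rw [h4 v hvp]; exact h.height_le v hv
  · have hb := h.bound v hv0 hv1 hev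
    by_cases hvp : v = p
    · subst hvp
      exact ⟨fun hx => absurd hx (lt_irrefl _), fun hx => by have := hb.2 hx; omega⟩
    · rw [h4 v hvp]
      exact ⟨fun hx => by have := hb.1 hx; omega, fun hx => by have := hb.2 hx; omega⟩

/-- The only vertex that can become active is `w`, one level below `p`, hence it meets even the
stronger half of `bound`. The new residual edge from `w` to `p` goes up, so it is not admissible and
the arcs already skipped stay valid. -/
theorem pushPos (h : IsSweepState m c r e d cur p H) (hp : p + 1 < m) (he : 0 < e p) {w : ℕ}
    (hw : w < m) (hd : d p = d w + 1) {x : ℝ} (hx : 0 ≤ x) (hxr : x ≤ r p w) (hxe : x ≤ e p)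
    {r' : ℕ → ℕ → ℝ} {e' : ℕ → ℝ}
    (hr1 : r' p w = r p w - x) (hr2 : r' w p = r w p + x)
    (hr3 : ∀ u v, ¬ (u = p ∧ v = w) → ¬ (u = w ∧ v = p) → r' u v = r u v)
    (he1 : e' p = e p - x) (he2 : e' w = e w + x) (he3 : ∀ v, v ≠ p → v ≠ w → e' v = e v) :
    IsSweepState m c r' e' d cur p H := by
  refine ⟨h.toIsPreflow.push h.pos_lt h.pos_ne hw hd hx hxr hxe hr1 hr2 hr3 he1 he2 he3, h.arc_le,
    fun u hu v hv hvc hpos => ?_, h.height_le, h.pos_ne, h.pos_lt, fun v hv0 hv1 hev => ?_⟩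
  · by_cases h1 : u = p ∧ v = w
    · obtain ⟨rfl, rfl⟩ := h1
      exact h.arc u hu v hv hvc (by linarith)
    by_cases h2 : u = w ∧ v = p
    · obtain ⟨rfl, rfl⟩ := h2
      omega
    · exact h.arc u hu v hv hvc (by rwa [hr3 u v h1 h2] at hpos)
  · have hbp := (h.bound p h.pos_ne hp he).2 le_rfl
    by_cases h1 : v = w
    · subst h1
      exact ⟨fun _ => by omega, fun _ => by omega⟩
    by_cases h2 : v = p
    · subst h2
      exact ⟨fun hx => absurd hx (lt_irrefl _), fun _ => hbp⟩
    · exact h.bound v hv0 hv1 (by rwa [he3 v h2 h1] at hev)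

/-- The state after the edges that leave the source have been saturated. -/
theorem initial (hm : 2 ≤ m) (hc : ∀ u < m, ∀ v < m, 0 ≤ c u v)
    (hr : ∀ u < m, ∀ v < m, r u v = if u = 0 ∧ 0 < v then 0 else
      if v = 0 ∧ 0 < u then c u 0 + c 0 u else c u v)
    (he : ∀ v < m, v ≠ 0 → e v = c 0 v) (hd0 : d 0 = m) (hd : ∀ v < m, v ≠ 0 → d v = 0)
    (hcur : ∀ v < m, cur v = 0) : IsSweepState m c r e d cur 1 1 := by
  have hcur' : ∀ v < m, cur v ≤ m := fun v hv => by rw [hcur v hv]; omega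
  have hm0 : 0 < m := by omega
  refine ⟨⟨hm, hc, fun u hu v hv => ?_, fun u hu v hv => ?_, fun v hv hv0 => ?_,
    fun v hv hv0 => ?_, hd0, hd _ (by omega) (by omega), fun u hu v hv hpos => ?_⟩, hcur',
    fun u hu v _ hvc _ => ?_, fun v hv => ?_, one_ne_zero, by omega, fun v hv0 hv1 _ => ?_⟩
  · rw [hr u hu v hv]
    have h1 := hc u hu v hv
    have h2 := hc u hu 0 hm0
    have h3 := hc 0 hm0 u hu
    split_ifs <;> linarith
  · rw [hr u hu v hv, hr v hv u hu]
    rcases Nat.eq_zero_or_pos u with rfl | hu0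
    · rcases Nat.eq_zero_or_pos v with rfl | hv0
      · simp
      · simp [hv0, hv0.ne']; ring
    · rcases Nat.eq_zero_or_pos v with rfl | hv0
      · simp [hu0, hu0.ne']
      · simp [hu0.ne', hv0.ne']
  · rw [he v hv hv0, Finset.sum_eq_single_of_mem 0 (Finset.mem_range.2 hm0)]
    · rw [hr 0 hm0 v hv]; simp [Nat.pos_of_ne_zero hv0]
    · intro u hu hu0
      rw [hr u (Finset.mem_range.1 hu) v hv]; simp [hu0, hv0]
  · rw [he v hv hv0]; exact hc 0 hm0 v hv
  · rcases Nat.eq_zero_or_pos u with rfl | hu0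
    · rcases Nat.eq_zero_or_pos v with rfl | hv0
      · omega
      · rw [hr 0 hm0 v hv] at hpos; simp [hv0] at hpos
    · rw [hd u hu hu0.ne']; omega
  · rw [hcur u hu] at hvc; omega
  · rcases Nat.eq_zero_or_pos v with rfl | hv0
    · omega
    · rw [hd v hv hv0.ne']; omega
  · rw [hd v (by omega) hv0]; omega

end IsSweepState

end FlowNetwork

namespace RealRAM

/-! ### A push-relabel program -/

/-- Names of the arrays of the flow routine: excesses (real) and heights, current arcs, vertex
being discharged, bound for the heights of active vertices (natural). The residual capacities
replace the capacities in `kCap`. -/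
def kExcess : ℕ := 102
def kAmount : ℕ := 103
def kHeight : ℕ := 102
def kArc : ℕ := 103
def kPos : ℕ := 104
def kBound : ℕ := 105

/-- Saturates the edges that leave the source, and sets all heights but that of the source to
zero. -/
def saturateSource : Prog :=
  let w : NExp := nvar kPos
  let z : NExp := .lit 0
  forRange kPos (.lit 1) (nvar kVert) (block [
    .setReal kExcess w z (.get kCap z w),
    .setReal kCap w z (.add (.get kCap w z) (.get kCap z w)),
    .setReal kCap z w (.ofNat z),
    .setNat kHeight w z z,
    .setNat kArc w z z])

/-- Moves `kAmount` from the vertex `kPos` along its current arc. -/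
def pushAmount : Prog :=
  let p : NExp := nvar kPos
  let z : NExp := .lit 0
  let w : NExp := .get kArc p z
  block [
    .setReal kCap p w (.sub (.get kCap p w) (rvar kAmount)),
    .setReal kCap w p (.add (.get kCap w p) (rvar kAmount)),
    .setReal kExcess p z (.sub (.get kExcess p z) (rvar kAmount)),
    .setReal kExcess w z (.add (.get kExcess w z) (rvar kAmount))]

/-- One step of a sweep over the inner vertices. -/
def sweepStep : Prog :=
  let p : NExp := nvar kPos
  let z : NExp := .lit 0
  let w : NExp := .get kArc p z
  .cond (.ltNat (.add p (.lit 1)) (nvar kVert))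
    (.cond (.leReal (.get kExcess p z) (.ofNat z))
      (assignNat kPos (.add p (.lit 1)))
      (.cond (.ltNat w (nvar kVert))
        (.cond (.and (.eqNat (.get kHeight p z) (.add (.get kHeight w z) (.lit 1)))
            (.not (.leReal (.get kCap p w) (.ofNat z))))
          -- A saturating push is fused with advancing the arc, a non-saturating one with moving to
          -- the next vertex. Thus pushes need no term of their own in the potential.
          (.cond (.leReal (.get kCap p w) (.get kExcess p z))
            (block [assignReal kAmount (.get kCap p w), pushAmount,
              .setNat kArc p z (.add w (.lit 1))])
            (block [assignReal kAmount (.get kExcess p z), pushAmount,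
              assignNat kPos (.add p (.lit 1))]))
          (.setNat kArc p z (.add w (.lit 1))))
        (block [.setNat kHeight p z (.add (.get kHeight p z) (.lit 1)), .setNat kArc p z z,
          assignNat kBound (.add (nvar kBound) (.lit 1))])))
    -- The position has reached the sink: the sweep is over.
    (block [assignNat kPos (.lit 1), assignNat kBound (.sub (nvar kBound) (.lit 1))])

/-- The push-relabel routine. -/
def pushRelabel : Prog := block [
  saturateSource,
  block [
    .setNat kHeight (.lit 0) (.lit 0) (nvar kVert),
    .setNat kArc (.lit 0) (.lit 0) (.lit 0),
    assignNat kPos (.lit 1),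
    assignNat kBound (.lit 1)],
  .loop (.ltNat (.lit 0) (nvar kBound)) sweepStep,
  assignReal kFlow (.get kExcess (.sub (nvar kVert) (.lit 1)) (.lit 0))]

/-- The memories agree on the arrays of the caller of a flow routine, except for the arrays of
natural numbers in `A` and the arrays of real numbers in `B`. -/
def AgreeOff (A B : List ℕ) (σ σ' : Mem) : Prop :=
  ∀ x < 100, (x ∉ A → σ'.nat x = σ.nat x) ∧ (x ∉ B → σ'.real x = σ.real x)

namespace AgreeOff

variable {A B A' B' : List ℕ} {σ σ' σ'' : Mem}

theorem refl (A B : List ℕ) (σ : Mem) : AgreeOff A B σ σ := fun _ _ => ⟨fun _ => rfl, fun _ => rfl⟩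

theorem trans (h : AgreeOff A B σ σ') (h' : AgreeOff A B σ' σ'') : AgreeOff A B σ σ'' :=
  fun x hx => ⟨fun hA => ((h' x hx).1 hA).trans ((h x hx).1 hA),
    fun hB => ((h' x hx).2 hB).trans ((h x hx).2 hB)⟩

theorem mono (h : AgreeOff A B σ σ') (hA : A ⊆ A') (hB : B ⊆ B') : AgreeOff A' B' σ σ' :=
  fun x hx => ⟨fun h1 => (h x hx).1 fun h2 => h1 (hA h2),
    fun h1 => (h x hx).2 fun h2 => h1 (hB h2)⟩

theorem updateNat (h : AgreeOff A B σ σ') {x : ℕ} (hx : 100 ≤ x ∨ x ∈ A) (i j k : ℕ) :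
    AgreeOff A B σ (σ'.updateNat x i j k) := by
  refine fun y hy => ⟨fun hA => ?_, (h y hy).2⟩
  rw [updateNat_nat_of_ne, (h y hy).1 hA]
  rintro rfl
  exact hx.elim (fun h => absurd hy h.not_gt) hA

theorem updateReal (h : AgreeOff A B σ σ') {x : ℕ} (hx : 100 ≤ x ∨ x ∈ B) (i j : ℕ) (r : ℝ) :
    AgreeOff A B σ (σ'.updateReal x i j r) := by
  refine fun y hy => ⟨(h y hy).1, fun hB => ?_⟩
  rw [updateReal_real_of_ne, (h y hy).2 hB]
  rintro rfl
  exact hx.elim (fun h => absurd hy h.not_gt) hB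

end AgreeOff

/-- The memory holds a state of the push-relabel routine. -/
def HoldsSweep (σ₀ : Mem) (m : ℕ) (c : ℕ → ℕ → ℝ) (σ : Mem) : Prop :=
  AgreeOff [] [] σ₀ σ ∧ σ.nat kVert 0 0 = m ∧
  FlowNetwork.IsSweepState m c (σ.real kCap) (fun v => σ.real kExcess v 0)
    (fun v => σ.nat kHeight v 0) (fun v => σ.nat kArc v 0) (σ.nat kPos 0 0) (σ.nat kBound 0 0)

def sweepMeasure (m : ℕ) (σ : Mem) : ℕ :=
  FlowNetwork.sweepPotential m (fun v => σ.nat kHeight v 0) (fun v => σ.nat kArc v 0)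
    (σ.nat kPos 0 0) (σ.nat kBound 0 0)

/-- Each leaf of the program is one of the abstract moves of a sweep state: next vertex, saturating
or non-saturating push, skipped arc, relabelling, end of sweep. The `simp` calls only check that the
array updates realise that move. -/
theorem haltsWithin_sweepStep {σ₀ σ : Mem} {m : ℕ} {c : ℕ → ℕ → ℝ} (h : HoldsSweep σ₀ m c σ)
    (hH : 0 < σ.nat kBound 0 0) :
    HaltsWithin sweepStep σ 1000 fun σ' =>
      HoldsSweep σ₀ m c σ' ∧ sweepMeasure m σ' < sweepMeasure m σ := by
  obtain ⟨hag, hk, hs⟩ := h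
  refine (haltsWithin_of_wp ?_).mono (T := sweepStep.maxCost) (by decide) fun _ h => h
  simp only [sweepStep, pushAmount, Prog.wp, block, assignNat, assignReal, NExp.eval, RExp.eval,
    BExp.Holds, nvar_eval, hk, Nat.cast_zero]
  set p := σ.nat kPos 0 0 with hp
  set H := σ.nat kBound 0 0 with hHdef
  set w := σ.nat kArc p 0 with hwdef
  refine ⟨fun hpm => ⟨fun he => ?_, fun he => ⟨fun hw => ⟨fun hadm => ⟨fun hle => ?_,
    fun hle => ?_⟩, fun hadm => ?_⟩, fun hw => ?_⟩⟩, fun hpm => ?_⟩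
  · refine ⟨⟨hag.updateNat (by decide) _ _ _, hk, ?_⟩, ?_⟩
    · exact hs.next hpm he
    · exact FlowNetwork.sweepPotential_next H hs.pos_lt
  · have hpw : p ≠ w := fun hpw => by have := hadm.1; rw [← hpw] at this; omega
    simp only [updateReal_nat, ← hp, ← hwdef]
    refine ⟨⟨?_, hk, ?_⟩, ?_⟩
    · repeat first | exact hag | refine AgreeOff.updateNat ?_ (by decide) _ _ _ |
        refine AgreeOff.updateReal ?_ (by decide) _ _ _
    · refine FlowNetwork.IsSweepState.advanceArc (p := p) (H := H)
        (cur := fun v => σ.nat kArc v 0) (hs.pushPos (x := σ.real kCap p w) hpm (not_le.1 he) hw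
          hadm.1 (not_le.1 hadm.2).le le_rfl hle ?_ ?_ ?_ ?_ ?_ ?_) hw (fun hpos => ?_) ?_ ?_
      · simp [Mem.updateReal, kCap, kExcess, kAmount, rvar, RExp.eval, NExp.eval, hpw]
      · simp [Mem.updateReal, kCap, kExcess, kAmount, rvar, RExp.eval, NExp.eval, hpw, hpw.symm]
      · intro u v h1 h2
        simp [Mem.updateReal, kCap, kExcess, kAmount, rvar, RExp.eval, NExp.eval, h1, h2]
      · simp [Mem.updateReal, kCap, kExcess, kAmount, rvar, RExp.eval, NExp.eval, hpw]
      · simp [Mem.updateReal, kCap, kExcess, kAmount, rvar, RExp.eval, NExp.eval, hpw.symm]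
      · intro v h1 h2
        simp [Mem.updateReal, kCap, kExcess, kAmount, rvar, RExp.eval, NExp.eval, h1, h2]
      -- After a saturating push the residual capacity of the arc is zero, so the arc may be
      -- skipped.
      · refine absurd hpos ?_
        simp [Mem.updateReal, kCap, kExcess, kAmount, rvar, RExp.eval, NExp.eval, hpw, ← hwdef]
      · simp [Mem.updateNat, kArc, hwdef]
      · intro v hv
        simp [Mem.updateNat, kArc, hv]
    · refine FlowNetwork.sweepPotential_advanceArc (p := p) H hs.pos_lt hw ?_ ?_
      · simp [Mem.updateNat, kArc, hwdef]
      · intro v hv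
        simp [Mem.updateNat, kArc, hv]
  · have hpw : p ≠ w := fun hpw => by have := hadm.1; rw [← hpw] at this; omega
    simp only [updateReal_nat, ← hp, ← hwdef]
    refine ⟨⟨?_, hk, ?_⟩, ?_⟩
    · repeat first | exact hag | refine AgreeOff.updateNat ?_ (by decide) _ _ _ |
        refine AgreeOff.updateReal ?_ (by decide) _ _ _
    · refine FlowNetwork.IsSweepState.next (p := p) (H := H)
        (hs.pushPos (x := σ.real kExcess p 0) hpm (not_le.1 he) hw
          hadm.1 (not_le.1 he).le (not_le.1 hle).le le_rfl ?_ ?_ ?_ ?_ ?_ ?_) hpm ?_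
      · simp [Mem.updateReal, kCap, kExcess, kAmount, rvar, RExp.eval, NExp.eval, hpw]
      · simp [Mem.updateReal, kCap, kExcess, kAmount, rvar, RExp.eval, NExp.eval, hpw, hpw.symm]
      · intro u v h1 h2
        simp [Mem.updateReal, kCap, kExcess, kAmount, rvar, RExp.eval, NExp.eval, h1, h2]
      · simp [Mem.updateReal, kCap, kExcess, kAmount, rvar, RExp.eval, NExp.eval, hpw]
      · simp [Mem.updateReal, kCap, kExcess, kAmount, rvar, RExp.eval, NExp.eval, hpw.symm]
      · intro v h1 h2
        simp [Mem.updateReal, kCap, kExcess, kAmount, rvar, RExp.eval, NExp.eval, h1, h2]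
      -- The whole excess has been pushed away, which is what moving to the next vertex requires.
      · simp [Mem.updateReal, kCap, kExcess, kAmount, rvar, RExp.eval, NExp.eval, hpw]
    · exact FlowNetwork.sweepPotential_next H hs.pos_lt
  · refine ⟨⟨hag.updateNat (by decide) _ _ _, hk, ?_⟩, ?_⟩
    · refine FlowNetwork.IsSweepState.advanceArc (p := p) (H := H) hs hw (fun hpos => ?_) ?_ ?_
      -- Validity allows a residual edge to descend by at most one level; descending by exactly one
      -- would make it admissible.
      · have h1 := hs.valid p hs.pos_lt w hw hpos
        have h2 : ¬ σ.nat kHeight p 0 = σ.nat kHeight w 0 + 1 :=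
          fun h2 => hadm ⟨h2, not_le.2 hpos⟩
        exact Nat.lt_succ_iff.1 (lt_of_le_of_ne h1 h2)
      · simp [Mem.updateNat, kArc, hwdef]
      · intro v hv
        simp [Mem.updateNat, kArc, hv]
    · refine FlowNetwork.sweepPotential_advanceArc (p := p) H hs.pos_lt hw ?_ ?_
      · simp [Mem.updateNat, kArc, hwdef]
      · intro v hv
        simp [Mem.updateNat, kArc, hv]
  · have hlt := hs.toIsPreflow.height_lt hs.pos_lt (not_le.1 he)
    refine ⟨⟨?_, hk, ?_⟩, ?_⟩
    · repeat first | exact hag | refine AgreeOff.updateNat ?_ (by decide) _ _ _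
    · refine FlowNetwork.IsSweepState.relabelPos (p := p) (H := H) hs hpm hw (not_le.1 he)
        ?_ ?_ ?_ ?_
      · simp [Mem.updateNat, kArc, kHeight, kPos, kBound, hp]
      · intro v hv
        simp [Mem.updateNat, kArc, kHeight, kPos, kBound, hp]
        simp [kPos] at hv hp
        tauto
      · simp [Mem.updateNat, kArc, kHeight, kPos, kBound, hp]
      · intro v hv
        simp [Mem.updateNat, kArc, kHeight, kPos, kBound, hv]
    · refine FlowNetwork.sweepPotential_relabel (p := p) H hs.pos_lt hlt ?_ ?_ ?_ ?_
      · simp [Mem.updateNat, kArc, kHeight, kPos, kBound, hp]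
      · intro v hv
        simp [Mem.updateNat, kArc, kHeight, kPos, kBound, hp]
        tauto
      · simp [Mem.updateNat, kArc, kHeight, kPos, kBound, hp]
      · intro v hv
        simp [Mem.updateNat, kArc, kHeight, kPos, kBound, hv]
  · refine ⟨⟨((hag.updateNat (by decide) _ _ _).updateNat (by decide) _ _ _), hk, ?_⟩, ?_⟩
    · exact hs.wrap hpm
    · exact FlowNetwork.sweepPotential_wrap hs.pos_lt hH

theorem haltsWithin_saturateSource {σ : Mem} {m : ℕ} (hm : 2 ≤ m) (hk : σ.nat kVert 0 0 = m) :
    HaltsWithin saturateSource σ (100 * (m * 100)) fun σ' =>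
      AgreeOff [] [] σ σ' ∧ σ'.nat kVert 0 0 = m ∧
      (∀ u < m, ∀ v < m, σ'.real kCap u v = if u = 0 ∧ 0 < v then 0 else
        if v = 0 ∧ 0 < u then σ.real kCap u 0 + σ.real kCap 0 u else σ.real kCap u v) ∧
      ∀ v < m, v ≠ 0 → σ'.real kExcess v 0 = σ.real kCap 0 v ∧ σ'.nat kHeight v 0 = 0 ∧
        σ'.nat kArc v 0 = 0 := by
  refine haltsWithin_forRange (fun i σ' => AgreeOff [] [] σ σ' ∧ σ'.nat kVert 0 0 = m ∧
      (∀ u v, σ'.real kCap u v = if u = 0 ∧ 0 < v ∧ v < i then 0 else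
        if v = 0 ∧ 0 < u ∧ u < i then σ.real kCap u 0 + σ.real kCap 0 u else σ.real kCap u v) ∧
      ∀ v < i, v ≠ 0 → σ'.real kExcess v 0 = σ.real kCap 0 v ∧ σ'.nat kHeight v 0 = 0 ∧
        σ'.nat kArc v 0 = 0) 1 m m 100 rfl (by omega) (by omega) (by omega) (by omega)
    (by decide) (by decide) ?_ ?_ ?_ ?_
  · refine ⟨(AgreeOff.refl _ _ _).updateNat (by decide) _ _ _, hk, fun u v => ?_, fun v hv => ?_⟩
    · rw [if_neg (by omega), if_neg (by omega)]; rfl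
    · omega
  · exact fun i τ h _ => h.2.1
  · rintro i τ h1i him ⟨hag, hkτ, hcap, hrest⟩ hpos
    refine (haltsWithin_of_wp ?_).mono (T := Prog.maxCost _) ?_ fun _ h => h
    · simp only [Prog.wp, block, NExp.eval, RExp.eval, nvar_eval, updateReal_nat]
      simp only [updateNat_nat_of_ne _ _ _ _ (show kPos ≠ kHeight by decide),
        updateNat_nat_of_ne _ _ _ _ (show kPos ≠ kArc by decide), updateReal_nat, hpos, true_and]
      have hi0 : i ≠ 0 := by omega
      refine ⟨?_, hkτ, fun u v => ?_, fun v hv hv0 => ?_⟩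
      · repeat first | exact hag | refine AgreeOff.updateNat ?_ (by decide) _ _ _ |
          refine AgreeOff.updateReal ?_ (by decide) _ _ _
      · have h1 := hcap u v
        have h2 := hcap i 0
        have h3 := hcap 0 i
        simp [hi0] at h2 h3
        simp only [Mem.updateReal, updateNat_real, kCap, kExcess] at h1 h2 h3 ⊢
        by_cases hu : u = 0
        · subst hu
          by_cases hv : v = i
          · subst hv; simp [Nat.pos_of_ne_zero hi0]
          · simp [hv, hi0.symm] at h1 ⊢
            rw [h1]
            have : v < i ↔ v ≤ i := by omega
            simp only [this]
        · by_cases hv : v = 0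
          · subst hv
            by_cases hui : u = i
            · subst hui; simp [hi0, h2, h3, Nat.pos_of_ne_zero hi0]
            · simp [hu, hui] at h1 ⊢
              rw [h1]
              have : u < i ↔ u ≤ i := by omega
              simp only [this]
          · simp [hu, hv] at h1 ⊢
            exact h1
      · have h3 := hcap 0 i
        simp [hi0] at h3
        simp only [Mem.updateReal, Mem.updateNat, kCap, kExcess, kHeight, kArc, kPos]
          at h3 hrest ⊢
        by_cases hvi : v = i
        · subst hvi; simp [h3]
        · simpa [hvi] using hrest v (by omega) hv0
    · decide
  · rintro τ ⟨hag, hkτ, hcap, hrest⟩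
    refine ⟨hag, hkτ, fun u hu v hv => ?_, fun v hv => hrest v hv⟩
    rw [hcap]
    simp [hu, hv]

/-- The cut in the conclusion is irrelevant to the caller of the routine. It is recorded because it
turns the analysis of the program into a proof that maximum flow equals minimum cut. -/
theorem haltsWithin_pushRelabel {m : ℕ} (G : FlowNetwork (Fin m)) {σ : Mem}
    (hG : HoldsNetwork σ G) :
    HaltsWithin pushRelabel σ (1000000 * m ^ 3) fun σ' =>
      AgreeOff [] [] σ σ' ∧ G.IsMaxFlow (σ'.real kFlow 0 0) ∧
      ∃ U : Finset (Fin m), G.source ∈ U ∧ G.sink ∉ U ∧ σ'.real kFlow 0 0 = G.cutCap U := by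
  obtain ⟨hk, hs, ht, hcap⟩ := hG
  have hm : 2 ≤ m := by
    have h1 := G.sink.2
    have h2 : (G.sink : ℕ) ≠ 0 := fun h => G.source_ne_sink (Fin.ext (hs.trans h.symm))
    omega
  have hm3 : m * 1 ≤ m * (m * m) := Nat.mul_le_mul_left _ (Nat.mul_pos (by omega) (by omega))
  have hm3' : m ^ 3 = m * (m * m) := by ring
  have hc : ∀ u < m, ∀ v < m, 0 ≤ σ.real kCap u v := fun u hu v hv => by
    have := hcap ⟨u, hu⟩ ⟨v, hv⟩
    simp only at this
    rw [this]; exact G.cap_nonneg _ _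
  have hinit : HaltsWithin saturateSource σ (100 * (m * 100)) fun σ₁ =>
      HaltsWithin (block [
        .setNat kHeight (.lit 0) (.lit 0) (nvar kVert),
        .setNat kArc (.lit 0) (.lit 0) (.lit 0),
        assignNat kPos (.lit 1),
        assignNat kBound (.lit 1)]) σ₁ 100 fun τ =>
          HoldsSweep σ m (σ.real kCap) τ ∧ τ.nat kPos 0 0 = 1 ∧ τ.nat kBound 0 0 = 1 := by
    refine (haltsWithin_saturateSource hm hk).mono le_rfl ?_
    rintro τ ⟨hag, hkτ, hr, hrest⟩
    refine (haltsWithin_of_wp ?_).mono (T := Prog.maxCost _) (by decide) fun _ h => h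
    simp only [Prog.wp, block, assignNat, NExp.eval, nvar_eval, hkτ]
    refine ⟨⟨?_, hkτ, FlowNetwork.IsSweepState.initial hm hc hr
      (fun v hv h0 => (hrest v hv h0).1) ?_ (fun v hv h0 => ?_) fun v hv => ?_⟩, rfl, rfl⟩
    · repeat first | exact hag | refine AgreeOff.updateNat ?_ (by decide) _ _ _
    · simp [Mem.updateNat, kHeight, kArc, kPos, kBound]
    · have := (hrest v hv h0).2.1
      simpa [Mem.updateNat, kHeight, kArc, kPos, kBound, h0] using this
    · by_cases h0 : v = 0
      · simp [Mem.updateNat, kHeight, kArc, kPos, kBound, h0]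
      · have := (hrest v hv h0).2.2
        simpa [Mem.updateNat, kHeight, kArc, kPos, kBound, h0] using this
  have hloop : ∀ τ, HoldsSweep σ m (σ.real kCap) τ → τ.nat kPos 0 0 = 1 → τ.nat kBound 0 0 = 1 →
      HaltsWithin (.loop (.ltNat (.lit 0) (nvar kBound)) sweepStep) τ (1010 * (9 * m ^ 3 + 1))
        fun τ' => HoldsSweep σ m (σ.real kCap) τ' ∧ ¬ 0 < τ'.nat kBound 0 0 := by
    intro τ hτ h1 h2
    refine (haltsWithin_loop (b := .ltNat (.lit 0) (nvar kBound))
      (HoldsSweep σ m (σ.real kCap)) (sweepMeasure m) 1000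
      (fun τ h hb => haltsWithin_sweepStep h hb) τ hτ).mono ?_ fun _ h => h
    have : sweepMeasure m τ ≤ 9 * m ^ 3 := by
      rw [sweepMeasure, h1, h2]; exact FlowNetwork.sweepPotential_le _ _
    exact Nat.mul_le_mul (by decide) (by omega)
  have hend : ∀ τ, HoldsSweep σ m (σ.real kCap) τ ∧ ¬ 0 < τ.nat kBound 0 0 →
      HaltsWithin (block [assignReal kFlow (.get kExcess (.sub (nvar kVert) (.lit 1)) (.lit 0))])
        τ 100 fun σ' => AgreeOff [] [] σ σ' ∧ G.IsMaxFlow (σ'.real kFlow 0 0) ∧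
          ∃ U : Finset (Fin m), G.source ∈ U ∧ G.sink ∉ U ∧
            σ'.real kFlow 0 0 = G.cutCap U := by
    rintro τ ⟨⟨hag, hkτ, hsw⟩, hb⟩
    -- With the height bound at 0, `bound` would give an active vertex a negative height.
    have hact : ∀ v, v ≠ 0 → v + 1 < m → τ.real kExcess v 0 = 0 := by
      intro v hv0 hv1
      by_contra hne
      have hpos := lt_of_le_of_ne (hsw.excess_nonneg v (by omega) hv0) (Ne.symm hne)
      have := hsw.bound v hv0 hv1 hpos
      omega
    obtain ⟨U, hU⟩ := hsw.toIsPreflow.exists_flow_cut hact G hs ht hcap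
    refine (haltsWithin_of_wp ?_).mono (T := Prog.maxCost _) (by decide) fun _ h => h
    simp only [Prog.wp, block, assignReal, NExp.eval, RExp.eval, nvar_eval, hkτ,
      updateReal_real_self]
    exact ⟨hag.updateReal (by decide) _ _ _, hU.2.2.2, U, hU.1, hU.2.1, hU.2.2.1⟩
  refine (hinit.mono le_rfl fun τ₁ h₁ => (h₁.mono le_rfl fun τ₂ h₂ =>
    ((hloop τ₂ h₂.1 h₂.2.1 h₂.2.2).mono le_rfl hend).seq).seq).seq.mono ?_ fun _ h => h
  omega

theorem isCubicMaxFlow_pushRelabel : IsCubicMaxFlow pushRelabel := by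
  refine ⟨1000000, fun m G σ hG => ?_⟩
  obtain ⟨σ', T, hr, hT, hag, hmax, -⟩ := haltsWithin_pushRelabel G hG
  exact ⟨σ', T, hr, hT, hmax, fun x hx => ⟨(hag x hx).1 (by simp), (hag x hx).2 (by simp)⟩⟩

end RealRAM

/-- The value of a maximum flow is the capacity of some cut. -/
theorem FlowNetwork.IsMaxFlow.exists_cutCap_eq {m : ℕ} {G : FlowNetwork (Fin m)} {x : ℝ}
    (hs : (G.source : ℕ) = 0) (ht : (G.sink : ℕ) = m - 1) (hx : G.IsMaxFlow x) :
    ∃ U : Finset (Fin m), G.source ∈ U ∧ G.sink ∉ U ∧ x = G.cutCap U := by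
  -- The routine is run on a memory made up to hold `G`; the cut it exhibits belongs to any maximum
  -- flow value, since that value is unique.
  obtain ⟨σ', -, -, -, -, hmax, U, h1, h2, h3⟩ := RealRAM.haltsWithin_pushRelabel G
    (σ := ⟨fun _ _ _ => m, fun _ i j => if h : i < m ∧ j < m then G.cap ⟨i, h.1⟩ ⟨j, h.2⟩ else 0⟩)
    ⟨rfl, hs, ht, fun u v => by simp⟩
  exact ⟨U, h1, h2, (IsGreatest.unique hx hmax).trans h3⟩

/-! ## The network of a pair of sub-distributions -/

namespace FlowNetwork

open Classical in
/-- The capacities of the network of `f`, `g` and `R` on the vertices `0, …, 2 * n + 1`. -/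
noncomputable def matchCap (n : ℕ) (f g : ℕ → ℝ) (R : ℕ → ℕ → Prop) (a b : ℕ) : ℝ :=
  if a = 0 ∧ 1 ≤ b ∧ b ≤ n then f (b - 1)
  else if 1 ≤ a ∧ a ≤ n ∧ n + 1 ≤ b ∧ b ≤ 2 * n ∧ R (a - 1) (b - (n + 1)) then 1
  else if n + 1 ≤ a ∧ a ≤ 2 * n ∧ b = 2 * n + 1 then g (a - (n + 1)) else 0

variable {n : ℕ} {f g : ℕ → ℝ} {R : ℕ → ℕ → Prop}

theorem matchCap_nonneg (hf : ∀ u < n, 0 ≤ f u) (hg : ∀ u < n, 0 ≤ g u) (a b : ℕ) :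
    0 ≤ matchCap n f g R a b := by
  unfold matchCap
  split_ifs with h1 h2 h3
  · exact hf _ (by omega)
  · exact zero_le_one
  · exact hg _ (by omega)
  · exact le_rfl

theorem matchCap_source {u : ℕ} (hu : u < n) : matchCap n f g R 0 (u + 1) = f u := by
  rw [matchCap, if_pos ⟨rfl, by omega, by omega⟩, Nat.add_sub_cancel]

theorem matchCap_edge {u w : ℕ} (hu : u < n) (hw : w < n) [Decidable (R u w)] :
    matchCap n f g R (u + 1) (w + n + 1) = if R u w then 1 else 0 := by
  rw [matchCap, if_neg (fun h => by omega), show w + n + 1 - (n + 1) = w by omega,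
    Nat.add_sub_cancel]
  by_cases h : R u w
  · rw [if_pos ⟨by omega, by omega, by omega, by omega, h⟩, if_pos h]
  · rw [if_neg (fun h' => h h'.2.2.2.2), if_neg (fun h => by omega), if_neg h]

theorem matchCap_sink {u : ℕ} (hu : u < n) : matchCap n f g R (u + n + 1) (2 * n + 1) = g u := by
  rw [matchCap, if_neg (fun h => by omega), if_neg (fun h => by omega),
    if_pos ⟨by omega, by omega, rfl⟩, show u + n + 1 - (n + 1) = u by omega]

theorem matchCap_eq_zero {a b : ℕ} (h1 : ¬ (a = 0 ∧ 1 ≤ b ∧ b ≤ n))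
    (h2 : ¬ (1 ≤ a ∧ a ≤ n ∧ n + 1 ≤ b ∧ b ≤ 2 * n))
    (h3 : ¬ (n + 1 ≤ a ∧ a ≤ 2 * n ∧ b = 2 * n + 1)) : matchCap n f g R a b = 0 := by
  rw [matchCap, if_neg h1, if_neg (fun h => h2 ⟨h.1, h.2.1, h.2.2.1, h.2.2.2.1⟩), if_neg h3]

/-- The network of `f`, `g` and `R`. -/
noncomputable def matchNetwork (n : ℕ) (f g : ℕ → ℝ) (R : ℕ → ℕ → Prop)
    (hf : ∀ u < n, 0 ≤ f u) (hg : ∀ u < n, 0 ≤ g u) : FlowNetwork (Fin (2 * n + 2)) where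
  source := ⟨0, by omega⟩
  sink := ⟨2 * n + 1, by omega⟩
  source_ne_sink := fun h => by simp at h
  cap u v := matchCap n f g R u v
  cap_nonneg _ _ := matchCap_nonneg hf hg _ _

theorem sum_range_two_mul_add_two (n : ℕ) (h : ℕ → ℝ) :
    ∑ a ∈ Finset.range (2 * n + 2), h a = h 0 + ∑ u ∈ Finset.range n, h (u + 1)
      + ∑ u ∈ Finset.range n, h (u + n + 1) + h (2 * n + 1) := by
  rw [Finset.sum_range_succ, Finset.sum_range_succ', two_mul, Finset.sum_range_add]
  have : ∀ u, h (n + u + 1) = h (u + n + 1) := fun u => by rw [add_comm n u]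
  simp only [this]
  ring

/-- The capacity of a cut of the network of `f`, `g` and `R`. -/
theorem cutCap_matchNetwork (hf : ∀ u < n, 0 ≤ f u) (hg : ∀ u < n, 0 ≤ g u) (P : ℕ → Prop)
    [DecidablePred P] [DecidableRel R] (h0 : P 0) (h1 : ¬ P (2 * n + 1)) :
    (matchNetwork n f g R hf hg).cutCap (Finset.univ.filter fun a : Fin (2 * n + 2) => P (a : ℕ))
      = ∑ u ∈ Finset.range n, (if P (u + 1) then 0 else f u)
        + ∑ u ∈ Finset.range n, ∑ w ∈ Finset.range n,
            (if P (u + 1) ∧ ¬ P (w + n + 1) ∧ R u w then 1 else 0)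
        + ∑ w ∈ Finset.range n, (if P (w + n + 1) then g w else 0) := by
  set F : ℕ → ℕ → ℝ := fun a b => if P a then if P b then 0 else matchCap n f g R a b else 0
    with hF
  have hsum : (matchNetwork n f g R hf hg).cutCap
        (Finset.univ.filter fun a : Fin (2 * n + 2) => P (a : ℕ))
      = ∑ a ∈ Finset.range (2 * n + 2), ∑ b ∈ Finset.range (2 * n + 2), F a b := by
    rw [cutCap, Finset.sum_filter, Finset.sum_range]
    refine Finset.sum_congr rfl fun a _ => ?_
    rw [Finset.sum_range]
    by_cases ha : P a
    · rw [if_pos ha, Finset.compl_filter, Finset.sum_filter]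
      refine Finset.sum_congr rfl fun b _ => ?_
      by_cases hb : P b <;> simp [hF, ha, hb, matchNetwork]
    · simp [hF, ha]
  have hz : ∀ a b, matchCap n f g R a b = 0 → F a b = 0 := fun a b h => by simp [hF, h]
  have a0 : ∑ b ∈ Finset.range (2 * n + 2), F 0 b
      = ∑ u ∈ Finset.range n, (if P (u + 1) then 0 else f u) := by
    rw [sum_range_two_mul_add_two, hz 0 0 (matchCap_eq_zero (by omega) (by omega) (by omega)),
      hz 0 (2 * n + 1) (matchCap_eq_zero (by omega) (by omega) (by omega)),
      Finset.sum_eq_zero (s := Finset.range n) (f := fun u => F 0 (u + n + 1)) fun u _ =>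
        hz _ _ (matchCap_eq_zero (by omega) (by omega) (by omega)), zero_add, add_zero, add_zero]
    refine Finset.sum_congr rfl fun u hu => ?_
    simp only [hF, if_pos h0, matchCap_source (Finset.mem_range.1 hu)]
  have a1 : ∀ u < n, ∑ b ∈ Finset.range (2 * n + 2), F (u + 1) b
      = ∑ w ∈ Finset.range n, (if P (u + 1) ∧ ¬ P (w + n + 1) ∧ R u w then 1 else 0) := by
    intro u hu
    rw [sum_range_two_mul_add_two, hz (u + 1) 0 (matchCap_eq_zero (by omega) (by omega) (by omega)),
      hz (u + 1) (2 * n + 1) (matchCap_eq_zero (by omega) (by omega) (by omega)),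
      Finset.sum_eq_zero (s := Finset.range n) (f := fun w => F (u + 1) (w + 1)) fun w hw => by
        have := Finset.mem_range.1 hw
        exact hz _ _ (matchCap_eq_zero (by omega) (by omega) (by omega)), zero_add, zero_add,
      add_zero]
    refine Finset.sum_congr rfl fun w hw => ?_
    simp only [hF, matchCap_edge hu (Finset.mem_range.1 hw)]
    by_cases p1 : P (u + 1) <;> by_cases p2 : P (w + n + 1) <;> simp [p1, p2]
  have a2 : ∀ u < n, ∑ b ∈ Finset.range (2 * n + 2), F (u + n + 1) b
      = if P (u + n + 1) then g u else 0 := by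
    intro u hu
    rw [sum_range_two_mul_add_two,
      hz (u + n + 1) 0 (matchCap_eq_zero (by omega) (by omega) (by omega)),
      Finset.sum_eq_zero (s := Finset.range n) (f := fun w => F (u + n + 1) (w + 1)) fun w hw => by
        have := Finset.mem_range.1 hw
        exact hz _ _ (matchCap_eq_zero (by omega) (by omega) (by omega)),
      Finset.sum_eq_zero (s := Finset.range n) (f := fun w => F (u + n + 1) (w + n + 1))
        fun w hw => by
          have := Finset.mem_range.1 hw
          exact hz _ _ (matchCap_eq_zero (by omega) (by omega) (by omega)),
      zero_add, zero_add, zero_add]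
    simp only [hF, if_neg h1, matchCap_sink hu]
  rw [hsum, sum_range_two_mul_add_two, a0, Finset.sum_congr rfl fun u hu =>
    a1 u (Finset.mem_range.1 hu), Finset.sum_congr rfl fun u hu => a2 u (Finset.mem_range.1 hu)]
  have a3 : ∑ b ∈ Finset.range (2 * n + 2), F (2 * n + 1) b = 0 := by simp [hF, h1]
  rw [a3, add_zero]

/-- The network of `μ`, `ν` and `R` has a flow of value `μ(S) - ε` if and only if `μ` and `ν` are
related by the lifting of `R` with tolerance `ε`. -/
theorem IsMaxFlow.sub_le_iff_lifting (μ ν : SubDist (Fin n)) (hf : ∀ u < n, 0 ≤ f u)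
    (hg : ∀ u < n, 0 ≤ g u) (hμ : ∀ u : Fin n, f u = μ.prob u) (hν : ∀ u : Fin n, g u = ν.prob u)
    {x ε : ℝ} (hx : (matchNetwork n f g R hf hg).IsMaxFlow x) (hε : 0 ≤ ε) :
    ∑ u ∈ Finset.range n, f u - ε ≤ x ↔
      FinitePA.Lifting ε (fun s t : Fin n => R s t) μ ν := by
  classical
  have hsum : ∑ u ∈ Finset.range n, f u = ∑ u, μ.prob u := by
    rw [Finset.sum_range]; exact Finset.sum_congr rfl fun u _ => hμ u
  have hcompl : ∀ (E : Set (Fin n)) [DecidablePred (· ∈ E)], ∑ u : Fin n, (if u ∈ E then 0 else f u)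
      = ∑ u ∈ Finset.range n, f u - μ.mass E := by
    intro E _
    rw [hsum, SubDist.mass, ← Finset.sum_sub_distrib]
    refine Finset.sum_congr rfl fun u _ => ?_
    by_cases hu : u ∈ E <;> simp [hu, hμ]
  have hmass : ∀ (E : Set (Fin n)) [DecidablePred (· ∈ E)], ∑ u : Fin n, (if u ∈ E then g u else 0) = ν.mass E := by
    intro E _
    rw [SubDist.mass]
    refine Finset.sum_congr rfl fun u _ => ?_
    by_cases hu : u ∈ E <;> simp [hu, hν]
  constructor
  · intro hle E
    set RE : Set (Fin n) := {y | ∃ x ∈ E, R x y} with hRE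
    -- The cut of the source, E and the copies of R(E): no edge of R crosses it, so its capacity is
    -- μ(S) - μ(E) + ν(R(E)), and weak duality gives the inequality for E.
    set P : ℕ → Prop := fun a => a = 0 ∨ (∃ u : Fin n, u ∈ E ∧ a = u + 1) ∨
      ∃ w : Fin n, w ∈ RE ∧ a = w + n + 1 with hP
    have hP0 : P 0 := Or.inl rfl
    have hP1 : ¬ P (2 * n + 1) := by
      rintro (h | ⟨u, -, h⟩ | ⟨w, -, h⟩)
      · omega
      · have := u.2; omega
      · have := w.2; omega
    have hPu : ∀ u : Fin n, P (u + 1) ↔ u ∈ E := by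
      refine fun u => ⟨?_, fun h => Or.inr (Or.inl ⟨u, h, rfl⟩)⟩
      rintro (h | ⟨v, hv, h⟩ | ⟨w, -, h⟩)
      · omega
      · rwa [show u = v from Fin.ext (by omega)]
      · have := u.2; omega
    have hPw : ∀ w : Fin n, P (w + n + 1) ↔ w ∈ RE := by
      refine fun w => ⟨?_, fun h => Or.inr (Or.inr ⟨w, h, rfl⟩)⟩
      rintro (h | ⟨v, -, h⟩ | ⟨v, hv, h⟩)
      · omega
      · have := v.2; omega
      · rwa [show w = v from Fin.ext (by omega)]
    obtain ⟨⟨fl, hfl, rfl⟩, -⟩ := hx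
    have hcut := flowValue_le_cutCap hfl (U := Finset.univ.filter fun a : Fin (2 * n + 2) => P (a : ℕ))
      (by simpa [matchNetwork] using hP0) (by simpa [matchNetwork] using hP1)
    rw [cutCap_matchNetwork hf hg P hP0 hP1] at hcut
    simp only [Finset.sum_range] at hcut
    simp only [hPu, hPw, hcompl] at hcut
    have hz : ∑ u : Fin n, ∑ w : Fin n, (if u ∈ E ∧ w ∉ RE ∧ R u w then (1 : ℝ) else 0) = 0 := by
      refine Finset.sum_eq_zero fun u _ => Finset.sum_eq_zero fun w _ => if_neg ?_
      rintro ⟨h1, h2, h3⟩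
      exact h2 ⟨u, h1, h3⟩
    rw [hz] at hcut
    have h2 : (matchNetwork n f g R hf hg).flowValue fl
        ≤ ∑ u ∈ Finset.range n, f u - μ.mass E + 0 + ν.mass RE := by
      rw [← hmass RE]; convert hcut
    linarith
  · intro hL
    -- Conversely, the lifting is applied to the set E of states on the source side of a minimum
    -- cut.
    obtain ⟨U, hs, ht, rfl⟩ := hx.exists_cutCap_eq rfl rfl
    set P : ℕ → Prop := fun a => ∃ h : a < 2 * n + 2, (⟨a, h⟩ : Fin (2 * n + 2)) ∈ U with hP
    have hU : U = Finset.univ.filter fun a : Fin (2 * n + 2) => P (a : ℕ) := by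
      ext a; simp [hP]
    have hP0 : P 0 := ⟨by omega, hs⟩
    have hP1 : ¬ P (2 * n + 1) := fun ⟨_, h⟩ => ht h
    rw [hU, cutCap_matchNetwork hf hg P hP0 hP1]
    simp only [Finset.sum_range]
    set E : Set (Fin n) := {u | P (u + 1)} with hE
    set F : Set (Fin n) := {w | P (w + n + 1)} with hF
    have h1 := hcompl E
    have h2 := hmass F
    simp only [hE, Set.mem_ofPred_eq] at h1
    simp only [hF, Set.mem_ofPred_eq] at h2
    rw [h1, h2]
    rw [Finset.sum_range]
    have hnn : ∀ u : Fin n, ∀ w : Fin n, (0 : ℝ) ≤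
        if P (u + 1) ∧ ¬ P (w + n + 1) ∧ R u w then 1 else 0 := fun u w => by
      split_ifs <;> norm_num
    -- If an edge of R crosses, its capacity 1 outweighs μ(E) ≤ 1, and the cut is at least μ(S).
    -- Otherwise R(E) is contained in the set F of states whose copies lie on the source side.
    by_cases hedge : ∃ u w : Fin n, P (u + 1) ∧ ¬ P (w + n + 1) ∧ R u w
    · obtain ⟨u, w, huw⟩ := hedge
      have h3 : (1 : ℝ) ≤ ∑ u : Fin n, ∑ w : Fin n,
          (if P (u + 1) ∧ ¬ P (w + n + 1) ∧ R u w then 1 else 0) := by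
        refine le_trans ?_ (Finset.single_le_sum
          (fun u _ => Finset.sum_nonneg fun w _ => hnn u w) (Finset.mem_univ u))
        refine le_trans ?_ (Finset.single_le_sum (fun w _ => hnn u w) (Finset.mem_univ w))
        rw [if_pos huw]
      have h4 : μ.mass E ≤ 1 := by
        refine le_trans (Finset.sum_le_sum fun u _ => ?_) μ.sum_le_one
        exact Set.indicator_le_self' (fun _ _ => μ.nonneg _) _
      have h5 : 0 ≤ ν.mass F :=
        Finset.sum_nonneg fun u _ => Set.indicator_nonneg (fun _ _ => ν.nonneg _) _
      have h4' : μ.mass {u : Fin n | P (u + 1)} ≤ 1 := h4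
      have h5' : 0 ≤ ν.mass {w : Fin n | P (w + n + 1)} := h5
      linarith
    · have h3 : 0 ≤ ∑ u : Fin n, ∑ w : Fin n,
          (if P (u + 1) ∧ ¬ P (w + n + 1) ∧ R u w then (1 : ℝ) else 0) :=
        Finset.sum_nonneg fun u _ => Finset.sum_nonneg fun w _ => hnn u w
      have h4 : ν.mass {y | ∃ x ∈ E, R (x : ℕ) y} ≤ ν.mass F := by
        refine Finset.sum_le_sum fun w _ => ?_
        refine Set.indicator_le_indicator_of_subset ?_ (fun _ => ν.nonneg _) w
        rintro y ⟨u, hu, hR⟩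
        by_contra hy
        exact hedge ⟨u, y, hu, hy, hR⟩
      have h5 : μ.mass E ≤ ν.mass {y | ∃ x ∈ E, R (x : ℕ) y} + ε := hL E
      have h4' : ν.mass {y | ∃ x ∈ E, R (x : ℕ) y} ≤ ν.mass {w : Fin n | P (w + n + 1)} := h4
      have h5' : μ.mass {u : Fin n | P (u + 1)} ≤ ν.mass {y | ∃ x ∈ E, R (x : ℕ) y} + ε := h5
      linarith

end FlowNetwork

/-! ### Loops over pairs, total mass, and the construction of the network -/

namespace RealRAM

theorem AgreeOff.nat_eq {A B : List ℕ} {σ σ' : Mem} (h : AgreeOff A B σ σ') {x : ℕ}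
    (hx : x < 100 ∧ x ∉ A) : σ'.nat x = σ.nat x := (h x hx.1).1 hx.2

theorem AgreeOff.real_eq {A B : List ℕ} {σ σ' : Mem} (h : AgreeOff A B σ σ') {x : ℕ}
    (hx : x < 100 ∧ x ∉ B) : σ'.real x = σ.real x := (h x hx.1).2 hx.2

/-- A loop over all pairs of states: `I D c` holds when the `c` pairs in `D` have been treated. -/
theorem haltsWithin_forPairs {p : Prog} {σ : Mem} {n c : ℕ} {Q : Mem → Prop}
    (I : (ℕ → ℕ → Prop) → ℕ → Mem → Prop) (hn : 1 ≤ n) (hc : 1 ≤ c)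
    (init : I (fun _ _ => False) 0 σ)
    (states : ∀ D i τ, I D i τ → τ.nat kStates 0 0 = n)
    (stable : ∀ D i τ j, I D i τ → I D i (τ.updateNat kS 0 0 j) ∧ I D i (τ.updateNat kT 0 0 j))
    (step : ∀ D i s t τ, s < n → t < n → ¬ D s t → I D i τ → τ.nat kS 0 0 = s →
      τ.nat kT 0 0 = t → HaltsWithin p τ c fun τ' => τ'.nat kS 0 0 = s ∧ τ'.nat kT 0 0 = t ∧
        I (fun s' t' => D s' t' ∨ (s' = s ∧ t' = t)) (i + 1) τ')
    (hQ : ∀ τ, I (fun s t => s < n ∧ t < n) (n * n) τ → Q τ) :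
    HaltsWithin (forPairs p) σ (100 * (n * (100 * (n * c)))) Q := by
  have hnc : 1 ≤ n * c := Nat.mul_pos hn hc
  refine haltsWithin_forRange (fun i τ => I (fun s t => s < i ∧ t < n) (i * n) τ) 0 n n _ rfl
    (Nat.zero_le _) (Nat.sub_le _ _) hn (by omega) (by decide) (by decide) ?_ ?_ ?_ hQ
  · have h := (stable _ _ _ 0 init).1
    simpa using h
  · exact fun i τ h _ => states _ _ _ h
  · intro i τ _ hi h hS
    -- Pairs are treated in lexicographic order: all rows before i, and the first j entries of row
    -- i.
    refine haltsWithin_forRange (fun j τ => τ.nat kS 0 0 = i ∧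
      I (fun s t => (s < i ∧ t < n) ∨ (s = i ∧ t < j)) (i * n + j) τ) 0 n n _ rfl
      (Nat.zero_le _) (Nat.sub_le _ _) hn hc (by decide) (by decide) ?_ ?_ ?_ ?_
    · refine ⟨hS, ?_⟩
      have h' := (stable _ _ _ 0 h).2
      simpa using h'
    · exact fun j τ h _ => states _ _ _ h.2
    · rintro j τ - hj ⟨hS, h⟩ hT
      refine (step _ _ i j τ hi hj (by omega) h hS hT).mono le_rfl ?_
      rintro τ' ⟨hS', hT', h'⟩
      refine ⟨hT', hS', ?_⟩
      have hD : (fun s t => ((s < i ∧ t < n) ∨ (s = i ∧ t < j)) ∨ (s = i ∧ t = j))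
          = fun s t => (s < i ∧ t < n) ∨ (s = i ∧ t < j + 1) := by
        funext s t; apply propext; omega
      rw [hD] at h'
      exact (stable _ _ _ _ h').2
    · rintro τ' ⟨hS, h⟩
      have hD : (fun s t => (s < i ∧ t < n) ∨ (s = i ∧ t < n))
          = fun s t => s < i + 1 ∧ t < n := by
        funext s t; apply propext; omega
      rw [hD, show i * n + n = (i + 1) * n by ring] at h
      exact ⟨hS, (stable _ _ _ _ h).1⟩

theorem AgreeOff.rowMu_eval {A B : List ℕ} {σ σ' : Mem} (h : AgreeOff A B σ σ')
    (hA : kBase ∉ A ∧ kS ∉ A ∧ kA ∉ A ∧ kI ∉ A) : rowMu.eval σ' = rowMu.eval σ := by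
  simp only [rowMu, NExp.eval, nvar_eval, h.nat_eq (x := kBase) ⟨by decide, hA.1⟩,
    h.nat_eq (x := kS) ⟨by decide, hA.2.1⟩, h.nat_eq (x := kA) ⟨by decide, hA.2.2.1⟩,
    h.nat_eq (x := kI) ⟨by decide, hA.2.2.2⟩]

theorem AgreeOff.rowNu_eval {A B : List ℕ} {σ σ' : Mem} (h : AgreeOff A B σ σ')
    (hA : kBase ∉ A ∧ kT ∉ A ∧ kA ∉ A ∧ kJ ∉ A) : rowNu.eval σ' = rowNu.eval σ := by
  simp only [rowNu, NExp.eval, nvar_eval, h.nat_eq (x := kBase) ⟨by decide, hA.1⟩,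
    h.nat_eq (x := kT) ⟨by decide, hA.2.1⟩, h.nat_eq (x := kA) ⟨by decide, hA.2.2.1⟩,
    h.nat_eq (x := kJ) ⟨by decide, hA.2.2.2⟩]

theorem haltsWithin_computeMass {σ : Mem} {n : ℕ} (hn : 1 ≤ n) (hs : σ.nat kStates 0 0 = n) :
    HaltsWithin computeMass σ (100 + (100 * (n * 100) + 1)) fun σ' =>
      AgreeOff [kU] [kMass] σ σ' ∧
      σ'.real kMass 0 0 = ∑ u ∈ Finset.range n, σ.real kProb (rowMu.eval σ) u := by
  refine HaltsWithin.seq ((haltsWithin_of_wp (Q := fun τ => AgreeOff [kU] [kMass] σ τ ∧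
    τ.real kMass 0 0 = 0) ?_).mono (T := Prog.maxCost _) (by decide) ?_)
  · simp only [assignReal, Prog.wp, RExp.eval, NExp.eval, updateReal_real_self, Nat.cast_zero]
    exact ⟨(AgreeOff.refl _ _ _).updateReal (by decide) _ _ _, trivial⟩
  rintro τ ⟨hag, h0⟩
  refine HaltsWithin.seq_skip ?_
  refine haltsWithin_forRange (fun i τ => AgreeOff [kU] [kMass] σ τ ∧
      τ.real kMass 0 0 = ∑ u ∈ Finset.range i, σ.real kProb (rowMu.eval σ) u) 0 n n 100 rfl
    (Nat.zero_le _) (Nat.sub_le _ _) hn (by decide) (by decide) (by decide) ?_ ?_ ?_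
    fun _ h => h
  · exact ⟨hag.updateNat (by decide) _ _ _, by simpa using h0⟩
  · rintro i τ ⟨h, -⟩ -
    rw [← hs]
    exact congrFun (congrFun (h.nat_eq (by decide)) 0) 0
  · rintro i τ - hi ⟨hag, hsum⟩ hU
    refine (haltsWithin_of_wp ?_).mono (T := Prog.maxCost _) (by decide) fun _ h => h
    simp only [assignReal, Prog.wp, RExp.eval, NExp.eval, nvar_eval, rvar_eval, updateReal_nat, hU,
      true_and]
    refine ⟨(hag.updateReal (by decide) _ _ _).updateNat (by decide) _ _ _, ?_⟩
    rw [updateNat_real, updateReal_real_self, Finset.sum_range_succ, hsum,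
      hag.real_eq (x := kProb) (by decide), hag.rowMu_eval (by decide)]

/-- The capacities of the network of the transitions that are being treated. -/
noncomputable def netCap (n : ℕ) (σ : Mem) : ℕ → ℕ → ℝ :=
  FlowNetwork.matchCap n (σ.real kProb (rowMu.eval σ)) (σ.real kProb (rowNu.eval σ))
    fun u w => σ.nat kRel u w = 1

theorem haltsWithin_buildNetwork {σ : Mem} {n : ℕ} (hn : 1 ≤ n) (hs : σ.nat kStates 0 0 = n) :
    HaltsWithin buildNetwork σ (100000000 * (n * n)) fun σ' =>
      AgreeOff [kU, kW] [] σ σ' ∧ σ'.nat kVert 0 0 = 2 * n + 2 ∧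
      ∀ a < 2 * n + 2, ∀ b < 2 * n + 2, σ'.real kCap a b = netCap n σ a b := by
  have hst : ∀ τ, AgreeOff [kU, kW] [] σ τ → τ.nat kStates 0 0 = n := fun τ h => by
    rw [← hs]
    exact congrFun (congrFun (h.nat_eq (by decide)) 0) 0
  set m := 2 * n + 2 with hm
  have part1 : HaltsWithin (assignNat kVert (.add (.add (nvar kStates) (nvar kStates)) (.lit 2)))
      σ 100 fun τ => AgreeOff [kU, kW] [] σ τ ∧ τ.nat kVert 0 0 = m := by
    refine (haltsWithin_of_wp ?_).mono (T := Prog.maxCost _) (by decide) fun _ h => h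
    simp only [assignNat, Prog.wp, NExp.eval, nvar_eval, hs, updateNat_nat_self]
    exact ⟨(AgreeOff.refl _ _ _).updateNat (by decide) _ _ _, by omega⟩
  have part2 : ∀ τ, AgreeOff [kU, kW] [] σ τ ∧ τ.nat kVert 0 0 = m →
      HaltsWithin (forRange kU (.lit 0) (nvar kVert) (forRange kW (.lit 0) (nvar kVert)
        (.setReal kCap (nvar kU) (nvar kW) (.ofNat (.lit 0))))) τ
        (100 * (m * (100 * (m * 100)))) fun τ =>
        AgreeOff [kU, kW] [] σ τ ∧ τ.nat kVert 0 0 = m ∧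
          ∀ a < m, ∀ b < m, τ.real kCap a b = 0 := by
    rintro τ ⟨hag, hk⟩
    refine haltsWithin_forRange (fun i τ => AgreeOff [kU, kW] [] σ τ ∧ τ.nat kVert 0 0 = m ∧
      ∀ a < i, ∀ b < m, τ.real kCap a b = 0) 0 m m _ rfl
      (Nat.zero_le _) (Nat.sub_le _ _) (by omega) (by omega) (by decide) (by decide) ?_ ?_ ?_
      fun _ h => h
    · exact ⟨hag.updateNat (by decide) _ _ _, hk, by omega⟩
    · exact fun i τ h _ => h.2.1
    · rintro i τ - hi ⟨hag, hk, hz⟩ hU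
      refine haltsWithin_forRange (fun j τ => AgreeOff [kU, kW] [] σ τ ∧ τ.nat kVert 0 0 = m ∧
        τ.nat kU 0 0 = i ∧
        (∀ a < i, ∀ b < m, τ.real kCap a b = 0) ∧ ∀ b < j, τ.real kCap i b = 0) 0 m m _ rfl
        (Nat.zero_le _) (Nat.sub_le _ _) (by omega) (by omega) (by decide) (by decide) ?_ ?_ ?_ ?_
      · exact ⟨hag.updateNat (by decide) _ _ _, hk, hU, hz, by omega⟩
      · exact fun i τ h _ => h.2.1
      · rintro j τ - hj ⟨hag, hk, hU, hz, hz'⟩ hW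
        refine (haltsWithin_of_wp ?_).mono (T := Prog.maxCost _) (by decide) fun _ h => h
        simp only [Prog.wp, NExp.eval, RExp.eval, nvar_eval, updateReal_nat, hU, hW, true_and,
          Nat.cast_zero, updateNat_real, updateReal_real_apply]
        refine ⟨(hag.updateReal (by decide) _ _ _).updateNat (by decide) _ _ _, hk, hU,
          fun a ha b hb => ?_, fun b hb => ?_⟩
        · rw [hz a ha b hb, ite_self]
        · by_cases hbj : b = j
          · rw [if_pos hbj]
          · rw [if_neg hbj, hz' b (by omega)]
      · rintro τ ⟨hag, hk, hU, hz, hz'⟩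
        refine ⟨hU, hag.updateNat (by decide) _ _ _, hk, fun a ha b hb => ?_⟩
        rcases Nat.lt_succ_iff_lt_or_eq.1 ha with h | rfl
        · exact hz a h b hb
        · exact hz' b hb
  have hnet : ∀ τ, AgreeOff [kU, kW] [] σ τ → rowMu.eval τ = rowMu.eval σ ∧
      rowNu.eval τ = rowNu.eval σ ∧ τ.real kProb = σ.real kProb ∧ τ.nat kRel = σ.nat kRel :=
    fun τ h => ⟨h.rowMu_eval (by decide), h.rowNu_eval (by decide), h.real_eq (by decide),
      h.nat_eq (by decide)⟩
  have part3 : ∀ τ, (AgreeOff [kU, kW] [] σ τ ∧ τ.nat kVert 0 0 = m ∧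
          ∀ a < m, ∀ b < m, τ.real kCap a b = 0) →
      HaltsWithin (forRange kU (.lit 0) (nvar kStates) (block [
        .setReal kCap (.lit 0) (.add (nvar kU) (.lit 1)) (.get kProb rowMu (nvar kU)),
        .setReal kCap (.add (.add (nvar kU) (nvar kStates)) (.lit 1))
          (.add (.add (nvar kStates) (nvar kStates)) (.lit 1)) (.get kProb rowNu (nvar kU)),
        forRange kW (.lit 0) (nvar kStates)
          (.cond (.eqNat (.get kRel (nvar kU) (nvar kW)) (.lit 1))
            (.setReal kCap (.add (nvar kU) (.lit 1))
              (.add (.add (nvar kW) (nvar kStates)) (.lit 1)) (.ofNat (.lit 1)))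
            .skip)])) τ
        (100 * (n * (200 + (100 * (n * 100) + 1)))) fun τ =>
        AgreeOff [kU, kW] [] σ τ ∧ τ.nat kVert 0 0 = m ∧
          ∀ a < m, ∀ b < m, τ.real kCap a b = netCap n σ a b := by
    rintro τ ⟨hag, hk, hz⟩
    -- After i states the matrix is final in row 0 up to column i, in rows 1 to i and in rows n + 1
    -- to n + i, and zero elsewhere. For i = 0 this region is the cell (0, 0), and for i = n its
    -- complement contains no edge, so both ends of the loop match.
    refine haltsWithin_forRange (fun i τ => AgreeOff [kU, kW] [] σ τ ∧ τ.nat kVert 0 0 = m ∧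
      ∀ a < m, ∀ b < m, τ.real kCap a b =
        if (a = 0 ∧ b ≤ i) ∨ (1 ≤ a ∧ a ≤ i) ∨ (n + 1 ≤ a ∧ a ≤ n + i) then netCap n σ a b else 0)
      0 n n _ rfl
      (Nat.zero_le _) (Nat.sub_le _ _) hn (by omega) (by decide) (by decide) ?_ ?_ ?_ ?_
    · refine ⟨hag.updateNat (by decide) _ _ _, hk, fun a ha b hb => ?_⟩
      rw [updateNat_real, hz a ha b hb]
      split_ifs with h
      · exact (FlowNetwork.matchCap_eq_zero (by omega) (by omega) (by omega)).symm
      · rfl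
    · exact fun i τ h _ => hst τ h.1
    · rintro i τ - hi ⟨hag, hk, hz⟩ hU
      obtain ⟨e1, e2, e3, e4⟩ := hnet τ hag
      have hpre : HaltsWithin (.setReal kCap (.lit 0) (.add (nvar kU) (.lit 1))
          (.get kProb rowMu (nvar kU))) τ 100 fun τ₁ => HaltsWithin
          (.setReal kCap (.add (.add (nvar kU) (nvar kStates)) (.lit 1))
          (.add (.add (nvar kStates) (nvar kStates)) (.lit 1)) (.get kProb rowNu (nvar kU))) τ₁ 100
          fun τ₂ => AgreeOff [kU, kW] [] σ τ₂ ∧ τ₂.nat kVert 0 0 = m ∧ τ₂.nat kU 0 0 = i ∧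
      ∀ a < m, ∀ b < m, τ₂.real kCap a b =
        if (a = 0 ∧ b ≤ i + 1) ∨ (1 ≤ a ∧ a ≤ i) ∨ (n + 1 ≤ a ∧ a ≤ n + i + 1) then netCap n σ a b
        else 0 := by
        refine (haltsWithin_of_wp ?_).mono (T := Prog.maxCost _) (by decide) fun _ h => h
        refine (haltsWithin_of_wp ?_).mono (T := Prog.maxCost _) (by decide) fun _ h => h
        have hag' : AgreeOff [kU, kW] [] σ
            (τ.updateReal kCap 0 (i + 1) (σ.real kProb (rowMu.eval σ) i)) :=
          hag.updateReal (by decide) _ _ _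
        simp only [Prog.wp, NExp.eval, RExp.eval, nvar_eval, updateReal_nat, hU, true_and,
          hst τ hag, e1, e3]
        obtain ⟨-, e2', e3', -⟩ := hnet _ hag'
        rw [e2', e3']
        refine ⟨hag'.updateReal (by decide) _ _ _, hk, fun a ha b hb => ?_⟩
        simp only [updateReal_real_apply, hz a ha b hb]
        by_cases h1 : a = i + n + 1 ∧ b = n + n + 1
        · rw [if_pos h1, if_pos (by omega), h1.1, h1.2, netCap, ← two_mul,
            FlowNetwork.matchCap_sink hi]
        rw [if_neg h1]
        by_cases h2 : a = 0 ∧ b = i + 1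
        · rw [if_pos h2, if_pos (by omega), h2.1, h2.2, netCap, FlowNetwork.matchCap_source hi]
        rw [if_neg h2]
        split_ifs with h3 h4 h4
        · rfl
        · omega
        · exact (FlowNetwork.matchCap_eq_zero (by omega) (by omega) (by omega)).symm
        · rfl
      refine (((hpre.mono le_rfl fun τ₁ h₁ => (h₁.mono le_rfl fun τ₂ h₂ => (HaltsWithin.seq_skip
        ?_)).seq).seq).mono
        (T := 100 + (100 + (100 * (n * 100) + 1))) (by omega) fun _ h => h)
      obtain ⟨hag, hk, hU, hz⟩ := h₂
      -- Row i + 1 becomes final from left to right. Its columns up to n carry no edges, so the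
      -- count may start at n + 1.
      refine haltsWithin_forRange (fun j τ => AgreeOff [kU, kW] [] σ τ ∧ τ.nat kVert 0 0 = m ∧
        τ.nat kU 0 0 = i ∧
        ∀ a < m, ∀ b < m, τ.real kCap a b =
          if (a = 0 ∧ b ≤ i + 1) ∨ (1 ≤ a ∧ a ≤ i) ∨ (n + 1 ≤ a ∧ a ≤ n + i + 1) ∨
            (a = i + 1 ∧ b < n + 1 + j) then netCap n σ a b
          else 0) 0 n n 100 rfl
        (Nat.zero_le _) (Nat.sub_le _ _) hn (by omega) (by decide) (by decide) ?_ ?_ ?_ ?_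
      · refine ⟨hag.updateNat (by decide) _ _ _, hk, hU, fun a ha b hb => ?_⟩
        rw [updateNat_real, hz a ha b hb]
        split_ifs with h3 h4 h4
        · rfl
        · omega
        · exact (FlowNetwork.matchCap_eq_zero (by omega) (by omega) (by omega)).symm
        · rfl
      · exact fun i τ h _ => hst τ h.1
      · rintro j τ - hj ⟨hag, hk, hU, hz⟩ hW
        obtain ⟨-, -, -, e4⟩ := hnet τ hag
        refine (haltsWithin_of_wp ?_).mono (T := Prog.maxCost _) (by decide) fun _ h => h
        simp only [Prog.wp, NExp.eval, RExp.eval, BExp.Holds, nvar_eval, updateReal_nat, hU, hW,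
          true_and, hst τ hag, e4, updateNat_real, updateReal_real_apply, Nat.cast_one]
        have hcap : netCap n σ (i + 1) (j + n + 1) = if σ.nat kRel i j = 1 then 1 else 0 :=
          FlowNetwork.matchCap_edge hi hj
        refine ⟨fun hrel => ⟨(hag.updateReal (by decide) _ _ _).updateNat (by decide) _ _ _, hk,
          hU, fun a ha b hb => ?_⟩, fun hrel => ⟨hag.updateNat (by decide) _ _ _, hk, hU,
          fun a ha b hb => ?_⟩⟩
        · rw [if_pos hrel] at hcap
          by_cases h1 : a = i + 1 ∧ b = j + n + 1
          · rw [if_pos h1, if_pos (by omega), h1.1, h1.2, hcap]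
          rw [if_neg h1, hz a ha b hb]
          exact if_congr (by omega) rfl rfl
        · rw [if_neg hrel] at hcap
          rw [hz a ha b hb]
          by_cases h1 : a = i + 1 ∧ b = j + n + 1
          · rw [h1.1, h1.2, hcap, ite_self, ite_self]
          exact if_congr (by omega) rfl rfl
      · rintro τ ⟨hag, hk, hU, hz⟩
        refine ⟨hU, hag.updateNat (by decide) _ _ _, hk, fun a ha b hb => ?_⟩
        rw [updateNat_real, hz a ha b hb]
        split_ifs with h3 h4 h4
        · rfl
        · exact FlowNetwork.matchCap_eq_zero (by omega) (by omega) (by omega)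
        · exact (FlowNetwork.matchCap_eq_zero (by omega) (by omega) (by omega)).symm
        · rfl
    · rintro τ ⟨hag, hk, hz⟩
      refine ⟨hag, hk, fun a ha b hb => ?_⟩
      rw [hz a ha b hb]
      split_ifs with h3
      · rfl
      · exact (FlowNetwork.matchCap_eq_zero (by omega) (by omega) (by omega)).symm
  have hnn : n ≤ n * n := Nat.le_mul_of_pos_left n hn
  have hn1 : 1 ≤ n * n := hn.trans hnn
  refine (part1.mono le_rfl fun τ₁ h₁ => ((part2 τ₁ h₁).mono le_rfl fun τ₂ h₂ =>
    (part3 τ₂ h₂).seq_skip).seq).seq.mono ?_ fun _ h => h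
  -- Clearing the matrix of (2n + 2)² entries dominates the cost.
  have h1 : 100 * (m * (100 * (m * 100))) = 1000000 * (4 * (n * n) + 8 * n + 4) := by
    rw [hm]; ring
  have h2 : 100 * (n * (200 + (100 * (n * 100) + 1))) = 1000000 * (n * n) + 20100 * n := by ring
  omega

end RealRAM

theorem SubDist.eq_of_prob {S : Type} [Fintype S] {μ ν : SubDist S} (h : ∀ s, μ.prob s = ν.prob s) :
    μ = ν := by
  cases μ; cases ν
  congr
  exact funext h

/-! ### The input, and the tests for matching transitions -/

namespace RealRAM

section Input

variable {n k N : ℕ} {P : FinitePA (Fin n) (Fin k)} {σ σ' : Mem}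

theorem HoldsInput.of_agreeOff {A B : List ℕ} (h : HoldsInput σ P N) (hag : AgreeOff A B σ σ')
    (hA : ∀ x ∈ [kStates, kActs, kRounds, kCount, kBase], x ∉ A) (hB : kProb ∉ B) :
    HoldsInput σ' P N := by
  simp only [List.forall_mem_cons] at hA
  unfold HoldsInput
  rw [hag.nat_eq (x := kStates) ⟨by decide, hA.1⟩, hag.nat_eq (x := kActs) ⟨by decide, hA.2.1⟩,
    hag.nat_eq (x := kRounds) ⟨by decide, hA.2.2.1⟩,
    hag.nat_eq (x := kCount) ⟨by decide, hA.2.2.2.1⟩,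
    hag.nat_eq (x := kBase) ⟨by decide, hA.2.2.2.2.1⟩, hag.real_eq (x := kProb) ⟨by decide, hB⟩]
  exact h

/-- Row number `q` of `kProb` holds the sub-distribution `μ`. -/
def HoldsRow (σ : Mem) (q : ℕ) (μ : SubDist (Fin n)) : Prop :=
  ∀ u : Fin n, σ.real kProb q u = μ.prob u

theorem HoldsRow.unique {q : ℕ} {μ ν : SubDist (Fin n)} (h : HoldsRow σ q μ) (h' : HoldsRow σ q ν) :
    μ = ν := SubDist.eq_of_prob fun u => (h u).symm.trans (h' u)

theorem HoldsRow.nonneg {q : ℕ} {μ : SubDist (Fin n)} (h : HoldsRow σ q μ) :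
    ∀ u < n, 0 ≤ σ.real kProb q u := fun u hu => by
  rw [show σ.real kProb q u = μ.prob ⟨u, hu⟩ from h ⟨u, hu⟩]
  exact μ.nonneg _

theorem HoldsRow.of_agreeOff {A B : List ℕ} {q : ℕ} {μ : SubDist (Fin n)} (h : HoldsRow σ q μ)
    (hag : AgreeOff A B σ σ') (hB : kProb ∉ B) : HoldsRow σ' q μ := by
  unfold HoldsRow
  rw [hag.real_eq (x := kProb) ⟨by decide, hB⟩]
  exact h

theorem HoldsInput.exists_row (h : HoldsInput σ P N) (s : Fin n) (a : Fin k) {i : ℕ}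
    (hi : i < σ.nat kCount s a) : ∃ μ ∈ P.trans s a, HoldsRow σ (σ.nat kBase s a + i) μ := by
  obtain ⟨e, he⟩ := h.2.2.2 s a
  exact ⟨(e ⟨i, hi⟩).1, (e ⟨i, hi⟩).2, he ⟨i, hi⟩⟩

theorem HoldsInput.exists_index (h : HoldsInput σ P N) {s : Fin n} {a : Fin k}
    {μ : SubDist (Fin n)} (hμ : μ ∈ P.trans s a) :
    ∃ i < σ.nat kCount s a, HoldsRow σ (σ.nat kBase s a + i) μ := by
  obtain ⟨e, he⟩ := h.2.2.2 s a
  refine ⟨e.symm ⟨μ, hμ⟩, (e.symm ⟨μ, hμ⟩).2, fun u => ?_⟩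
  rw [he, Equiv.apply_symm_apply]

/-- Here the listing without repetition matters: it makes the length of each inner loop the
cardinality of a set of transitions, hence at most l. -/
theorem HoldsInput.count_le (h : HoldsInput σ P N) (s : Fin n) (a : Fin k) :
    σ.nat kCount s a ≤ P.maxBranching := by
  obtain ⟨e, -⟩ := h.2.2.2 s a
  have h1 := Fintype.card_congr e
  rw [Fintype.card_fin, Fintype.card_coe] at h1
  rw [h1]
  exact Finset.le_sup (f := fun p : Fin n × Fin k => (P.trans p.1 p.2).card)
    (Finset.mem_univ (s, a))

end Input

/-- The running time and the result of a flow routine. -/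
def MaxFlowBound (flow : Prog) (K : ℕ) : Prop :=
  ∀ (m : ℕ) (G : FlowNetwork (Fin m)) (σ : Mem), HoldsNetwork σ G →
    HaltsWithin flow σ (K * m ^ 3) fun σ' => AgreeOff [] [] σ σ' ∧ G.IsMaxFlow (σ'.real kFlow 0 0)

theorem IsCubicMaxFlow.exists_maxFlowBound {flow : Prog} (h : IsCubicMaxFlow flow) :
    ∃ K, MaxFlowBound flow K := by
  obtain ⟨K, hK⟩ := h
  refine ⟨K, fun m G σ hG => ?_⟩
  obtain ⟨σ', T, hr, hT, hmax, hag⟩ := hK m G σ hG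
  exact ⟨σ', T, hr, hT, fun x hx => ⟨fun _ => (hag x hx).1, fun _ => (hag x hx).2⟩, hmax⟩

/-- The current relation. -/
def currentRel (n : ℕ) (σ : Mem) (s t : Fin n) : Prop := σ.nat kRel s t = 1

theorem AgreeOff.currentRel_eq {A B : List ℕ} {σ σ' : Mem} (h : AgreeOff A B σ σ') (n : ℕ)
    (hA : kRel ∉ A) : currentRel n σ' = currentRel n σ := by
  unfold currentRel
  rw [h.nat_eq (x := kRel) ⟨by decide, hA⟩]

theorem AgreeOff.tolerance_eval {A B : List ℕ} {σ σ' : Mem} (h : AgreeOff A B σ σ')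
    (hA : kN ∉ A) (hB : kDelta ∉ B) : tolerance.eval σ' = tolerance.eval σ := by
  simp only [tolerance, RExp.eval, NExp.eval, nvar_eval, rvar_eval,
    h.nat_eq (x := kN) ⟨by decide, hA⟩, h.real_eq (x := kDelta) ⟨by decide, hB⟩]

/-- Testing whether one transition matches another. -/
theorem haltsWithin_matchTest {flow : Prog} {K n : ℕ} (hflow : MaxFlowBound flow K) {σ : Mem}
    (hn : 1 ≤ n) (hs : σ.nat kStates 0 0 = n) {μ ν : SubDist (Fin n)}
    (hμ : HoldsRow σ (rowMu.eval σ) μ) (hν : HoldsRow σ (rowNu.eval σ) ν)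
    (hmass : σ.real kMass 0 0 = ∑ u ∈ Finset.range n, σ.real kProb (rowMu.eval σ) u)
    (htol : 0 ≤ tolerance.eval σ) :
    HaltsWithin (block [
      buildNetwork,
      flow,
      assignNat kCalls (.add (nvar kCalls) (.lit 1)),
      .cond (.leReal (.sub (rvar kMass) tolerance) (rvar kFlow))
        (assignNat kFound (.lit 1))
        .skip]) σ ((100001000 + 64 * K) * n ^ 3) fun σ' =>
      AgreeOff [kU, kW, kCalls, kFound] [] σ σ' ∧ σ'.nat kCalls 0 0 = σ.nat kCalls 0 0 + 1 ∧
      (σ'.nat kFound 0 0 = 0 ↔ σ.nat kFound 0 0 = 0 ∧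
        ¬ FinitePA.Lifting (tolerance.eval σ) (currentRel n σ) μ ν) := by
  have h3 : n * n ≤ n ^ 3 := by
    calc n * n = n * n * 1 := by ring
      _ ≤ n * n * n := Nat.mul_le_mul_left _ hn
      _ = n ^ 3 := by ring
  -- Since 1 ≤ n, the network has at most 4n vertices; this is the source of the factor 64.
  have h4 : (2 * n + 2) ^ 3 ≤ 64 * n ^ 3 := by
    calc (2 * n + 2) ^ 3 ≤ (4 * n) ^ 3 := Nat.pow_le_pow_left (by omega) 3
      _ = 64 * n ^ 3 := by ring
  have h5 : K * (2 * n + 2) ^ 3 ≤ K * (64 * n ^ 3) := Nat.mul_le_mul_left _ h4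
  have h6 : (100001000 + 64 * K) * n ^ 3 = 100001000 * n ^ 3 + K * (64 * n ^ 3) := by ring
  have h7 : 1 ≤ n ^ 3 := Nat.one_le_pow _ _ hn
  refine HaltsWithin.mono (T := 100000000 * (n * n) + (K * (2 * n + 2) ^ 3 + 1000))
    (HaltsWithin.seq ((haltsWithin_buildNetwork hn hs).mono le_rfl ?_)) (by omega) fun _ h => h
  rintro τ ⟨hag, hk, hcap⟩
  have hmax := hflow _ (FlowNetwork.matchNetwork n _ _ (fun u w => σ.nat kRel u w = 1)
    hμ.nonneg hν.nonneg) τ ⟨hk, rfl, rfl, fun u v => hcap u u.2 v v.2⟩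
  refine HaltsWithin.seq (hmax.mono le_rfl ?_)
  rintro τ' ⟨hag', hx⟩
  have hag2 : AgreeOff [kU, kW, kCalls, kFound] [] σ τ' :=
    (hag.mono (by decide) (by decide)).trans (hag'.mono (by decide) (by decide))
  have hlift := hx.sub_le_iff_lifting μ ν _ _ hμ hν htol
  rw [← hmass] at hlift
  have e1 : τ'.nat kCalls = σ.nat kCalls := by
    rw [hag'.nat_eq (by decide), hag.nat_eq (by decide)]
  have e2 : τ'.nat kFound = σ.nat kFound := by
    rw [hag'.nat_eq (by decide), hag.nat_eq (by decide)]
  have e3 : τ'.real kMass = σ.real kMass := hag2.real_eq (by decide)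
  refine (haltsWithin_of_wp ?_).mono (T := Prog.maxCost _) (by decide) fun _ h => h
  have hag3 : AgreeOff [kU, kW, kCalls, kFound] [] σ
      (τ'.updateNat kCalls 0 0 (τ'.nat kCalls 0 0 + 1)) := hag2.updateNat (by decide) _ _ _
  rw [e1] at hag3
  simp only [block, Prog.wp, assignNat, NExp.eval, RExp.eval, BExp.Holds, nvar_eval, rvar_eval,
    hag3.tolerance_eval (by decide) (by decide), updateNat_real, e3, hlift,
    updateNat_nat_self, updateNat_nat_of_ne _ _ _ _ (show kCalls ≠ kFound by decide),
    updateNat_nat_of_ne _ _ _ _ (show kFound ≠ kCalls by decide), e1, e2]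
  refine ⟨fun h => ⟨hag3.updateNat (by decide) _ _ _, trivial, ?_⟩,
    fun h => ⟨hag3, trivial, ?_⟩⟩
  · exact ⟨fun h' => absurd h' one_ne_zero, fun h' => absurd h h'.2⟩
  · exact ⟨fun h' => ⟨h', h⟩, fun h' => h'.1⟩

/-- A pair of states is removed if a transition from the first one is not matched. -/
theorem haltsWithin_treatTransition {flow : Prog} {K n k N : ℕ} (hflow : MaxFlowBound flow K)
    {P : FinitePA (Fin n) (Fin k)} {σ : Mem} (hP : HoldsInput σ P N) (hl : 1 ≤ P.maxBranching)
    {s t : Fin n} {a : Fin k} (hS : σ.nat kS 0 0 = s) (hT : σ.nat kT 0 0 = t)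
    (hA : σ.nat kA 0 0 = a) {μ : SubDist (Fin n)} (hμ : HoldsRow σ (rowMu.eval σ) μ)
    (htol : 0 ≤ tolerance.eval σ) :
    HaltsWithin (treatTransition flow) σ ((10000120000 + 6400 * K) * (P.maxBranching * n ^ 3))
      fun σ' =>
      AgreeOff [kU, kW, kCalls, kFound, kJ, kNext] [kMass] σ σ' ∧
      σ'.nat kCalls 0 0 ≤ σ.nat kCalls 0 0 + P.maxBranching ∧
      (∀ x y : ℕ, ¬ (x = s ∧ y = t) → σ'.nat kNext x y = σ.nat kNext x y) ∧
      (σ'.nat kNext s t = 1 ↔ σ.nat kNext s t = 1 ∧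
        ∃ ν ∈ P.trans t a, FinitePA.Lifting (tolerance.eval σ) (currentRel n σ) μ ν) := by
  have hn : 1 ≤ n := Nat.one_le_of_lt s.2
  have hs := hP.1
  set l := P.maxBranching with hldef
  set A := [kU, kW, kCalls, kFound, kJ] with hAdef
  have h3 : n ≤ n ^ 3 := Nat.le_self_pow (by norm_num) n
  have h7 : n ^ 3 ≤ l * n ^ 3 := Nat.le_mul_of_pos_left _ hl
  have hc1 : 1 ≤ (100001000 + 64 * K) * n ^ 3 :=
    Nat.mul_pos (by omega) (by omega)
  have h8 : (10000120000 + 6400 * K) * (l * n ^ 3)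
      = 100 * (l * ((100001000 + 64 * K) * n ^ 3)) + 20000 * (l * n ^ 3) := by ring
  have hcount : ∀ τ, AgreeOff A [kMass] σ τ →
      (NExp.get kCount (nvar kT) (nvar kA)).eval τ = σ.nat kCount t a := fun τ h => by
    simp only [NExp.eval, nvar_eval, h.nat_eq (x := kCount) (by decide),
      h.nat_eq (x := kT) (by decide), h.nat_eq (x := kA) (by decide), hT, hA]
  refine HaltsWithin.mono (T := (100 + (100 * (n * 100) + 1)) +
    (100 + (100 * (l * ((100001000 + 64 * K) * n ^ 3)) + 100)))
    (HaltsWithin.seq ((haltsWithin_computeMass hn hs).mono le_rfl ?_)) (by omega) fun _ h => h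
  rintro τ₁ ⟨hag₁, hmass₁⟩
  have hag₁' : AgreeOff A [kMass] σ τ₁ := hag₁.mono (by decide) (by decide)
  -- The test is indexed by rows, as in the loop; existence over all rows becomes existence over all
  -- transitions because every transition has a row.
  set Match : ℕ → Prop := fun j => ∃ ν ∈ P.trans t a, HoldsRow σ (σ.nat kBase t a + j) ν ∧
    FinitePA.Lifting (tolerance.eval σ) (currentRel n σ) μ ν with hMatch
  set I : ℕ → Mem → Prop := fun j τ => AgreeOff A [kMass] σ τ ∧
    τ.real kMass 0 0 = ∑ u ∈ Finset.range n, σ.real kProb (rowMu.eval σ) u ∧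
    τ.nat kNext = σ.nat kNext ∧
    τ.nat kCalls 0 0 = σ.nat kCalls 0 0 + j ∧
    (τ.nat kFound 0 0 = 0 ↔ ∀ j' < j, ¬ Match j') with hI
  have hinit : HaltsWithin (assignNat kFound (.lit 0)) τ₁ 100 (I 0) := by
    refine (haltsWithin_of_wp ?_).mono (T := Prog.maxCost _) (by decide) fun _ h => h
    refine ⟨hag₁'.updateNat (by decide) _ _ _, hmass₁, ?_, ?_, ?_⟩
    · exact hag₁.nat_eq (by decide)
    · exact congrFun (congrFun (hag₁.nat_eq (by decide)) 0) 0
    · simp [NExp.eval]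
  refine HaltsWithin.seq (hinit.mono le_rfl fun τ₂ h₂ => HaltsWithin.seq (HaltsWithin.mono
    (haltsWithin_forRange I 0 (σ.nat kCount t a) l ((100001000 + 64 * K) * n ^ 3) rfl
      (Nat.zero_le _) ((Nat.sub_le _ _).trans (hP.count_le t a)) hl hc1 (by decide) (by decide)
      ?_ ?_ ?_ (Q := I (σ.nat kCount t a)) fun _ h => h) le_rfl ?_))
  · exact ⟨h₂.1.updateNat (by decide) _ _ _, h₂.2⟩
  · exact fun j τ h _ => hcount τ h.1
  · rintro j τ - hj ⟨hag, hmass, hnext, hcalls, hfound⟩ hJ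
    obtain ⟨ν, hνP, hν⟩ := hP.exists_row t a hj
    have hrowMu : rowMu.eval τ = rowMu.eval σ := hag.rowMu_eval (by decide)
    have hrowNu : rowNu.eval τ = σ.nat kBase t a + j := by
      simp only [rowNu, NExp.eval, nvar_eval, hag.nat_eq (x := kBase) (by decide),
        hag.nat_eq (x := kT) (by decide), hag.nat_eq (x := kA) (by decide), hT, hA, hJ]
    have htol' := hag.tolerance_eval (by decide) (by decide)
    have hrel := hag.currentRel_eq n (by decide)
    refine (haltsWithin_matchTest hflow (σ := τ) (μ := μ) (ν := ν) hn ?_ ?_ ?_ ?_ ?_).mono le_rfl ?_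
    · rw [hag.nat_eq (by decide)]; exact hs
    · rw [hrowMu]; exact hμ.of_agreeOff hag (by decide)
    · rw [hrowNu]; exact hν.of_agreeOff hag (by decide)
    · rw [hmass, hrowMu, hag.real_eq (x := kProb) (by decide)]
    · rw [htol']; exact htol
    · rintro τ' ⟨hag', hcalls', hfound'⟩
      rw [htol', hrel] at hfound'
      refine ⟨?_, ?_, ?_, ?_, ?_, ?_⟩
      · rw [hag'.nat_eq (by decide)]; exact hJ
      · exact (hag.trans (hag'.mono (by decide) (by decide))).updateNat (by decide) _ _ _
      · rw [updateNat_real, hag'.real_eq (by decide)]; exact hmass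
      · rw [updateNat_nat_of_ne _ _ _ _ (by decide), hag'.nat_eq (by decide)]; exact hnext
      · rw [updateNat_nat_of_ne _ _ _ _ (by decide), hcalls', hcalls]; omega
      · rw [updateNat_nat_of_ne _ _ _ _ (by decide), hfound', hfound]
        -- A row determines its sub-distribution, so the witness in `Match j` must be the ν of the
        -- current test.
        have hM : Match j ↔ FinitePA.Lifting (tolerance.eval σ) (currentRel n σ) μ ν := by
          refine ⟨?_, fun h => ⟨ν, hνP, hν, h⟩⟩
          rintro ⟨ν', -, hν', h⟩
          rwa [hν.unique hν']
        rw [← hM]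
        constructor
        · rintro ⟨h1, h2⟩ j' hj'
          rcases Nat.lt_succ_iff_lt_or_eq.1 hj' with h | rfl
          · exact h1 j' h
          · exact h2
        · exact fun h => ⟨fun j' hj' => h j' (by omega), h j (by omega)⟩
  · rintro τ ⟨hag, -, hnext, hcalls, hfound⟩
    have hM : (∀ j' < σ.nat kCount t a, ¬ Match j') ↔
        ¬ ∃ ν ∈ P.trans t a, FinitePA.Lifting (tolerance.eval σ) (currentRel n σ) μ ν := by
      constructor
      · rintro h ⟨ν, hν, hL⟩
        obtain ⟨j, hj, hrow⟩ := hP.exists_index hν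
        exact h j hj ⟨ν, hν, hrow, hL⟩
      · rintro h j' - ⟨ν, hν, -, hL⟩
        exact h ⟨ν, hν, hL⟩
    rw [hM] at hfound
    have hag' : AgreeOff [kU, kW, kCalls, kFound, kJ, kNext] [kMass] σ τ :=
      hag.mono (by decide) (by decide)
    have hS' : τ.nat kS 0 0 = s := by rw [hag.nat_eq (by decide)]; exact hS
    have hT' : τ.nat kT 0 0 = t := by rw [hag.nat_eq (by decide)]; exact hT
    have hle := hP.count_le t a
    refine (haltsWithin_of_wp ?_).mono (T := Prog.maxCost _) (by decide) fun _ h => h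
    simp only [block, Prog.wp, NExp.eval, BExp.Holds, nvar_eval, hS', hT',
      updateNat_nat_of_ne _ _ _ _ (show kCalls ≠ kNext by decide), hcalls, updateNat_nat_apply,
      hnext, hfound]
    refine ⟨fun h => ⟨hag'.updateNat (by decide) _ _ _, by omega, fun x y hxy => ?_, ?_⟩,
      fun h => ⟨hag', by omega, fun _ _ _ => trivial, ?_⟩⟩
    · rw [if_neg hxy]
    · rw [if_pos ⟨trivial, trivial⟩]
      exact ⟨fun h' => absurd h' (by decide), fun h' => absurd h'.2 h⟩
    · exact ⟨fun h' => ⟨h', not_not.1 h⟩, fun h' => h'.1⟩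

/-- A pair of states is removed unless all transitions from the first one are matched. -/
theorem haltsWithin_treatPair {flow : Prog} {K n k N : ℕ} (hflow : MaxFlowBound flow K)
    {P : FinitePA (Fin n) (Fin k)} {σ : Mem} (hP : HoldsInput σ P N) (hl : 1 ≤ P.maxBranching)
    (hk : 1 ≤ k) {s t : Fin n} (hS : σ.nat kS 0 0 = s) (hT : σ.nat kT 0 0 = t)
    (htol : 0 ≤ tolerance.eval σ) :
    HaltsWithin (forRange kA (.lit 0) (nvar kActs)
        (forRange kI (.lit 0) (.get kCount (nvar kS) (nvar kA)) (treatTransition flow))) σ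
      (100 * (k * (100 * (P.maxBranching *
        ((10000120000 + 6400 * K) * (P.maxBranching * n ^ 3)))))) fun σ' =>
      AgreeOff [kU, kW, kCalls, kFound, kJ, kNext, kI, kA] [kMass] σ σ' ∧
      σ'.nat kCalls 0 0 ≤ σ.nat kCalls 0 0 + k * (P.maxBranching * P.maxBranching) ∧
      (∀ x y : ℕ, ¬ (x = s ∧ y = t) → σ'.nat kNext x y = σ.nat kNext x y) ∧
      (σ'.nat kNext s t = 1 ↔ σ.nat kNext s t = 1 ∧ ∀ a, ∀ μ ∈ P.trans s a,
        ∃ ν ∈ P.trans t a, FinitePA.Lifting (tolerance.eval σ) (currentRel n σ) μ ν) := by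
  have hn : 1 ≤ n := Nat.one_le_of_lt s.2
  set l := P.maxBranching with hldef
  set A := [kU, kW, kCalls, kFound, kJ, kNext, kI, kA] with hAdef
  have hc1 : 1 ≤ (10000120000 + 6400 * K) * (l * n ^ 3) :=
    Nat.mul_pos (by omega) (Nat.mul_pos hl (Nat.one_le_pow _ _ hn))
  have hc2 : 1 ≤ l * ((10000120000 + 6400 * K) * (l * n ^ 3)) := Nat.mul_pos hl hc1
  set M : Fin k → SubDist (Fin n) → Prop := fun a μ =>
    ∃ ν ∈ P.trans t a, FinitePA.Lifting (tolerance.eval σ) (currentRel n σ) μ ν with hM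
  -- `D` collects the transitions from s that have been treated, and `c` bounds the flow
  -- computations made for this pair so far.
  set I : ℕ → (Fin k → SubDist (Fin n) → Prop) → Mem → Prop := fun c D τ => AgreeOff A [kMass] σ τ ∧
    τ.nat kCalls 0 0 ≤ σ.nat kCalls 0 0 + c ∧
    (∀ x y : ℕ, ¬ (x = s ∧ y = t) → τ.nat kNext x y = σ.nat kNext x y) ∧
    (τ.nat kNext s t = 1 ↔ σ.nat kNext s t = 1 ∧ ∀ a μ, D a μ → M a μ) with hI
  have hIcongr : ∀ {c c' D D' τ}, I c D τ → c ≤ c' → (∀ a μ, D a μ ↔ D' a μ) → I c' D' τ := by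
    rintro c c' D D' τ ⟨h1, h2, h3, h4⟩ hc hD
    have : D = D' := funext fun a => funext fun μ => propext (hD a μ)
    subst this
    exact ⟨h1, by omega, h3, h4⟩
  have hIupd : ∀ {c D τ x j}, I c D τ → x ∈ [kI, kA] → I c D (τ.updateNat x 0 0 j) := by
    rintro c D τ x j ⟨h1, h2, h3, h4⟩ hx
    simp only [List.mem_cons, List.not_mem_nil, or_false] at hx
    rcases hx with rfl | rfl
    · exact ⟨h1.updateNat (by decide) _ _ _, h2, h3, h4⟩
    · exact ⟨h1.updateNat (by decide) _ _ _, h2, h3, h4⟩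
  refine haltsWithin_forRange (fun i τ => I (i * (l * l))
    (fun a μ => (a : ℕ) < i ∧ μ ∈ P.trans s a) τ) 0 k k _ rfl
    (Nat.zero_le _) (Nat.sub_le _ _) hk (by omega) (by decide) (by decide) ?_ ?_ ?_ ?_
  · refine ⟨(AgreeOff.refl _ _ _).updateNat (by decide) _ _ _, Nat.le_add_right _ _,
      fun _ _ _ => rfl, ?_⟩
    exact ⟨fun h => ⟨h, fun a μ hD => absurd hD.1 (Nat.not_lt_zero _)⟩, fun h => h.1⟩
  · rintro i τ h -
    rw [nvar_eval, h.1.nat_eq (by decide)]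
    exact hP.2.1
  · rintro i τ - hi h hA
    have hi' : ((⟨i, hi⟩ : Fin k) : ℕ) = i := rfl
    have hcnt := hP.count_le s ⟨i, hi⟩
    -- Treated so far: all transitions with a label before i, and those with label i in the first j
    -- rows. Each row costs at most l flow computations.
    refine haltsWithin_forRange (fun j τ => τ.nat kA 0 0 = i ∧ I (i * (l * l) + j * l)
      (fun a μ => ((a : ℕ) < i ∧ μ ∈ P.trans s a) ∨ ((a : ℕ) = i ∧ μ ∈ P.trans s a ∧
        ∃ j' < j, HoldsRow σ (σ.nat kBase s i + j') μ)) τ) 0 (σ.nat kCount s i) l _ rfl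
      (Nat.zero_le _) ((Nat.sub_le _ _).trans hcnt) hl hc1 (by decide) (by decide) ?_ ?_ ?_ ?_
    · refine ⟨hA, hIupd (hIcongr h (Nat.le_add_right _ _) fun a μ => ?_) (by decide)⟩
      simp
    · rintro j τ ⟨hA, hag, -⟩ -
      simp only [NExp.eval, nvar_eval, hA, hag.nat_eq (x := kCount) (by decide),
        hag.nat_eq (x := kS) (by decide), hS]
    · rintro j τ - hj ⟨hA, hag, hcalls, hne, hiff⟩ hJ
      obtain ⟨μ, hμP, hμ⟩ := hP.exists_row s ⟨i, hi⟩ hj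
      have hS' : τ.nat kS 0 0 = s := by rw [hag.nat_eq (by decide)]; exact hS
      have hT' : τ.nat kT 0 0 = t := by rw [hag.nat_eq (by decide)]; exact hT
      have htol' := hag.tolerance_eval (by decide) (by decide)
      have hrel := hag.currentRel_eq n (by decide)
      have hrow : rowMu.eval τ = σ.nat kBase s i + j := by
        simp only [rowMu, NExp.eval, nvar_eval, hag.nat_eq (x := kBase) (by decide), hS', hA, hJ]
      refine (haltsWithin_treatTransition hflow (hP.of_agreeOff hag (by decide) (by decide)) hl
        (a := ⟨i, hi⟩) (μ := μ) hS' hT' hA ?_ (by rw [htol']; exact htol)).mono le_rfl ?_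
      · rw [hrow]; exact hμ.of_agreeOff hag (by decide)
      · rintro τ' ⟨hag', hcalls', hne', hiff'⟩
        rw [htol', hrel] at hiff'
        refine ⟨?_, ?_, hIupd ⟨hag.trans (hag'.mono (by decide) (by decide)), ?_,
          fun x y hxy => (hne' x y hxy).trans (hne x y hxy), ?_⟩ (by decide)⟩
        · rw [hag'.nat_eq (by decide)]; exact hJ
        · rw [updateNat_nat_of_ne _ _ _ _ (by decide), hag'.nat_eq (by decide)]; exact hA
        · rw [add_mul j 1 l]; omega
        · rw [hiff', hiff]
          constructor
          · rintro ⟨⟨h1, h2⟩, h3⟩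
            refine ⟨h1, ?_⟩
            rintro a μ' (hD | ⟨ha, hμ', j', hj', hrow'⟩)
            · exact h2 a μ' (Or.inl hD)
            · rcases Nat.lt_succ_iff_lt_or_eq.1 hj' with h | rfl
              · exact h2 a μ' (Or.inr ⟨ha, hμ', j', h, hrow'⟩)
              · obtain rfl : a = ⟨i, hi⟩ := Fin.ext ha
                rw [hrow'.unique hμ]
                exact h3
          · rintro ⟨h1, h2⟩
            refine ⟨⟨h1, ?_⟩, h2 ⟨i, hi⟩ μ (Or.inr ⟨rfl, hμP, j, by omega, hμ⟩)⟩
            rintro a μ' (hD | ⟨ha, hμ', j', hj', hrow'⟩)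
            · exact h2 a μ' (Or.inl hD)
            · exact h2 a μ' (Or.inr ⟨ha, hμ', j', by omega, hrow'⟩)
    · rintro τ' ⟨hA', h'⟩
      refine ⟨hA', hIupd (hIcongr h' ?_ fun a μ => ?_) (by decide)⟩
      · rw [add_mul i 1, one_mul]
        exact Nat.add_le_add_left (Nat.mul_le_mul_right _ hcnt) _
      · constructor
        · rintro (⟨h1, h2⟩ | ⟨h1, h2, -⟩)
          · exact ⟨by omega, h2⟩
          · exact ⟨by omega, h2⟩
        · rintro ⟨h1, h2⟩
          rcases Nat.lt_succ_iff_lt_or_eq.1 h1 with h | h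
          · exact Or.inl ⟨h, h2⟩
          · obtain ⟨j, hj, hrow⟩ := hP.exists_index h2
            rw [h] at hj hrow
            exact Or.inr ⟨h, h2, j, hj, hrow⟩
  · rintro τ ⟨h1, h2, h3, h4⟩
    refine ⟨h1, h2, h3, h4.trans (and_congr_right fun _ => ?_)⟩
    exact ⟨fun h a μ hμ => h a μ ⟨a.2, hμ⟩, fun h a μ hD => h a μ hD.2⟩

end RealRAM

/-! ### The successive relations and the decayed distance -/

namespace FinitePA

variable {S Act : Type} [Fintype S] [Fintype Act]

theorem Lifting.mono {ε : ℝ} {R R' : S → S → Prop} {μ ν : SubDist S} (h : Lifting ε R μ ν)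
    (hR : ∀ s t, R s t → R' s t) : Lifting ε R' μ ν := by
  refine fun E => (h E).trans (add_le_add_left (Finset.sum_le_sum fun s _ => ?_) ε)
  refine Set.indicator_le_indicator_of_subset ?_ (fun _ => ν.nonneg _) s
  rintro y ⟨x, hx, hxy⟩
  exact ⟨x, hx, hR _ _ hxy⟩

/-- The relations that are computed by successive rounds with step `1 / N`. -/
def decayRel (P : FinitePA S Act) (N : ℕ) : ℕ → S → S → Prop
  | 0 => fun _ _ => True
  | i + 1 => fun s t => P.decayRel N i s t ∧ ∀ a, ∀ μ ∈ P.trans s a, ∃ ν ∈ P.trans t a,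
      Lifting (1 - ((i + 1 : ℕ) : ℝ) * (1 / (N : ℝ))) (P.decayRel N i) μ ν

theorem linearDecay_iterate (N m : ℕ) {x : ℝ} (hx : x ≤ 1) :
    (linearDecay N)^[m] x = min (x + m * (1 / (N : ℝ))) 1 := by
  induction m with
  | zero => simp [hx]
  | succ m ih =>
    have hδ : 0 ≤ 1 / (N : ℝ) := by positivity
    rw [Function.iterate_succ_apply', ih, linearDecay, Nat.cast_succ, add_mul, one_mul]
    rcases le_total (x + m * (1 / (N : ℝ))) 1 with h | h
    · rw [min_eq_left h, add_assoc]
    · rw [min_eq_right h, min_eq_right (by linarith), min_eq_right (by linarith)]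

/-- The m-th iterate is min(x + mδ, 1), which equals 1 exactly from 1 - mδ on; the maximum with 0
takes care of mδ > 1. -/
theorem isIterPreimageOne_linearDecay (N m : ℕ) :
    IsIterPreimageOne (linearDecay N) m (max (1 - m * (1 / (N : ℝ))) 0) := by
  have hδ : 0 ≤ m * (1 / (N : ℝ)) := by positivity
  refine ⟨⟨⟨le_max_right _ _, max_le (by linarith) zero_le_one⟩, ?_⟩, ?_⟩
  · rw [linearDecay_iterate _ _ (max_le (by linarith) zero_le_one), min_eq_right]
    linarith [le_max_left (1 - m * (1 / (N : ℝ))) 0]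
  · rintro x ⟨⟨h0, h1⟩, hx⟩
    rw [linearDecay_iterate _ _ h1] at hx
    have := min_eq_right_iff.1 hx
    exact max_le (by linarith) h0

/-- An order `m` simulation stays within the computed relations. -/
theorem DecaySimulated.decayRel {P : FinitePA S Act} {N m : ℕ} (hN : 1 ≤ N) {s t : S}
    (h : P.DecaySimulated (linearDecay N) m (max (1 - m * (1 / (N : ℝ))) 0) s t) :
    P.decayRel N (min m N) s t := by
  obtain ⟨R, ⟨-, hmono, hsim⟩, hst⟩ := h
  have hN0 : (N : ℝ) ≠ 0 := Nat.cast_ne_zero.2 (by omega)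
  have hNδ : (N : ℝ) * (1 / (N : ℝ)) = 1 := mul_one_div_cancel hN0
  have hδ : 0 ≤ 1 / (N : ℝ) := by positivity
  -- For m > N the first m - N levels of the simulation are discarded and the last N are compared
  -- with the computed relations; for m ≤ N there is no shift.
  have key : ∀ j ≤ min m N, ∀ s t, R (m - min m N + j) s t → P.decayRel N j s t := by
    intro j
    induction j with
    | zero => exact fun _ _ _ _ => trivial
    | succ j ih =>
      intro hj s t hR
      refine ⟨ih (by omega) s t (hmono _ (by omega) s t hR), fun a μ hμ => ?_⟩
      obtain ⟨ν, hν, hL⟩ := hsim (m - min m N + (j + 1)) (by omega) (by omega) s t hR a μ hμ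
      refine ⟨ν, hν, ?_⟩
      -- In both cases the tolerance at the shifted level is 1 - (j + 1)δ: from (1 - mδ) + (m - j -
      -- 1)δ if m ≤ N, and from 0 + (N - j - 1)δ with Nδ = 1 otherwise.
      have htol : (linearDecay N)^[m - (m - min m N + (j + 1))] (max (1 - m * (1 / (N : ℝ))) 0)
          = 1 - ((j + 1 : ℕ) : ℝ) * (1 / (N : ℝ)) := by
        have hm : 0 ≤ m * (1 / (N : ℝ)) := by positivity
        have hj0 : 0 ≤ ((j + 1 : ℕ) : ℝ) * (1 / (N : ℝ)) := by positivity
        rw [linearDecay_iterate _ _ (max_le (by linarith) zero_le_one)]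
        rcases le_total m N with hmN | hmN
        · have e1 : ((m - (m - min m N + (j + 1)) : ℕ) : ℝ) = m - ((j + 1 : ℕ) : ℝ) := by
            rw [← Nat.cast_sub (by omega)]; congr 1; omega
          have e2 : (m : ℝ) * (1 / (N : ℝ)) ≤ 1 :=
            (mul_le_mul_of_nonneg_right (Nat.cast_le.2 hmN) hδ).trans_eq hNδ
          rw [e1, sub_mul, max_eq_left (by linarith), min_eq_left (by linarith)]
          ring
        · have e1 : ((m - (m - min m N + (j + 1)) : ℕ) : ℝ) = N - ((j + 1 : ℕ) : ℝ) := by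
            rw [← Nat.cast_sub (by omega)]; congr 1; omega
          have e2 : 1 ≤ (m : ℝ) * (1 / (N : ℝ)) :=
            hNδ.symm.trans_le (mul_le_mul_of_nonneg_right (Nat.cast_le.2 hmN) hδ)
          rw [e1, sub_mul, hNδ, max_eq_right (by linarith), zero_add, min_eq_left (by linarith)]
      rw [htol] at hL
      exact hL.mono (ih (by omega))
  refine key _ le_rfl s t ?_
  rwa [Nat.sub_add_cancel (min_le_left _ _)]

/-- The computed relations themselves form the simulation, since (1 - mδ) + (m - i)δ = 1 - iδ. -/
theorem decaySimulated_of_decayRel {P : FinitePA S Act} {N m : ℕ} {s t : S}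
    (h : P.decayRel N m s t) :
    P.DecaySimulated (linearDecay N) m (1 - m * (1 / (N : ℝ))) s t := by
  refine ⟨P.decayRel N, ⟨fun _ _ => trivial, fun i _ s t h => h.1, ?_⟩, h⟩
  intro i h1 hi s t hst a μ hμ
  obtain ⟨i, rfl⟩ : ∃ j, i = j + 1 := ⟨i - 1, by omega⟩
  obtain ⟨ν, hν, hL⟩ := hst.2 a μ hμ
  refine ⟨ν, hν, ?_⟩
  have hδ : 0 ≤ m * (1 / (N : ℝ)) := by positivity
  have hi0 : 0 ≤ ((i + 1 : ℕ) : ℝ) * (1 / (N : ℝ)) := by positivity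
  rw [linearDecay_iterate _ _ (by linarith), Nat.cast_sub hi, sub_mul, min_eq_left (by linarith)]
  convert hL using 1
  · ring
  · rfl

/-- The decayed distance is read off from the last round in which the pair is related in both
directions. -/
theorem isDecayDistance_of_last {P : FinitePA S Act} {N j : ℕ} (hN : 1 ≤ N) (hj : j ≤ N) {s t : S}
    (h1 : P.decayRel N j s t) (h2 : P.decayRel N j t s)
    (hlast : ∀ j' ≤ N, P.decayRel N j' s t → P.decayRel N j' t s → j' ≤ j) :
    P.IsDecayDistance (linearDecay N) s t (1 - j * (1 / (N : ℝ))) := by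
  have hN0 : (N : ℝ) ≠ 0 := Nat.cast_ne_zero.2 (by omega)
  have hNδ : (N : ℝ) * (1 / (N : ℝ)) = 1 := mul_one_div_cancel hN0
  have hδ : 0 ≤ 1 / (N : ℝ) := by positivity
  have hjδ : (j : ℝ) * (1 / (N : ℝ)) ≤ 1 :=
    (mul_le_mul_of_nonneg_right (Nat.cast_le.2 hj) hδ).trans_eq hNδ
  constructor
  · refine ⟨j, ?_, decaySimulated_of_decayRel h1, decaySimulated_of_decayRel h2⟩
    have := isIterPreimageOne_linearDecay N j
    rwa [max_eq_left (by linarith)] at this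
  · rintro ε ⟨m, hm, hs, ht⟩
    obtain rfl := hm.unique (isIterPreimageOne_linearDecay N m)
    have hle := hlast _ (min_le_right _ _) (hs.decayRel hN) (ht.decayRel hN)
    rcases le_total m N with hmN | hmN
    · rw [min_eq_left hmN] at hle
      refine le_trans ?_ (le_max_left _ _)
      exact sub_le_sub_left (mul_le_mul_of_nonneg_right (Nat.cast_le.2 hle) hδ) 1
    -- Bisimilarity of an order m ≥ N forces the pair to survive all N rounds, so j = N and the
    -- claimed distance is 0.
    · rw [min_eq_right hmN] at hle
      obtain rfl : j = N := le_antisymm hj hle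
      rw [hNδ, sub_self]
      exact le_max_right _ _

end FinitePA

/-! ### Correctness and running time of Algorithm C -/

namespace RealRAM

theorem haltsWithin_initialise {σ : Mem} {n N : ℕ} (hn : 1 ≤ n) (hs : σ.nat kStates 0 0 = n)
    (hN : σ.nat kRounds 0 0 = N) :
    HaltsWithin initialise σ (1001000 * (n * n)) fun σ' =>
      AgreeOff [kS, kT, kRel, kCalls] [kDelta, kDist] σ σ' ∧ σ'.real kDelta 0 0 = 1 / (N : ℝ) ∧
      σ'.nat kCalls 0 0 = 0 ∧
      ∀ s < n, ∀ t < n, σ'.real kDist s t = 1 ∧ σ'.nat kRel s t = 1 := by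
  have h1 : 1 ≤ n * n := Nat.mul_pos hn hn
  refine HaltsWithin.mono (T := 100 + (100 * (n * (100 * (n * 100))) + 100))
    (HaltsWithin.seq (HaltsWithin.mono (Q := fun τ =>
      AgreeOff [kS, kT, kRel, kCalls] [kDelta, kDist] σ τ ∧ τ.real kDelta 0 0 = 1 / (N : ℝ))
      ((haltsWithin_of_wp ?_).mono (T := Prog.maxCost _) (by decide) fun _ h => h) le_rfl ?_))
    ?_ fun _ h => h
  · simp only [assignReal, Prog.wp, RExp.eval, NExp.eval, nvar_eval, hN, updateReal_real_self,
      Nat.cast_one]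
    exact ⟨(AgreeOff.refl _ _ _).updateReal (by decide) _ _ _, trivial⟩
  · rintro τ ⟨hag, hδ⟩
    refine HaltsWithin.seq (haltsWithin_forPairs (fun D _ τ =>
      AgreeOff [kS, kT, kRel, kCalls] [kDelta, kDist] σ τ ∧ τ.real kDelta 0 0 = 1 / (N : ℝ) ∧
      ∀ s t, D s t → τ.real kDist s t = 1 ∧ τ.nat kRel s t = 1) hn (by decide) ?_ ?_ ?_ ?_ ?_)
    · exact ⟨hag, hδ, fun _ _ h => h.elim⟩
    · rintro D i τ ⟨hag, -⟩
      rw [hag.nat_eq (by decide)]; exact hs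
    · rintro D i τ j ⟨hag, h⟩
      exact ⟨⟨hag.updateNat (by decide) _ _ _, h⟩, ⟨hag.updateNat (by decide) _ _ _, h⟩⟩
    · rintro D i s t τ - - - ⟨hag, hδ, h⟩ hS hT
      refine (haltsWithin_of_wp ?_).mono (T := Prog.maxCost _) (by decide) fun _ h => h
      simp only [block, Prog.wp, RExp.eval, NExp.eval, nvar_eval, updateReal_nat, hS, hT,
        Nat.cast_one, updateNat_real]
      refine ⟨hS, hT, (hag.updateReal (by decide) _ _ _).updateNat (by decide) _ _ _, hδ, ?_⟩
      rintro s' t' hD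
      rw [updateReal_real_apply, updateNat_nat_apply]
      by_cases h' : s' = s ∧ t' = t
      · rw [if_pos h', if_pos h']; exact ⟨rfl, rfl⟩
      · rw [if_neg h', if_neg h']
        exact h s' t' (hD.resolve_right h')
    · rintro τ ⟨hag, hδ, h⟩
      refine (haltsWithin_of_wp ?_).mono (T := Prog.maxCost _) (by decide) fun _ h => h
      exact ⟨hag.updateNat (by decide) _ _ _, hδ, rfl, fun s hs t ht => h s t ⟨hs, ht⟩⟩
  · have : 100 * (n * (100 * (n * 100))) = 1000000 * (n * n) := by ring
    omega

/-- Copying the matrix `y` to `x`. -/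
theorem haltsWithin_copy {σ : Mem} {n x y : ℕ} (hn : 1 ≤ n) (hs : σ.nat kStates 0 0 = n)
    (hx : x ∈ [kRel, kNext]) (hy : y ∈ [kRel, kNext]) (hxy : y ≠ x) :
    HaltsWithin (forPairs (.setNat x (nvar kS) (nvar kT) (.get y (nvar kS) (nvar kT)))) σ
      (100 * (n * (100 * (n * 100)))) fun σ' =>
      AgreeOff [kS, kT, x] [] σ σ' ∧ ∀ s < n, ∀ t < n, σ'.nat x s t = σ.nat y s t := by
  have hne : y < 100 ∧ y ∉ [kS, kT, x] ∧ kStates ∉ [kS, kT, x] ∧ kS ≠ x ∧ kT ≠ x ∧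
      kS ≠ y ∧ kT ≠ y := by
    simp only [List.mem_cons, List.not_mem_nil, or_false] at hx hy
    rcases hx with rfl | rfl <;> rcases hy with rfl | rfl <;> first | exact absurd rfl hxy | decide
  obtain ⟨h1, h2, h3, h4, h5, h6, h7⟩ := hne
  refine haltsWithin_forPairs (fun D _ τ => AgreeOff [kS, kT, x] [] σ τ ∧
    ∀ s t, D s t → τ.nat x s t = σ.nat y s t) hn (by decide) ?_ ?_ ?_ ?_ ?_
  · exact ⟨AgreeOff.refl _ _ _, fun _ _ h => h.elim⟩
  · rintro D i τ ⟨hag, -⟩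
    rw [hag.nat_eq ⟨by decide, h3⟩]; exact hs
  · rintro D i τ j ⟨hag, h⟩
    refine ⟨⟨hag.updateNat (Or.inr (by simp)) _ _ _, ?_⟩,
      ⟨hag.updateNat (Or.inr (by simp)) _ _ _, ?_⟩⟩
    · rwa [updateNat_nat_of_ne _ _ _ _ h4.symm]
    · rwa [updateNat_nat_of_ne _ _ _ _ h5.symm]
  · rintro D i s t τ - - - ⟨hag, h⟩ hS hT
    refine (haltsWithin_of_wp ?_).mono (T := Prog.maxCost _) ?_ fun _ h => h
    · simp only [Prog.wp, NExp.eval, nvar_eval, hS, hT]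
      refine ⟨?_, ?_, hag.updateNat (Or.inr (by simp)) _ _ _, fun s' t' hD => ?_⟩
      · rwa [updateNat_nat_of_ne _ _ _ _ h4]
      · rwa [updateNat_nat_of_ne _ _ _ _ h5]
      · rw [updateNat_nat_apply]
        by_cases h' : s' = s ∧ t' = t
        · rw [if_pos h', h'.1, h'.2, hag.nat_eq ⟨h1, h2⟩]
        · rw [if_neg h']
          exact h s' t' (hD.resolve_right h')
    · simp [Prog.maxCost, NExp.cost, nvar]
  · rintro τ ⟨hag, h⟩
    exact ⟨hag, fun s hs t ht => h s t ⟨hs, ht⟩⟩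

/-- The tests read `kRel` and write `kNext` at the current pair only, so the pairs do not influence
each other and the order in which they are treated is irrelevant. -/
theorem haltsWithin_treatPairs {flow : Prog} {K n k N : ℕ} (hflow : MaxFlowBound flow K)
    {P : FinitePA (Fin n) (Fin k)} {σ : Mem} (hP : HoldsInput σ P N) (hl : 1 ≤ P.maxBranching)
    (hn : 1 ≤ n) (hk : 1 ≤ k) (htol : 0 ≤ tolerance.eval σ) :
    HaltsWithin (forPairs (forRange kA (.lit 0) (nvar kActs)
        (forRange kI (.lit 0) (.get kCount (nvar kS) (nvar kA)) (treatTransition flow)))) σ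
      (100 * (n * (100 * (n * (100 * (k * (100 * (P.maxBranching *
        ((10000120000 + 6400 * K) * (P.maxBranching * n ^ 3)))))))))) fun σ' =>
      AgreeOff [kU, kW, kCalls, kFound, kJ, kNext, kI, kA, kS, kT] [kMass] σ σ' ∧
      σ'.nat kCalls 0 0 ≤ σ.nat kCalls 0 0 + n * n * (k * (P.maxBranching * P.maxBranching)) ∧
      ∀ s t : Fin n, σ'.nat kNext s t = 1 ↔ σ.nat kNext s t = 1 ∧ ∀ a, ∀ μ ∈ P.trans s a,
        ∃ ν ∈ P.trans t a, FinitePA.Lifting (tolerance.eval σ) (currentRel n σ) μ ν := by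
  set A := [kU, kW, kCalls, kFound, kJ, kNext, kI, kA, kS, kT] with hA
  set l := P.maxBranching with hldef
  have hc : 1 ≤ 100 * (k * (100 * (l * ((10000120000 + 6400 * K) * (l * n ^ 3))))) :=
    Nat.mul_pos (by decide) (Nat.mul_pos hk (Nat.mul_pos (by decide) (Nat.mul_pos hl
      (Nat.mul_pos (by omega) (Nat.mul_pos hl (Nat.one_le_pow _ _ hn))))))
  refine haltsWithin_forPairs (fun D c τ => AgreeOff A [kMass] σ τ ∧
    τ.nat kCalls 0 0 ≤ σ.nat kCalls 0 0 + c * (k * (l * l)) ∧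
    ∀ s t : Fin n, τ.nat kNext s t = 1 ↔ σ.nat kNext s t = 1 ∧ (D s t → ∀ a, ∀ μ ∈ P.trans s a,
        ∃ ν ∈ P.trans t a, FinitePA.Lifting (tolerance.eval σ) (currentRel n σ) μ ν))
    hn hc ?_ ?_ ?_ ?_ ?_
  · exact ⟨AgreeOff.refl _ _ _, Nat.le_add_right _ _, fun s t => ⟨fun h => ⟨h, fun h => h.elim⟩,
      fun h => h.1⟩⟩
  · rintro D i τ ⟨hag, -⟩
    rw [hag.nat_eq (by decide)]; exact hP.1
  · rintro D i τ j ⟨hag, h⟩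
    exact ⟨⟨hag.updateNat (by decide) _ _ _, h⟩, ⟨hag.updateNat (by decide) _ _ _, h⟩⟩
  · rintro D c s t τ hs ht - ⟨hag, hcalls, h⟩ hS hT
    have htol' := hag.tolerance_eval (by decide) (by decide)
    have hrel := hag.currentRel_eq n (by decide)
    refine (haltsWithin_treatPair hflow (hP.of_agreeOff hag (by decide) (by decide)) hl hk
      (s := ⟨s, hs⟩) (t := ⟨t, ht⟩) hS hT (by rw [htol']; exact htol)).mono le_rfl ?_
    rintro τ' ⟨hag', hcalls', hne, hiff⟩
    rw [htol', hrel] at hiff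
    refine ⟨?_, ?_, hag.trans (hag'.mono (by decide) (by decide)), ?_, fun s' t' => ?_⟩
    · rw [hag'.nat_eq (by decide)]; exact hS
    · rw [hag'.nat_eq (by decide)]; exact hT
    · rw [← hldef] at hcalls'
      rw [add_mul c 1, one_mul]; omega
    · by_cases h' : (s' : ℕ) = s ∧ (t' : ℕ) = t
      · obtain ⟨rfl, rfl⟩ := h'
        rw [hiff, h s' t']
        exact ⟨fun h => ⟨h.1.1, fun _ => h.2⟩,
          fun h => ⟨⟨h.1, fun _ => h.2 (Or.inr ⟨rfl, rfl⟩)⟩, h.2 (Or.inr ⟨rfl, rfl⟩)⟩⟩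
      · rw [hne s' t' h', h s' t']
        exact and_congr_right fun _ => ⟨fun h hD => h (hD.resolve_right h'),
          fun h hD => h (Or.inl hD)⟩
  · rintro τ ⟨hag, hcalls, h⟩
    refine ⟨hag, hcalls, fun s t => (h s t).trans (and_congr_right fun _ => ?_)⟩
    exact ⟨fun h => h ⟨s.2, t.2⟩, fun h _ => h⟩

theorem haltsWithin_updateDist {σ : Mem} {n : ℕ} (hn : 1 ≤ n) (hs : σ.nat kStates 0 0 = n) :
    HaltsWithin (forPairs
      (.cond (.and (.eqNat (.get kRel (nvar kS) (nvar kT)) (.lit 1))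
          (.eqNat (.get kRel (nvar kT) (nvar kS)) (.lit 1)))
        (.setReal kDist (nvar kS) (nvar kT) tolerance)
        .skip)) σ (100 * (n * (100 * (n * 100)))) fun σ' =>
      AgreeOff [kS, kT] [kDist] σ σ' ∧ ∀ s < n, ∀ t < n,
        (σ.nat kRel s t = 1 ∧ σ.nat kRel t s = 1 → σ'.real kDist s t = tolerance.eval σ) ∧
        (¬ (σ.nat kRel s t = 1 ∧ σ.nat kRel t s = 1) →
          σ'.real kDist s t = σ.real kDist s t) := by
  refine haltsWithin_forPairs (fun D _ τ => AgreeOff [kS, kT] [kDist] σ τ ∧ ∀ s t,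
    (D s t ∧ σ.nat kRel s t = 1 ∧ σ.nat kRel t s = 1 → τ.real kDist s t = tolerance.eval σ) ∧
    (¬ (D s t ∧ σ.nat kRel s t = 1 ∧ σ.nat kRel t s = 1) →
          τ.real kDist s t = σ.real kDist s t)) hn (by decide) ?_ ?_ ?_ ?_ ?_
  · exact ⟨AgreeOff.refl _ _ _, fun _ _ => ⟨fun h => h.1.elim, fun _ => rfl⟩⟩
  · rintro D i τ ⟨hag, -⟩
    rw [hag.nat_eq (by decide)]; exact hs
  · rintro D i τ j ⟨hag, h⟩
    exact ⟨⟨hag.updateNat (by decide) _ _ _, h⟩, ⟨hag.updateNat (by decide) _ _ _, h⟩⟩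
  · rintro D i s t τ - - - ⟨hag, h⟩ hS hT
    refine (haltsWithin_of_wp ?_).mono (T := Prog.maxCost _) (by decide) fun _ h => h
    simp only [Prog.wp, NExp.eval, BExp.Holds, nvar_eval, hS, hT, updateReal_nat, true_and,
      hag.nat_eq (x := kRel) (by decide), hag.tolerance_eval (by decide) (by decide)]
    refine ⟨fun hrel => ⟨hag.updateReal (by decide) _ _ _, fun s' t' => ?_⟩,
      fun hrel => ⟨hag, fun s' t' => ?_⟩⟩
    · rw [updateReal_real_apply]
      by_cases h' : s' = s ∧ t' = t
      · rw [if_pos h']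
        refine ⟨fun _ => rfl, fun hn => absurd ⟨Or.inr h', ?_⟩ hn⟩
        rw [h'.1, h'.2]; exact hrel
      · rw [if_neg h']
        exact ⟨fun hD => (h s' t').1 ⟨hD.1.resolve_right h', hD.2⟩,
          fun hD => (h s' t').2 fun hD' => hD ⟨Or.inl hD'.1, hD'.2⟩⟩
    · by_cases h' : s' = s ∧ t' = t
      · obtain ⟨rfl, rfl⟩ := h'
        exact ⟨fun hD => absurd hD.2 hrel, fun _ => (h s' t').2 fun hD => hrel hD.2⟩
      · exact ⟨fun hD => (h s' t').1 ⟨hD.1.resolve_right h', hD.2⟩,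
          fun hD => (h s' t').2 fun hD' => hD ⟨Or.inl hD'.1, hD'.2⟩⟩
  · rintro τ ⟨hag, h⟩
    exact ⟨hag, fun s hs t ht => ⟨fun h' => (h s t).1 ⟨⟨hs, ht⟩, h'⟩,
      fun h' => (h s t).2 fun hD => h' hD.2⟩⟩

/-- One round of Algorithm C. -/
theorem haltsWithin_round {flow : Prog} {K n k N r : ℕ} (hflow : MaxFlowBound flow K)
    {P : FinitePA (Fin n) (Fin k)} {σ : Mem} (hP : HoldsInput σ P N) (hl : 1 ≤ P.maxBranching)
    (hn : 1 ≤ n) (hk : 1 ≤ k) (hr : r < N) (hround : σ.nat kN 0 0 = r + 1)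
    (hδ : σ.real kDelta 0 0 = 1 / (N : ℝ))
    (hrel : ∀ s t : Fin n, σ.nat kRel s t = 1 ↔ P.decayRel N r s t)
    (hdist : ∀ s t : Fin n, ∃ j ≤ r, σ.real kDist s t = 1 - j * (1 / (N : ℝ)) ∧
      P.decayRel N j s t ∧ P.decayRel N j t s ∧
      ∀ j' ≤ r, P.decayRel N j' s t → P.decayRel N j' t s → j' ≤ j) :
    HaltsWithin (block [
      forPairs (.setNat kNext (nvar kS) (nvar kT) (.get kRel (nvar kS) (nvar kT))),
      forPairs
        (forRange kA (.lit 0) (nvar kActs)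
          (forRange kI (.lit 0) (.get kCount (nvar kS) (nvar kA))
            (treatTransition flow))),
      forPairs (.setNat kRel (nvar kS) (nvar kT) (.get kNext (nvar kS) (nvar kT))),
      forPairs
        (.cond (.and (.eqNat (.get kRel (nvar kS) (nvar kT)) (.lit 1))
            (.eqNat (.get kRel (nvar kT) (nvar kS)) (.lit 1)))
          (.setReal kDist (nvar kS) (nvar kT) tolerance)
          .skip)]) σ
      ((1000012000003000001 + 640000000000 * K) * (n ^ 5 * k * P.maxBranching ^ 2)) fun σ' =>
      AgreeOff [kU, kW, kCalls, kFound, kJ, kNext, kI, kA, kS, kT, kRel] [kMass, kDist] σ σ' ∧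
      σ'.nat kCalls 0 0 ≤ σ.nat kCalls 0 0 + n * n * (k * (P.maxBranching * P.maxBranching)) ∧
      (∀ s t : Fin n, σ'.nat kRel s t = 1 ↔ P.decayRel N (r + 1) s t) ∧
      ∀ s t : Fin n, ∃ j ≤ r + 1, σ'.real kDist s t = 1 - j * (1 / (N : ℝ)) ∧
        P.decayRel N j s t ∧ P.decayRel N j t s ∧
        ∀ j' ≤ r + 1, P.decayRel N j' s t → P.decayRel N j' t s → j' ≤ j := by
  set A := [kU, kW, kCalls, kFound, kJ, kNext, kI, kA, kS, kT, kRel] with hA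
  set B := [kMass, kDist] with hB
  have hs := hP.1
  have hst : ∀ τ, AgreeOff A B σ τ → τ.nat kStates 0 0 = n := fun τ h => by
    rw [h.nat_eq (by decide)]; exact hs
  have htol : tolerance.eval σ = 1 - ((r + 1 : ℕ) : ℝ) * (1 / (N : ℝ)) := by
    simp only [tolerance, RExp.eval, NExp.eval, nvar_eval, rvar_eval, hround, hδ, Nat.cast_one]
  have htol0 : 0 ≤ tolerance.eval σ := by
    have hN0 : (N : ℝ) ≠ 0 := Nat.cast_ne_zero.2 (by omega)
    have h1 : ((r + 1 : ℕ) : ℝ) * (1 / (N : ℝ)) ≤ (N : ℝ) * (1 / (N : ℝ)) :=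
      mul_le_mul_of_nonneg_right (Nat.cast_le.2 hr) (by positivity)
    rw [mul_one_div_cancel hN0] at h1
    rw [htol]; linarith
  have hcur : currentRel n σ = P.decayRel N r := by
    funext s t; exact propext (hrel s t)
  have hnn : n * n ≤ n ^ 5 * k * P.maxBranching ^ 2 := by
    have h3 : 1 ≤ n ^ 3 * k * P.maxBranching ^ 2 :=
      Nat.mul_pos (Nat.mul_pos (Nat.one_le_pow _ _ hn) hk) (Nat.one_le_pow _ _ hl)
    calc n * n = n * n * 1 := by ring
      _ ≤ n * n * (n ^ 3 * k * P.maxBranching ^ 2) := Nat.mul_le_mul_left _ h3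
      _ = _ := by ring
  have hn1 : 1 ≤ n * n := Nat.mul_pos hn hn
  have e1 : 100 * (n * (100 * (n * 100))) = 1000000 * (n * n) := by ring
  have e2 : 100 * (n * (100 * (n * (100 * (k * (100 * (P.maxBranching *
        ((10000120000 + 6400 * K) * (P.maxBranching * n ^ 3)))))))))
      = (1000012000000000000 + 640000000000 * K) * (n ^ 5 * k * P.maxBranching ^ 2) := by ring
  -- The surplus pays for the two copies and the update of the distances, each at most 1000000 n²
  -- steps, and for the final `skip`.
  have e3 : (1000012000003000001 + 640000000000 * K) * (n ^ 5 * k * P.maxBranching ^ 2)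
      = (1000012000000000000 + 640000000000 * K) * (n ^ 5 * k * P.maxBranching ^ 2)
        + 3000001 * (n ^ 5 * k * P.maxBranching ^ 2) := by ring
  refine HaltsWithin.mono (HaltsWithin.seq ((haltsWithin_copy hn hs (by decide) (by decide)
    (by decide)).mono le_rfl fun τ₁ h₁ => HaltsWithin.seq (HaltsWithin.mono
      (haltsWithin_treatPairs (N := N) (P := P) hflow ?_ hl hn hk ?_) le_rfl fun τ₂ h₂ =>
      HaltsWithin.seq (HaltsWithin.mono (haltsWithin_copy hn ?_ (by decide) (by decide)
        (by decide)) le_rfl fun τ₃ h₃ => HaltsWithin.seq_skip (HaltsWithin.mono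
          (haltsWithin_updateDist hn ?_) le_rfl fun τ₄ h₄ => ?_))))) (by omega) fun _ h => h
  · exact hP.of_agreeOff h₁.1 (by decide) (by decide)
  · rw [h₁.1.tolerance_eval (by decide) (by decide)]; exact htol0
  · refine hst τ₂ ?_
    exact (h₁.1.mono (by decide) (by decide)).trans (h₂.1.mono (by decide) (by decide))
  · refine hst τ₃ ?_
    exact ((h₁.1.mono (by decide) (by decide)).trans (h₂.1.mono (by decide) (by decide))).trans
      (h₃.1.mono (by decide) (by decide))
  obtain ⟨hag₁, hcopy₁⟩ := h₁
  obtain ⟨hag₂, hcalls, hnext⟩ := h₂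
  obtain ⟨hag₃, hcopy₃⟩ := h₃
  obtain ⟨hag₄, hd⟩ := h₄
  rw [hag₁.tolerance_eval (by decide) (by decide), htol, hag₁.currentRel_eq n (by decide), hcur]
    at hnext
  have hag₁₃ : AgreeOff A B σ τ₃ :=
    ((hag₁.mono (by decide) (by decide)).trans (hag₂.mono (by decide) (by decide))).trans
      (hag₃.mono (by decide) (by decide))
  have hrel₃ : ∀ s t : Fin n, τ₃.nat kRel s t = 1 ↔ P.decayRel N (r + 1) s t := fun s t => by
    rw [hcopy₃ s s.2 t t.2, hnext, hcopy₁ s s.2 t t.2, hrel]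
    rfl
  have hdist₃ : τ₃.real kDist = σ.real kDist := by
    rw [hag₃.real_eq (by decide), hag₂.real_eq (by decide), hag₁.real_eq (by decide)]
  refine ⟨hag₁₃.trans (hag₄.mono (by decide) (by decide)), ?_, fun s t => ?_, fun s t => ?_⟩
  · rw [hag₄.nat_eq (by decide), hag₃.nat_eq (by decide)]
    rwa [hag₁.nat_eq (x := kCalls) (by decide)] at hcalls
  · rw [hag₄.nat_eq (by decide)]; exact hrel₃ s t
  · have hd' := hd s s.2 t t.2
    rw [hrel₃, hrel₃, hdist₃, hag₁₃.tolerance_eval (by decide) (by decide), htol] at hd'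
    -- If the pair survives in both directions, the new round becomes its last one; otherwise the
    -- earlier record stands.
    by_cases hb : P.decayRel N (r + 1) s t ∧ P.decayRel N (r + 1) t s
    · exact ⟨r + 1, le_rfl, hd'.1 hb, hb.1, hb.2, fun j' hj' _ _ => hj'⟩
    · obtain ⟨j, hj, hv, h1, h2, hlast⟩ := hdist s t
      refine ⟨j, by omega, (hd'.2 hb).trans hv, h1, h2, fun j' hj' h1' h2' => ?_⟩
      rcases Nat.le_succ_iff.1 hj' with h | rfl
      · exact hlast j' h h1' h2'
      · exact absurd ⟨h1', h2'⟩ hb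

theorem haltsWithin_algorithmC {flow : Prog} {K n k N : ℕ} (hflow : MaxFlowBound flow K)
    {P : FinitePA (Fin n) (Fin k)} {σ : Mem} (hP : HoldsInput σ P N) (hN : 1 ≤ N)
    (hl : 1 ≤ P.maxBranching) :
    HaltsWithin (algorithmC flow) σ
      ((100001200000302000000 + 64000000000000 * K) * N * (n ^ 5 * k * P.maxBranching ^ 2))
      fun σ' => σ'.nat kCalls 0 0 ≤ N * n ^ 2 * k * P.maxBranching ^ 2 ∧
        ∀ s t : Fin n,
          P.IsDecayDistance (FinitePA.linearDecay N) s t (σ'.real kDist s t) := by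
  -- The supremum over an empty index set is 0, so l ≥ 1 provides a state and an action.
  obtain ⟨hn, hk⟩ : 1 ≤ n ∧ 1 ≤ k := by
    obtain ⟨p, -, -⟩ := Finset.lt_sup_iff.1 (Nat.lt_of_succ_le hl)
    exact ⟨Nat.one_le_of_lt p.1.2, Nat.one_le_of_lt p.2.2⟩
  set X := n ^ 5 * k * P.maxBranching ^ 2 with hX
  have hnn : n * n ≤ X := by
    have h3 : 1 ≤ n ^ 3 * k * P.maxBranching ^ 2 :=
      Nat.mul_pos (Nat.mul_pos (Nat.one_le_pow _ _ hn) hk) (Nat.one_le_pow _ _ hl)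
    calc n * n = n * n * 1 := by ring
      _ ≤ n * n * (n ^ 3 * k * P.maxBranching ^ 2) := Nat.mul_le_mul_left _ h3
      _ = _ := by ring
  have hX1 : 1 ≤ X := le_trans (Nat.mul_pos hn hn) hnn
  have hNX : X ≤ N * X := Nat.le_mul_of_pos_left _ hN
  set A := [kU, kW, kCalls, kFound, kJ, kNext, kI, kA, kS, kT, kRel, kN] with hA
  set B := [kMass, kDist, kDelta] with hB
  set c := n * n * (k * (P.maxBranching * P.maxBranching)) with hc
  refine HaltsWithin.mono (T := 1001000 * (n * n) +
    (100 * (N * ((1000012000003000001 + 640000000000 * K) * X)) + 1))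
    (HaltsWithin.seq ((haltsWithin_initialise hn hP.1 hP.2.2.1).mono le_rfl
      fun τ₀ h₀ => HaltsWithin.seq_skip ?_)) ?_ fun _ h => h
  · obtain ⟨hag₀, hδ₀, hcalls₀, hinit₀⟩ := h₀
    -- The counter runs from 1 to N + 1, so its value i means that i - 1 rounds are complete. The
    -- distance cell records the last of them that relates the pair in both directions.
    refine haltsWithin_forRange (fun i τ => AgreeOff A B σ τ ∧ τ.real kDelta 0 0 = 1 / (N : ℝ) ∧
      τ.nat kCalls 0 0 ≤ (i - 1) * c ∧
      (∀ s t : Fin n, τ.nat kRel s t = 1 ↔ P.decayRel N (i - 1) s t) ∧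
      ∀ s t : Fin n, ∃ j ≤ i - 1, τ.real kDist s t = 1 - j * (1 / (N : ℝ)) ∧
        P.decayRel N j s t ∧ P.decayRel N j t s ∧
        ∀ j' ≤ i - 1, P.decayRel N j' s t → P.decayRel N j' t s → j' ≤ j)
      1 (N + 1) N _ rfl (by omega) (by omega) hN (Nat.mul_pos (by omega) hX1) (by decide)
      (by decide) ?_ ?_ ?_ ?_
    · refine ⟨(hag₀.mono (by decide) (by decide)).updateNat (by decide) _ _ _, hδ₀, ?_,
        fun s t => ?_, fun s t => ⟨0, Nat.zero_le _, ?_, trivial, trivial, fun j' hj' _ _ => hj'⟩⟩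
      · rw [updateNat_nat_of_ne _ _ _ _ (by decide), hcalls₀]; exact Nat.zero_le _
      · rw [updateNat_nat_of_ne _ _ _ _ (by decide)]
        exact ⟨fun _ => trivial, fun _ => (hinit₀ s s.2 t t.2).2⟩
      · rw [updateNat_real, (hinit₀ s s.2 t t.2).1]; simp
    · rintro i τ ⟨hag, -⟩ -
      simp only [NExp.eval, nvar_eval, hag.nat_eq (x := kRounds) (by decide), hP.2.2.1]
    · rintro i τ h1 hi ⟨hag, hδ, hcalls, hrel, hdist⟩ hround
      obtain ⟨r, rfl⟩ : ∃ r, i = r + 1 := ⟨i - 1, by omega⟩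
      rw [Nat.add_sub_cancel] at hcalls hrel hdist
      refine (haltsWithin_round hflow (hP.of_agreeOff hag (by decide) (by decide)) hl hn hk
        (by omega) hround hδ hrel hdist).mono le_rfl ?_
      rintro τ' ⟨hag', hcalls', hrel', hdist'⟩
      refine ⟨?_, ?_, ?_, ?_, ?_, hdist'⟩
      · rw [hag'.nat_eq (by decide)]; exact hround
      · exact (hag.trans (hag'.mono (by decide) (by decide))).updateNat (by decide) _ _ _
      · rw [updateNat_real, hag'.real_eq (by decide)]; exact hδ
      · rw [updateNat_nat_of_ne _ _ _ _ (by decide), Nat.add_sub_cancel, add_mul r 1, one_mul]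
        omega
      · intro s t
        rw [updateNat_nat_of_ne _ _ _ _ (by decide)]
        exact hrel' s t
    · rintro τ ⟨-, -, hcalls, -, hdist⟩
      rw [Nat.add_sub_cancel] at hcalls hdist
      refine ⟨hcalls.trans (le_of_eq ?_), fun s t => ?_⟩
      · rw [hc]; ring
      · obtain ⟨j, hj, hv, h1, h2, hlast⟩ := hdist s t
        rw [hv]
        exact FinitePA.isDecayDistance_of_last hN hj h1 h2 hlast
  · have e1 : 100 * (N * ((1000012000003000001 + 640000000000 * K) * X))
        = 100001200000300000100 * (N * X) + 64000000000000 * (K * (N * X)) := by ring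
    have e2 : (100001200000302000000 + 64000000000000 * K) * N * X
        = 100001200000302000000 * (N * X) + 64000000000000 * (K * (N * X)) := by ring
    omega

end RealRAM

/-- There is a maximum-flow routine that runs in cubic time on a real RAM. With any such routine,
Algorithm C outputs the decayed distance for the linear discount with step `1 / N`, in
`O(N * |S| ^ 5 * |Act| * l ^ 2)` steps and with at most `N * |S| ^ 2 * |Act| * l ^ 2` flow
computations. -/
theorem mainTheorem9 :
    (∃ flow : RealRAM.Prog, RealRAM.IsCubicMaxFlow flow) ∧
    ∀ flow : RealRAM.Prog, RealRAM.IsCubicMaxFlow flow →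
      ∃ C : ℕ, ∀ (n k N : ℕ) (P : FinitePA (Fin n) (Fin k)) (σ : RealRAM.Mem),
        1 ≤ N → 1 ≤ P.maxBranching → RealRAM.HoldsInput σ P N →
        ∃ (σ' : RealRAM.Mem) (T : ℕ),
          RealRAM.Run (RealRAM.algorithmC flow) σ σ' T ∧
          T ≤ C * N * (n ^ 5 * k * P.maxBranching ^ 2) ∧
          σ'.nat RealRAM.kCalls 0 0 ≤ N * n ^ 2 * k * P.maxBranching ^ 2 ∧
          ∀ s t : Fin n,
            P.IsDecayDistance (FinitePA.linearDecay N) s t (σ'.real RealRAM.kDist s t) := by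
  refine ⟨⟨_, RealRAM.isCubicMaxFlow_pushRelabel⟩, fun flow hflow => ?_⟩
  -- K is fixed before the automaton and N are introduced, so the final constant depends on the flow
  -- routine alone.
  obtain ⟨K, hK⟩ := hflow.exists_maxFlowBound
  refine ⟨100001200000302000000 + 64000000000000 * K, fun n k N P σ hN hl hP => ?_⟩
  obtain ⟨σ', T, hr, hT, hcalls, hdist⟩ := RealRAM.haltsWithin_algorithmC hK hP hN hl
  exact ⟨σ', T, hr, hT, hcalls, hdist⟩
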